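/- **Conventions.** Alphabets are finite sets with at least two symbols, and $\varepsilon$ is the empty word. An infinite word $x$ over $A$ is *normal* if for every $\ell\ge 1$ and every $u\in A^\ell$ the proportion of indices $i\in\{0,\dots,n-1\}$ such that $u$ is the block $x[i\ell+1..(i+1)\ell]$ tends to $|A|^{-\ell}$ as $n\to\infty$. A *$k$-automaton* with tape alphabets $A_1,\dots,A_k$ consists of a finite set $Q$ of states, a set of initial states and a set of transitions $p\xrightarrow{\alpha_1,\dots,\alpha_k}q$ with $p,q\in Q$ and $\alpha_i\in A_i\cup\{\varepsilon\}$. The label of an infinite run (an infinite sequence of consecutive transitions) is the componentwise concatenation of the labels of its transitions; the run is *accepting* if it starts in an initial state and all $k$ components of its label are infinite. The automaton is *$\ell$-deterministic* if it has exactly one initial state and, for each state $q$, all transitions starting at $q$ have the same set of positions $i\le\ell$ with $\alpha_i\ne\varepsilon$ (the $\ell$-support of $q$), but pairwise different $\ell$-labels $(\alpha_1,\dots,\alpha_\ell)$. It is then *$\ell$-complete* if for each state $q$ every $\ell$-label whose support is the $\ell$-support of $q$ occurs on a transition starting at $q$. An $\ell$-deterministic $k$-automaton $\mathcal A$ realizes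 a partial function: $\mathcal A(x_1,\dots,x_\ell)=(x_{\ell+1},\dots,x_k)$ if there is an accepting run with label $(x_1,\dots,x_k)$. A *compressor* is either a $1$-deterministic $2$-automaton $\mathcal A$ for which $x\mapsto\mathcal A(x)$ is one-to-one, or a $2$-deterministic $3$-automaton $\mathcal A$ for which $x\mapsto\mathcal A(x,y)$ is one-to-one for each fixed $y$. If $x$ is a word over $A$, the output alphabet of $\mathcal A$ is $C$, and the first $n$ transitions of the accepting run on $x$ (respectively on $x$ and $y$) read $a_n$ symbols of $x$ and write $c_n$ symbols, then $\rho_{\mathcal A}(x)$ (respectively $\rho_{\mathcal A}(x/y)$) is $\liminf_{n\to\infty}\frac{c_n\log|C|}{a_n\log|A|}$. Let $\rho(x)$ and $\rho(x/y)$ be the infima of these ratios over all compressors of the respective kind that have such an accepting run (over all output alphabets). Infinite words $x$ and $y$, possibly over different alphabets, are *finite-state independent* if $\rho(x/y)=\rho(x)\neq 0$ and $\rho(y/x)=\rho(y)\neq 0$. The Markov chain associated with a $2$-deterministic $2$-automaton with tape alphabets $A$ and $B$ has the matrix $M$ indexed by $Q\times Q$ whose $(p,q)$-entry is the sum of the weights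 of the transitions $p\xrightarrow{\alpha,\beta}q$; the weight is the product of a factor $1/|A|$ if $\alpha\neq\varepsilon$ and a factor $1/|B|$ if $\beta\ne\varepsilon$. The *stationary distribution* $\pi$ is the unique row vector with $\pi M=\pi$ and $\sum_q\pi(q)=1$. A *selector* (from a word over $A$ with an oracle over $B$) is a $2$-deterministic $3$-automaton all of whose transitions have labels of one of the types $(a,\varepsilon,a)$, $(a,\varepsilon,\varepsilon)$, $(\varepsilon,b,\varepsilon)$ with $a\in A$, $b\in B$; it is *oblivious* if all transitions starting at the same state have the same type. A *shuffler* over $A$ is a $2$-deterministic $3$-automaton all of whose transitions have labels of one of the types $(a,\varepsilon,a)$, $(\varepsilon,a,a)$ with $a\in A$. **Theorem (Characterization Theorem).** Let $x$ and $y$ be normal words over the alphabets $A$ and $B$. The following statements are equivalent. 1. $x$ and $y$ are finite-state independent. 2. For every strongly connected $2$-deterministic $2$-automaton $\mathcal A$ and every infinite run $\gamma$ of $\mathcal A$ whose label consists of an (infinite) suffix of $x$ and an (infinite) suffix of $y$, $\mathcal A$ is $2$-complete and for every state $q$ the proportion of indices $i\le n$ such that the $i$-th transition of $\gamma$ starts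 at $q$ tends to $\pi(q)$ as $n\to\infty$, where $\pi$ is the stationary distribution associated with $\mathcal A$. 3. For every oblivious selector $\mathcal S$ from words over $A$ with an oracle over $B$, $\mathcal S(x,y)$ is normal whenever it is defined, and for every oblivious selector $\mathcal S$ from words over $B$ with an oracle over $A$, $\mathcal S(y,x)$ is normal whenever it is defined. Furthermore, if $A=B$, the following statement is also equivalent to these. 4. For every shuffler $\mathcal S$ over $A$, $\mathcal S(x,y)$ is normal whenever it is defined. -/

import Mathlib

open Filter Topology

noncomputable section

namespace FSI

/-! ### Normal words

An infinite word over `A` is a function `ℕ → A`; positions are numbered from `0`. -/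

/-- The number of aligned occurrences of the block `u` of length `ℓ` among the first `n`
aligned blocks of length `ℓ` of `x`. -/
def alignedOcc {A : Type*} (x : ℕ → A) {ℓ : ℕ} (u : Fin ℓ → A) (n : ℕ) : ℕ :=
  open Classical in Nat.count (fun i => ∀ j : Fin ℓ, x (i * ℓ + j) = u j) n

/-- `x` is simply normal to word length `ℓ`. -/
def IsSimplyNormal {A : Type*} [Fintype A] (x : ℕ → A) (ℓ : ℕ) : Prop :=
  ∀ u : Fin ℓ → A,
    Tendsto (fun n : ℕ => (alignedOcc x u n : ℝ) / n) atTop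
      (𝓝 (((Fintype.card A : ℝ) ^ ℓ)⁻¹))

/-- `x` is normal: it is simply normal to every (positive) word length. -/
def IsNormal {A : Type*} [Fintype A] (x : ℕ → A) : Prop :=
  ∀ ℓ : ℕ, 0 < ℓ → IsSimplyNormal x ℓ

/-! ### Words spelled by sequences of symbols and empty words

An element of `Option A` is a symbol of `A` or, in case of `none`, the empty word. -/

/-- The length of the concatenation of the first `n` terms of `α`. -/
def lengthRead {A : Type*} (α : ℕ → Option A) (n : ℕ) : ℕ :=
  Nat.count (fun i => (α i).isSome) n

/-- The concatenation `α 0 · α 1 · α 2 ⋯` is infinite and equal to the infinite word `x`. -/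
def Spells {A : Type*} (α : ℕ → Option A) (x : ℕ → A) : Prop :=
  (∀ n a, α n = some a → x (lengthRead α n) = a) ∧ ∀ m, ∃ n, m ≤ n ∧ (α n).isSome

/-- The suffix of `x` obtained by removing its first `i` symbols. -/
def suffix {A : Type*} (x : ℕ → A) (i : ℕ) : ℕ → A := fun n => x (i + n)

/-! ### Automata -/

/-- An automaton with state set `Q` and transition labels in `L`. A transition is a triple
(starting state, label, ending state). -/
structure Automaton (L Q : Type*) where
  /-- The transition relation. -/
  trans : Set (Q × L × Q)
  /-- The set of initial states. -/
  init : Set Q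

/-- Automata with two tapes, over the alphabets `A` and `B`. -/
abbrev TwoAutomaton (A B Q : Type*) := Automaton (Option A × Option B) Q

/-- Automata with three tapes, over the alphabets `A`, `B` and `C`. -/
abbrev ThreeAutomaton (A B C Q : Type*) := Automaton (Option A × Option B × Option C) Q

namespace Automaton

variable {L Q : Type*}

/-- The states `s 0, s 1, …` and the labels `l 0, l 1, …` form an infinite run
`s 0 → s 1 → s 2 → ⋯`, where the transition from `s n` to `s (n + 1)` has label `l n`. -/
def IsRun (M : Automaton L Q) (s : ℕ → Q) (l : ℕ → L) : Prop :=
  ∀ n, (s n, l n, s (n + 1)) ∈ M.trans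

/-- Every state can be reached from every state. -/
def StronglyConnected (M : Automaton L Q) : Prop :=
  ∀ p q : Q, Relation.ReflTransGen (fun p' q' => ∃ l, (p', l, q') ∈ M.trans) p q

/-- Determinism with respect to a part `inp` of the label, whose support is given by `supp`:
there is exactly one initial state, and all transitions starting at a given state have input
labels of the same support, but pairwise different input labels. -/
def IsDeterministic {I S : Type*} (M : Automaton L Q) (inp : L → I) (supp : I → S) : Prop :=
  (∃ q₀, M.init = {q₀}) ∧
    ∀ p l q l' q', (p, l, q) ∈ M.trans → (p, l', q') ∈ M.trans →
      supp (inp l) = supp (inp l') ∧ (inp l = inp l' → l = l' ∧ q = q')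

/-- Completeness with respect to a part `inp` of the label: if a state is the start of some
transition, then every input label with the support of this transition labels a transition
starting at this state. -/
def IsComplete {I S : Type*} (M : Automaton L Q) (inp : L → I) (supp : I → S) : Prop :=
  ∀ p l q, (p, l, q) ∈ M.trans → ∀ α : I, supp α = supp (inp l) →
    ∃ l' q', (p, l', q') ∈ M.trans ∧ inp l' = α

end Automaton

/-- The support of a label on one tape: whether the tape is read. -/
def supp₁ {A : Type*} (α : Option A) : Bool := α.isSome

/-- The support of a label on two tapes: which of the tapes are read. -/
def supp₂ {A B : Type*} (α : Option A × Option B) : Bool × Bool := (α.1.isSome, α.2.isSome)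

namespace TwoAutomaton

variable {A B Q : Type*}

/-- `1`-deterministic automata with two tapes. -/
def IsDet₁ (M : TwoAutomaton A B Q) : Prop := M.IsDeterministic (fun l => l.1) supp₁

/-- `2`-deterministic automata with two tapes. -/
def IsDet₂ (M : TwoAutomaton A B Q) : Prop := M.IsDeterministic (fun l => l) supp₂

/-- `2`-complete automata with two tapes. -/
def IsComplete₂ (M : TwoAutomaton A B Q) : Prop := M.IsComplete (fun l => l) supp₂

/-- `(s, l)` is an infinite run with label `⟨x, y⟩`, where both words are infinite; the first
state is arbitrary. -/
def IsRunOn (M : TwoAutomaton A B Q) (s : ℕ → Q) (l : ℕ → Option A × Option B)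
    (x : ℕ → A) (y : ℕ → B) : Prop :=
  M.IsRun s l ∧ Spells (fun n => (l n).1) x ∧ Spells (fun n => (l n).2) y

/-- `(s, l)` is an accepting run with label `⟨x, y⟩`. -/
def IsAcceptingRun (M : TwoAutomaton A B Q) (s : ℕ → Q) (l : ℕ → Option A × Option B)
    (x : ℕ → A) (y : ℕ → B) : Prop :=
  M.IsRunOn s l x y ∧ s 0 ∈ M.init

/-- The pair `⟨x, y⟩` is accepted. -/
def Accepts (M : TwoAutomaton A B Q) (x : ℕ → A) (y : ℕ → B) : Prop :=
  ∃ s l, M.IsAcceptingRun s l x y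

/-- A compressor: a `1`-deterministic automaton with two tapes (input, output) for which the
partial function mapping the input to the output is one-to-one. -/
def IsCompressor (M : TwoAutomaton A B Q) : Prop :=
  M.IsDet₁ ∧ ∀ x x' z, M.Accepts x z → M.Accepts x' z → x = x'

/-- The weight of a label: a factor `1 / |A|` if a symbol is read on the first tape, and a factor
`1 / |B|` if a symbol is read on the second tape. -/
def weight [Fintype A] [Fintype B] (l : Option A × Option B) : ℝ :=
  (if l.1.isSome then 1 / (Fintype.card A : ℝ) else 1) *
    (if l.2.isSome then 1 / (Fintype.card B : ℝ) else 1)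

/-- The matrix of the Markov chain associated with the automaton: the entry at `(p, q)` is the
sum of the weights of the transitions from `p` to `q`. -/
def markovMatrix [Fintype A] [Fintype B] (M : TwoAutomaton A B Q) : Matrix Q Q ℝ :=
  fun p q => open Classical in
    ∑ l : Option A × Option B, if (p, l, q) ∈ M.trans then weight l else 0

/-- `π` is the stationary distribution of the Markov chain associated with the automaton, that is,
the unique row vector with `π M = π` whose entries sum up to `1`. -/
def IsStationaryDistribution [Fintype A] [Fintype B] [Fintype Q] (M : TwoAutomaton A B Q)
    (π : Q → ℝ) : Prop :=
  (Matrix.vecMul π M.markovMatrix = π ∧ ∑ q, π q = 1) ∧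
    ∀ π' : Q → ℝ, Matrix.vecMul π' M.markovMatrix = π' → ∑ q, π' q = 1 → π' = π

end TwoAutomaton

namespace ThreeAutomaton

variable {A B C Q : Type*}

/-- `2`-deterministic automata with three tapes. -/
def IsDet₂ (M : ThreeAutomaton A B C Q) : Prop :=
  M.IsDeterministic (fun l => (l.1, l.2.1)) supp₂

/-- `(s, l)` is an accepting run with label `⟨x, y, z⟩`. -/
def IsAcceptingRun (M : ThreeAutomaton A B C Q) (s : ℕ → Q)
    (l : ℕ → Option A × Option B × Option C) (x : ℕ → A) (y : ℕ → B) (z : ℕ → C) : Prop :=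
  M.IsRun s l ∧ s 0 ∈ M.init ∧ Spells (fun n => (l n).1) x ∧ Spells (fun n => (l n).2.1) y ∧
    Spells (fun n => (l n).2.2) z

/-- The triple `⟨x, y, z⟩` is accepted. If the automaton is `2`-deterministic, this means that
the partial function that it realizes is defined at `⟨x, y⟩` and has the value `z` there. -/
def Accepts (M : ThreeAutomaton A B C Q) (x : ℕ → A) (y : ℕ → B) (z : ℕ → C) : Prop :=
  ∃ s l, M.IsAcceptingRun s l x y z

/-- A compressor (with oracle): a `2`-deterministic automaton with three tapes (input, oracle,
output) such that for each fixed `y`, the partial function mapping `x` to the output on `⟨x, y⟩`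
is one-to-one. -/
def IsCompressor (M : ThreeAutomaton A B C Q) : Prop :=
  M.IsDet₂ ∧ ∀ y x x' z, M.Accepts x y z → M.Accepts x' y z → x = x'

end ThreeAutomaton

/-! ### Finite-state independence -/

/-- The lower limit of the quotients (length of the output) / (length of the input) along a run,
where `α` lists the labels on the input tape (over `A`) and `β` those on the output tape (over
`C`), and where lengths are measured in bits: the quotient is multiplied by
`log |C| / log |A|`, which is `1` if the two alphabets have the same size. -/
def compressionRatio {A C : Type*} [Fintype A] [Fintype C]
    (α : ℕ → Option A) (β : ℕ → Option C) : ENNReal :=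
  liminf (fun n : ℕ => ENNReal.ofReal
    (((lengthRead β n : ℝ) / (lengthRead α n : ℝ)) *
      (Real.log (Fintype.card C) / Real.log (Fintype.card A)))) atTop

/-- The compression ratio `ρ(x)`: the infimum of the compression ratios of `x` achieved by
compressors with two tapes, over all output alphabets with at least two symbols. -/
def rho {A : Type*} [Fintype A] (x : ℕ → A) : ENNReal :=
  sInf {r | ∃ (C Q : Type) (_ : Fintype C) (_ : Nontrivial C) (_ : Finite Q)
    (M : TwoAutomaton A C Q) (s : ℕ → Q) (l : ℕ → Option A × Option C) (z : ℕ → C),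
    TwoAutomaton.IsCompressor M ∧ TwoAutomaton.IsAcceptingRun M s l x z ∧
      r = compressionRatio (fun n => (l n).1) (fun n => (l n).2)}

/-- The conditional compression ratio `ρ(x/y)`: the infimum of the compression ratios of `x` with
oracle `y` achieved by compressors with three tapes, over all output alphabets with at least two
symbols. -/
def condRho {A B : Type*} [Fintype A] (x : ℕ → A) (y : ℕ → B) : ENNReal :=
  sInf {r | ∃ (C Q : Type) (_ : Fintype C) (_ : Nontrivial C) (_ : Finite Q)
    (M : ThreeAutomaton A B C Q) (s : ℕ → Q) (l : ℕ → Option A × Option B × Option C)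
    (z : ℕ → C),
    ThreeAutomaton.IsCompressor M ∧ ThreeAutomaton.IsAcceptingRun M s l x y z ∧
      r = compressionRatio (fun n => (l n).1) (fun n => (l n).2.2)}

/-- `x` and `y` are finite-state independent. -/
def Independent {A B : Type*} [Fintype A] [Fintype B] (x : ℕ → A) (y : ℕ → B) : Prop :=
  condRho x y = rho x ∧ condRho y x = rho y ∧ rho x ≠ 0 ∧ rho y ≠ 0

/-! ### Frequencies of states -/

/-- Every strongly connected `2`-deterministic automaton with two tapes that has an infinite run
on a suffix of `x` and a suffix of `y` is `2`-complete, and the frequency of each state in each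
such run is given by the stationary distribution associated with the automaton. -/
def StateFrequencies {A B : Type*} [Fintype A] [Fintype B] (x : ℕ → A) (y : ℕ → B) : Prop :=
  ∀ (Q : Type) [Fintype Q] (M : TwoAutomaton A B Q),
    TwoAutomaton.IsDet₂ M → M.StronglyConnected →
    ∀ (i j : ℕ) (s : ℕ → Q) (l : ℕ → Option A × Option B),
      TwoAutomaton.IsRunOn M s l (suffix x i) (suffix y j) →
      TwoAutomaton.IsComplete₂ M ∧
        ∃ π : Q → ℝ, TwoAutomaton.IsStationaryDistribution M π ∧
          ∀ q : Q, Tendsto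
            (fun n : ℕ => ((open Classical in Nat.count (fun k => s k = q) n : ℕ) : ℝ) / n)
            atTop (𝓝 (π q))

/-! ### Selectors and shufflers -/

/-- A label `a, ε | a`: a symbol of the first input tape is copied. -/
def CopiesFirst {A B : Type*} (l : Option A × Option B × Option A) : Prop :=
  ∃ a, l = (some a, none, some a)

/-- A label `a, ε | ε`: a symbol of the first input tape is skipped. -/
def SkipsFirst {A B : Type*} (l : Option A × Option B × Option A) : Prop :=
  ∃ a, l = (some a, none, none)

/-- A label `ε, b | ε`: a symbol of the second input tape is skipped. -/
def SkipsSecond {A B : Type*} (l : Option A × Option B × Option A) : Prop :=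
  ∃ b, l = (none, some b, none)

/-- A label `ε, a | a`: a symbol of the second input tape is copied. -/
def CopiesSecond {A : Type*} (l : Option A × Option A × Option A) : Prop :=
  ∃ a, l = (none, some a, some a)

namespace ThreeAutomaton

/-- Selectors. -/
def IsSelector {A B Q : Type*} (M : ThreeAutomaton A B A Q) : Prop :=
  M.IsDet₂ ∧ ∀ p l q, (p, l, q) ∈ M.trans → CopiesFirst l ∨ SkipsFirst l ∨ SkipsSecond l

/-- All transitions starting at a given state have the same type. -/
def IsOblivious {A B Q : Type*} (M : ThreeAutomaton A B A Q) : Prop :=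
  ∀ p l q l' q', (p, l, q) ∈ M.trans → (p, l', q') ∈ M.trans →
    (CopiesFirst l ↔ CopiesFirst l') ∧ (SkipsFirst l ↔ SkipsFirst l') ∧
      (SkipsSecond l ↔ SkipsSecond l')

/-- Shufflers. -/
def IsShuffler {A Q : Type*} (M : ThreeAutomaton A A A Q) : Prop :=
  M.IsDet₂ ∧ ∀ p l q, (p, l, q) ∈ M.trans → CopiesFirst l ∨ CopiesSecond l

end ThreeAutomaton

/-- Every oblivious selector that is defined at `⟨x, y⟩` outputs a normal word there. -/
def SelectionsNormal {A B : Type*} [Fintype A] (x : ℕ → A) (y : ℕ → B) : Prop :=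
  ∀ (Q : Type) [Finite Q] (S : ThreeAutomaton A B A Q),
    ThreeAutomaton.IsSelector S → ThreeAutomaton.IsOblivious S →
      ∀ z : ℕ → A, ThreeAutomaton.Accepts S x y z → IsNormal z

/-- Every shuffler that is defined at `⟨x, y⟩` outputs a normal word there. -/
def ShufflesNormal {A : Type*} [Fintype A] (x y : ℕ → A) : Prop :=
  ∀ (Q : Type) [Finite Q] (S : ThreeAutomaton A A A Q),
    ThreeAutomaton.IsShuffler S →
      ∀ z : ℕ → A, ThreeAutomaton.Accepts S x y z → IsNormal z

end FSI

end

noncomputable section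

namespace FSI

open Asymptotics

/-! ### Indicators -/

/-! Everything is reduced to one property of deterministic runs on `x` and `y`: at each state, the
possible labels occur as often as independent uniform symbols would produce them, up to an error
o(n) (`Equidistributed`). Its weakest form, `HalfUniform`, concerns runs that read one symbol at a
time, and only the symbols of one tape. Its strongest form, `RunsErgodic`, adds that states visited
infinitely often have positive lower density.

State frequencies. `HalfUniform` in both directions gives equidistribution of all runs on suffixes:
transitions reading both tapes are split, silent ones dropped, missing prefixes prepended
(`uniform_of_halfUniform`). Equidistribution makes every limit point of the state frequencies an
invariant vector of the Markov chain, and strong connectivity leaves only one such probability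
vector (`stateFrequencies_of_uniform`). Conversely, `runsErgodic_of_stateFrequencies` applies the
statement on frequencies to an automaton whose states are the recurrent pairs of state and label of
a run.

Selectors and shufflers. A word is normal exactly if every deterministic one-tape automaton reading
it meets equidistributed symbols at each state (`isNormal_of_readsUniform`,
`readsUniform_of_isNormal`). Running such an automaton on the output of a selector or shuffler gives
again a deterministic run on `x` and `y`, so `RunsErgodic` makes the outputs normal. Conversely, a
run becomes a selector by copying the symbols read at one state, and a shuffler by copying all of
them; normality of the output is then equidistribution.

Independence. Injectivity of a compressor yields a Kraft-type bound on the weight of its paths,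
polynomial in their length (`pathWeight_le`). With this weight as a potential, equidistribution
shows that the output, in bits, cannot be shorter than the input by more than o(n)
(`eventually_gain_le`), so the conditional ratio is at least 1 (`one_le_condRho`). A one-letter
oracle gives the special case that normal words have ratio 1 (`rho_eq_one`), hence independence of
normal words means that both conditional ratios are 1. Conversely, if the symbols of `x` are biased
at some state, a block code that treats the symbols read there separately from the others makes the
conditional ratio smaller than 1 (`condRho_lt_one`, `halfUniform_of_one_le_condRho`). -/

/-- The real-valued indicator of a proposition. -/
def ind (P : Prop) : ℝ := open Classical in if P then 1 else 0

lemma ind_of {P : Prop} (h : P) : ind P = 1 := by simp [ind, h]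

lemma ind_of_not {P : Prop} (h : ¬ P) : ind P = 0 := by simp [ind, h]

lemma ind_nonneg (P : Prop) : 0 ≤ ind P := by
  by_cases h : P <;> simp [ind, h]

lemma ind_le_one (P : Prop) : ind P ≤ 1 := by
  by_cases h : P <;> simp [ind, h]

lemma ind_congr {P Q : Prop} (h : P ↔ Q) : ind P = ind Q := by rw [propext h]

lemma ind_and (P Q : Prop) : ind (P ∧ Q) = ind P * ind Q := by
  by_cases h : P <;> by_cases h' : Q <;> simp [ind, h, h']

lemma sum_ind_eq_mul {Q : Type*} [Fintype Q] (q₀ : Q) (f : Q → ℝ) :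
    ∑ q, ind (q₀ = q) * f q = f q₀ := by
  rw [Finset.sum_eq_single q₀]
  · simp [ind_of]
  · intro b _ hb
    rw [ind_of_not (fun h => hb h.symm), zero_mul]
  · simp

lemma sum_ind_eq {Q : Type*} [Fintype Q] (q₀ : Q) : ∑ q, ind (q₀ = q) = 1 := by
  simpa using sum_ind_eq_mul q₀ (fun _ => 1)

lemma count_eq_sum_ind (P : ℕ → Prop) [DecidablePred P] (n : ℕ) :
    (Nat.count P n : ℝ) = ∑ k ∈ Finset.range n, ind (P k) := by
  induction n with
  | zero => simp
  | succ n ih =>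
    rw [Nat.count_succ, Finset.sum_range_succ, ← ih]
    by_cases h : P n <;> simp [ind, h]

lemma abs_ind_sub_le {P : Prop} {w : ℝ} (h0 : 0 ≤ w) (h1 : w ≤ 1) : |ind P - w| ≤ 1 := by
  rw [abs_le]
  constructor <;> linarith [ind_nonneg P, ind_le_one P]

/-! ### Lengths of concatenations and spelled words -/

section Spelling

variable {A : Type*} {α : ℕ → Option A} {x : ℕ → A}

@[simp] lemma lengthRead_zero (α : ℕ → Option A) : lengthRead α 0 = 0 := by simp [lengthRead]

lemma lengthRead_succ_none {n : ℕ} (h : α n = none) :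
    lengthRead α (n + 1) = lengthRead α n := by
  simp [lengthRead, Nat.count_succ, h]

lemma lengthRead_succ_some {n : ℕ} {a : A} (h : α n = some a) :
    lengthRead α (n + 1) = lengthRead α n + 1 := by
  simp [lengthRead, Nat.count_succ, h]

lemma lengthRead_mono (α : ℕ → Option A) : Monotone (lengthRead α) := Nat.count_monotone _

lemma lengthRead_le (α : ℕ → Option A) (n : ℕ) : lengthRead α n ≤ n := Nat.count_le _

lemma lengthRead_eq_sum (α : ℕ → Option A) (n : ℕ) :
    (lengthRead α n : ℝ) = ∑ k ∈ Finset.range n, ind ((α k).isSome) :=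
  count_eq_sum_ind _ _

lemma lengthRead_add (α : ℕ → Option A) (m n : ℕ) :
    lengthRead α (m + n) = lengthRead α m + lengthRead (fun k => α (m + k)) n := by
  simp [lengthRead, Nat.count_add]

lemma infinite_of_frequently_isSome (h : ∀ m, ∃ n, m ≤ n ∧ (α n).isSome) :
    {n | ((α n).isSome : Prop)}.Infinite := by
  rw [← Nat.frequently_atTop_iff_infinite, frequently_atTop]
  exact h

/-- A sequence with infinitely many symbols spells a word. -/
lemma exists_spells (h : ∀ m, ∃ n, m ≤ n ∧ (α n).isSome) : ∃ x, Spells α x := by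
  obtain ⟨n₀, -, h₀⟩ := h 0
  refine ⟨fun r => (α (Nat.nth (fun n => (α n).isSome) r)).getD ((α n₀).get h₀), ?_, h⟩
  intro n a ha
  have : Nat.nth (fun n => ((α n).isSome : Prop)) (lengthRead α n) = n :=
    Nat.nth_count (p := fun n => ((α n).isSome : Prop)) (by simp [ha])
  simp [this, ha]

lemma Spells.exists_index (h : Spells α x) (r : ℕ) :
    ∃ n, α n = some (x r) ∧ lengthRead α n = r := by
  have hinf := infinite_of_frequently_isSome h.2
  have h1 := Nat.nth_mem_of_infinite hinf r
  have h2 : lengthRead α (Nat.nth (fun n => ((α n).isSome : Prop)) r) = r :=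
    Nat.count_nth_of_infinite hinf r
  obtain ⟨a, ha⟩ := Option.isSome_iff_exists.1 h1
  refine ⟨_, ?_, h2⟩
  have h3 := h.1 _ _ ha
  rw [h2] at h3
  rw [ha, h3]

lemma Spells.unique {x' : ℕ → A} (h : Spells α x) (h' : Spells α x') : x = x' := by
  funext r
  obtain ⟨n, hn, hr⟩ := h.exists_index r
  have := h'.1 n _ hn
  rw [hr] at this
  exact this.symm

lemma Spells.tendsto_lengthRead (h : Spells α x) : Tendsto (lengthRead α) atTop atTop := by
  refine tendsto_atTop_atTop_of_monotone (lengthRead_mono α) fun r => ?_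
  obtain ⟨n, -, hn⟩ := h.exists_index r
  exact ⟨n, hn.ge⟩

lemma Spells.tail (h : Spells α x) (m : ℕ) :
    Spells (fun k => α (m + k)) (suffix x (lengthRead α m)) := by
  refine ⟨fun n a ha => ?_, fun k => ?_⟩
  · have := h.1 _ _ ha
    rwa [lengthRead_add] at this
  · obtain ⟨n, hn, h'⟩ := h.2 (m + k)
    refine ⟨n - m, by omega, ?_⟩
    change (α (m + (n - m))).isSome
    rwa [Nat.add_sub_cancel' (by omega)]

lemma suffix_zero (x : ℕ → A) : suffix x 0 = x := by
  funext n; simp [suffix]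

/-- Prepending a term to a sequence. -/
def consSeq {X : Type*} (a : X) (f : ℕ → X) : ℕ → X
  | 0 => a
  | n + 1 => f n

/-- Prepending a list to a sequence. -/
def appendSeq {X : Type*} (u : List X) (f : ℕ → X) : ℕ → X := u.foldr consSeq f

lemma consSeq_comp {X Y : Type*} (g : X → Y) (a : X) (f : ℕ → X) :
    (fun n => g (consSeq a f n)) = consSeq (g a) (fun n => g (f n)) := by
  funext n; cases n <;> rfl

lemma appendSeq_comp {X Y : Type*} (g : X → Y) (u : List X) (f : ℕ → X) :
    (fun n => g (appendSeq u f n)) = appendSeq (u.map g) (fun n => g (f n)) := by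
  induction u with
  | nil => rfl
  | cons a u ih =>
    change (fun n => g (consSeq a (appendSeq u f) n)) = consSeq (g a) (appendSeq (u.map g) _)
    rw [consSeq_comp, ih]

lemma consSeq_injective {X : Type*} {a b : X} {f g : ℕ → X} (h : consSeq a f = consSeq b g) :
    a = b ∧ f = g :=
  ⟨congrFun h 0, funext fun n => congrFun h (n + 1)⟩

lemma appendSeq_injective {X : Type*} {u v : List X} {f g : ℕ → X} (hl : u.length = v.length)
    (h : appendSeq u f = appendSeq v g) : u = v ∧ f = g := by
  induction u generalizing v with
  | nil =>
    obtain rfl : v = [] := by simpa using hl.symm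
    exact ⟨rfl, h⟩
  | cons a u ih =>
    cases v with
    | nil => simp at hl
    | cons b v =>
      obtain ⟨rfl, h2⟩ := consSeq_injective (f := appendSeq u f) (g := appendSeq v g) h
      obtain ⟨rfl, h3⟩ := ih (by simpa using hl) h2
      exact ⟨rfl, h3⟩

lemma lengthRead_consSeq (o : Option A) (α : ℕ → Option A) (n : ℕ) :
    lengthRead (consSeq o α) (n + 1) = lengthRead α n + if o.isSome then 1 else 0 := by
  induction n with
  | zero => cases o <;> simp [lengthRead, Nat.count_succ, consSeq]
  | succ n ih =>
    have h : consSeq o α (n + 1) = α n := rfl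
    cases hn : α n with
    | none => rw [lengthRead_succ_none (h.trans hn), ih, lengthRead_succ_none hn]
    | some a => rw [lengthRead_succ_some (h.trans hn), ih, lengthRead_succ_some hn]; omega

lemma Spells.cons_none (h : Spells α x) : Spells (consSeq none α) x := by
  refine ⟨fun n a ha => ?_, fun m => ?_⟩
  · cases n with
    | zero => simp [consSeq] at ha
    | succ n => rw [lengthRead_consSeq]; exact h.1 n a ha
  · obtain ⟨n, hn, h'⟩ := h.2 m
    exact ⟨n + 1, by omega, h'⟩

lemma Spells.cons_some (h : Spells α x) (a : A) : Spells (consSeq (some a) α) (consSeq a x) := by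
  refine ⟨fun n b hb => ?_, fun m => ?_⟩
  · cases n with
    | zero => simpa [consSeq] using hb
    | succ n => rw [lengthRead_consSeq]; exact h.1 n b hb
  · obtain ⟨n, hn, h'⟩ := h.2 m
    exact ⟨n + 1, by omega, h'⟩

lemma Spells.append (h : Spells α x) (u : List (Option A)) :
    Spells (appendSeq u α) (appendSeq u.reduceOption x) := by
  induction u with
  | nil => exact h
  | cons o u ih =>
    cases o with
    | none => rw [List.reduceOption_cons_of_none]; exact ih.cons_none
    | some a => rw [List.reduceOption_cons_of_some]; exact ih.cons_some a

/-- Sums along the symbols of a spelled word. -/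
lemma sum_lengthRead (α : ℕ → Option A) (F : ℕ → ℝ) (n : ℕ) :
    ∑ k ∈ Finset.range n, ind ((α k).isSome) * F (lengthRead α k)
      = ∑ r ∈ Finset.range (lengthRead α n), F r := by
  induction n with
  | zero => simp
  | succ n ih =>
    rw [Finset.sum_range_succ, ih]
    cases h : α n with
    | none => rw [lengthRead_succ_none h]; simp [ind]
    | some a => rw [lengthRead_succ_some h, Finset.sum_range_succ]; simp [ind]

/-- A function that is small along the values of `lengthRead` is small. -/
lemma isLittleO_of_comp_lengthRead (h : Spells α x) {D : ℕ → ℝ}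
    (hD : (fun n => D (lengthRead α n)) =o[atTop] fun n => (lengthRead α n : ℝ)) :
    D =o[atTop] fun r => (r : ℝ) := by
  rw [isLittleO_iff] at hD ⊢
  intro c hc
  obtain ⟨n₀, hn₀⟩ := eventually_atTop.1 (hD hc)
  refine eventually_atTop.2 ⟨lengthRead α n₀ + 1, fun r hr => ?_⟩
  obtain ⟨n, -, rfl⟩ := h.exists_index r
  refine hn₀ n ?_
  by_contra hlt
  have := lengthRead_mono α (not_le.1 hlt).le
  omega

end Spelling

/-! ### Deterministic runs

The runs of `2`-deterministic automata with two tapes, as sequences of states and labels. -/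

section Runs

variable {A B Q : Type*}

/-- The states `s` and the labels `l` form a run of some `2`-deterministic automaton. -/
def DetRun (s : ℕ → Q) (l : ℕ → Option A × Option B) : Prop :=
  ∀ m n, s m = s n → supp₂ (l m) = supp₂ (l n) ∧ (l m = l n → s (m + 1) = s (n + 1))

/-- A deterministic run with label `⟨x, y⟩`. -/
structure DetRunOn (s : ℕ → Q) (l : ℕ → Option A × Option B) (x : ℕ → A) (y : ℕ → B) :
    Prop where
  det : DetRun s l
  fst : Spells (fun n => (l n).1) x
  snd : Spells (fun n => (l n).2) y

lemma supp₂_eq_iff {α α' : Option A × Option B} :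
    supp₂ α = supp₂ α' ↔ α.1.isSome = α'.1.isSome ∧ α.2.isSome = α'.2.isSome := by
  simp [supp₂]

lemma DetRunOn.comp {Q' : Type*} {s : ℕ → Q} {l : ℕ → Option A × Option B} {x : ℕ → A} {y : ℕ → B}
    (h : DetRunOn s l x y) {e : Q → Q'} (he : Function.Injective e) :
    DetRunOn (fun n => e (s n)) l x y :=
  ⟨fun m n hmn => ⟨(h.det m n (he hmn)).1, fun hl => congrArg e ((h.det m n (he hmn)).2 hl)⟩,
    h.fst, h.snd⟩

lemma DetRunOn.swap {s : ℕ → Q} {l : ℕ → Option A × Option B} {x : ℕ → A} {y : ℕ → B}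
    (h : DetRunOn s l x y) : DetRunOn s (fun n => (l n).swap) y x := by
  refine ⟨fun m n hmn => ⟨?_, fun hl => (h.det m n hmn).2 (Prod.swap_injective hl)⟩, h.snd, h.fst⟩
  have := supp₂_eq_iff.1 (h.det m n hmn).1
  exact supp₂_eq_iff.2 ⟨this.2, this.1⟩

/-! ### Removal of silent transitions -/

lemma lengthRead_eq_of_none {X : Type*} {α : ℕ → Option X} {m n : ℕ} (hmn : m ≤ n)
    (h : ∀ i, m ≤ i → i < n → α i = none) : lengthRead α n = lengthRead α m := by
  induction n, hmn using Nat.le_induction with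
  | base => rfl
  | succ n hmn ih =>
    rw [lengthRead_succ_none (h n hmn (by omega))]
    exact ih fun i hi hi' => h i hi (by omega)

section Subsequence

variable {X : Type*} {α α' : ℕ → Option X} {t : ℕ → ℕ}

lemma lengthRead_subseq (ht : StrictMono t) (h1 : ∀ k, α' (t k) = α k)
    (h2 : ∀ n, n ∉ Set.range t → α' n = none) (k : ℕ) :
    lengthRead α' (t k) = lengthRead α k := by
  induction k with
  | zero =>
    rw [lengthRead_zero, lengthRead_eq_of_none (Nat.zero_le _), lengthRead_zero]
    rintro i - hi
    refine h2 i ?_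
    rintro ⟨k, rfl⟩
    have := ht.lt_iff_lt.1 hi
    omega
  | succ k ih =>
    rw [lengthRead_eq_of_none (m := t k + 1) (ht (Nat.lt_succ_self k))]
    · cases h : α k with
      | none => rw [lengthRead_succ_none h, lengthRead_succ_none ((h1 k).trans h), ih]
      | some a => rw [lengthRead_succ_some h, lengthRead_succ_some ((h1 k).trans h), ih]
    · intro i hi hi'
      refine h2 i ?_
      rintro ⟨j, rfl⟩
      have := ht.lt_iff_lt.1 hi'
      have : t k < t j := by omega
      have := ht.lt_iff_lt.1 this
      omega

lemma spells_subseq_iff (ht : StrictMono t) (h1 : ∀ k, α' (t k) = α k)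
    (h2 : ∀ n, n ∉ Set.range t → α' n = none) {x : ℕ → X} : Spells α' x ↔ Spells α x := by
  constructor
  · rintro ⟨h3, h4⟩
    refine ⟨fun n a ha => ?_, fun m => ?_⟩
    · rw [← lengthRead_subseq ht h1 h2]
      exact h3 _ _ ((h1 n).trans ha)
    · obtain ⟨n, hn, hs⟩ := h4 (t m)
      by_cases hr : n ∈ Set.range t
      · obtain ⟨k, rfl⟩ := hr
        exact ⟨k, ht.le_iff_le.1 hn, by rwa [h1] at hs⟩
      · rw [h2 n hr] at hs
        simp at hs
  · rintro ⟨h3, h4⟩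
    refine ⟨fun n a ha => ?_, fun m => ?_⟩
    · by_cases hr : n ∈ Set.range t
      · obtain ⟨k, rfl⟩ := hr
        rw [lengthRead_subseq ht h1 h2]
        exact h3 _ _ ((h1 k).symm.trans ha)
      · rw [h2 n hr] at ha
        simp at ha
    · obtain ⟨n, hn, hs⟩ := h4 m
      exact ⟨t n, hn.trans (ht.le_apply), by rwa [h1]⟩

end Subsequence

/-- The states at the visible steps of a run form a deterministic run if the states at invisible
steps determine their successors. -/
lemma nth_succ_eq_of_succ_eq {Λ : Type*} {s : ℕ → Q} {l : ℕ → Λ} {V : Λ → Prop}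
    (hV : {k | V (l k)}.Infinite)
    (h : ∀ m n, s m = s n → (V (l m) ↔ V (l n)) ∧ (¬ V (l m) → s (m + 1) = s (n + 1)))
    {m n : ℕ} (hmn : s (Nat.nth (fun k => V (l k)) m + 1) = s (Nat.nth (fun k => V (l k)) n + 1)) :
    s (Nat.nth (fun k => V (l k)) (m + 1)) = s (Nat.nth (fun k => V (l k)) (n + 1)) := by
  have hs : StrictMono (Nat.nth fun k => V (l k)) := Nat.nth_strictMono hV
  have hrange : ∀ k, V (l k) → ∃ j, Nat.nth (fun k => V (l k)) j = k := fun k hk => by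
    have : k ∈ Set.range (Nat.nth fun k => V (l k)) := by
      rw [Nat.range_nth_of_infinite hV]; exact hk
    exact this
  have hmem : ∀ j, V (l (Nat.nth (fun k => V (l k)) j)) := fun j => Nat.nth_mem_of_infinite hV j
  generalize Nat.nth (fun k => V (l k)) = t at *
  have hgap : ∀ j i, t j < i → i < t (j + 1) → ¬ V (l i) := by
    intro j i h1 h2 hi
    obtain ⟨r, rfl⟩ := hrange i hi
    have h1 := hs.lt_iff_lt.1 h1
    have h2 := hs.lt_iff_lt.1 h2
    omega
  obtain ⟨d, hd⟩ : ∃ d, t (m + 1) = t m + 1 + d :=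
    ⟨t (m + 1) - (t m + 1), by have := hs (Nat.lt_add_one m); omega⟩
  -- Both stretches start in the same state and, as long as the labels are invisible, the state
  -- determines its successor. So they run in lockstep and reach their next visible steps after the
  -- same delay `d`.
  have key : ∀ j ≤ d, s (t m + 1 + j) = s (t n + 1 + j) := by
    intro j
    induction j with
    | zero => exact fun _ => hmn
    | succ j ih =>
      intro hj
      exact (h _ _ (ih (by omega))).2 (hgap m _ (by omega) (by omega))
  have hnd : t (n + 1) = t n + 1 + d := by
    have hv : V (l (t n + 1 + d)) := (h _ _ (key d le_rfl)).1.1 (hd ▸ hmem (m + 1))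
    apply le_antisymm
    · by_contra hlt
      exact hgap n _ (by omega) (not_le.1 hlt) hv
    · by_contra hlt
      have h1 := hs (Nat.lt_add_one n)
      obtain ⟨j, hj⟩ : ∃ j, t (n + 1) = t n + 1 + j := ⟨t (n + 1) - (t n + 1), by omega⟩
      have h2 : V (l (t m + 1 + j)) := (h _ _ (key j (by omega))).1.2 (hj ▸ hmem (n + 1))
      exact hgap m _ (by omega) (by omega) h2
  rw [hd, hnd]
  exact key d le_rfl

lemma sum_nth {P : ℕ → Prop} [DecidablePred P] {F : ℕ → ℝ} (hF : ∀ k, ¬ P k → F k = 0) (n : ℕ) :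
    ∑ k ∈ Finset.range n, F k = ∑ j ∈ Finset.range (Nat.count P n), F (Nat.nth P j) := by
  induction n with
  | zero => simp
  | succ n ih =>
    rw [Finset.sum_range_succ, ih, Nat.count_succ]
    by_cases h : P n
    · simp [h, Finset.sum_range_succ, Nat.nth_count h]
    · simp [h, hF n h]

lemma tendsto_count_atTop {P : ℕ → Prop} [DecidablePred P] (hP : {k | P k}.Infinite) :
    Tendsto (Nat.count P) atTop atTop := by
  refine tendsto_atTop_atTop_of_monotone (Nat.count_monotone P) fun r => ?_
  exact ⟨Nat.nth P r, (Nat.count_nth_of_infinite hP r).ge⟩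

lemma isLittleO_of_sum_nth {P : ℕ → Prop} (hP : {k | P k}.Infinite) {F : ℕ → ℝ}
    (hF : ∀ k, ¬ P k → F k = 0)
    (h : (fun n => ∑ j ∈ Finset.range n, F (Nat.nth P j)) =o[atTop] fun n => (n : ℝ)) :
    (fun n => ∑ k ∈ Finset.range n, F k) =o[atTop] fun n => (n : ℝ) := by
  classical
  have h1 := h.comp_tendsto (tendsto_count_atTop hP)
  have h2 : (fun n => ∑ k ∈ Finset.range n, F k)
      = (fun n => ∑ j ∈ Finset.range n, F (Nat.nth P j)) ∘ Nat.count P :=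
    funext fun n => sum_nth hF n
  rw [h2]
  refine h1.trans_isBigO (IsBigO.of_bound 1 (Eventually.of_forall fun n => ?_))
  simp only [Function.comp, Real.norm_natCast, one_mul, Nat.cast_le]
  exact Nat.count_le _

/-- The label reads at least one symbol. -/
def Visible (lab : Option A × Option B) : Prop := lab ≠ (none, none)

lemma visible_iff_of_supp {l l' : Option A × Option B} (h : supp₂ l = supp₂ l') :
    Visible l ↔ Visible l' := by
  obtain ⟨a, b⟩ := l
  obtain ⟨a', b'⟩ := l'
  rw [supp₂_eq_iff] at h
  cases a <;> cases b <;> cases a' <;> cases b' <;> simp_all [Visible]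

lemma DetRunOn.infinite_visible {s : ℕ → Q} {l : ℕ → Option A × Option B} {x : ℕ → A} {y : ℕ → B}
    (h : DetRunOn s l x y) : {k | Visible (l k)}.Infinite := by
  refine (infinite_of_frequently_isSome h.fst.2).mono fun k hk => ?_
  intro h0
  simp [h0] at hk

lemma DetRunOn.visible {s : ℕ → Q} {l : ℕ → Option A × Option B} {x : ℕ → A} {y : ℕ → B}
    (h : DetRunOn s l x y) :
    DetRunOn (fun n => s (Nat.nth (fun k => Visible (l k)) n))
      (fun n => l (Nat.nth (fun k => Visible (l k)) n)) x y := by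
  have hV := h.infinite_visible
  have hs : StrictMono (Nat.nth fun k => Visible (l k)) := Nat.nth_strictMono hV
  have hr : ∀ n, n ∉ Set.range (Nat.nth fun k => Visible (l k)) → l n = (none, none) := by
    intro n hn
    rw [Nat.range_nth_of_infinite hV] at hn
    simpa [Visible] using hn
  refine ⟨fun m n hmn => ⟨(h.det _ _ hmn).1, fun hl => ?_⟩, ?_, ?_⟩
  · refine nth_succ_eq_of_succ_eq hV (fun m n hmn => ?_) ((h.det _ _ hmn).2 hl)
    have h1 := h.det m n hmn
    refine ⟨visible_iff_of_supp h1.1, fun hm => h1.2 ?_⟩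
    have hn := (visible_iff_of_supp h1.1).not.1 hm
    simp only [Visible, ne_eq, not_not] at hm hn
    rw [hm, hn]
  · exact (spells_subseq_iff hs (fun _ => rfl) (fun n hn => by simp [hr n hn])).1 h.fst
  · exact (spells_subseq_iff hs (fun _ => rfl) (fun n hn => by simp [hr n hn])).1 h.snd

/-! ### Splitting transitions that read both tapes -/

/-- The states of the run in which each step is split into one step for each tape. -/
def splitState (s : ℕ → Q) (l : ℕ → Option A × Option B) (k : ℕ) : Q × Option (Option A) :=
  if k % 2 = 0 then (s (k / 2), none) else (s (k / 2), some (l (k / 2)).1)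

/-- The labels of the run in which each step is split into one step for each tape. -/
def splitLabel (l : ℕ → Option A × Option B) (k : ℕ) : Option A × Option B :=
  if k % 2 = 0 then ((l (k / 2)).1, none) else (none, (l (k / 2)).2)

section Split

variable (s : ℕ → Q) (l : ℕ → Option A × Option B)

lemma splitState_even (k : ℕ) : splitState s l (2 * k) = (s k, none) := by
  simp [splitState]

lemma splitState_odd (k : ℕ) : splitState s l (2 * k + 1) = (s k, some (l k).1) := by
  have h1 : (2 * k + 1) % 2 = 1 := by omega
  have h2 : (2 * k + 1) / 2 = k := by omega
  simp [splitState, h1, h2]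

lemma splitLabel_even (k : ℕ) : splitLabel l (2 * k) = ((l k).1, none) := by
  simp [splitLabel]

lemma splitLabel_odd (k : ℕ) : splitLabel l (2 * k + 1) = (none, (l k).2) := by
  have h1 : (2 * k + 1) % 2 = 1 := by omega
  have h2 : (2 * k + 1) / 2 = k := by omega
  simp [splitLabel, h1, h2]

variable {s l}

/-- Determinism survives because the odd states store the first component of the label: the second
half-step adds the other component, and both together determine the next state. -/
lemma DetRunOn.split {x : ℕ → A} {y : ℕ → B} (h : DetRunOn s l x y) :
    DetRunOn (splitState s l) (splitLabel l) x y := by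
  refine ⟨fun m n hmn => ?_, ?_, ?_⟩
  · obtain ⟨m, rfl | rfl⟩ := Nat.even_or_odd' m <;> obtain ⟨n, rfl | rfl⟩ := Nat.even_or_odd' n
    · rw [splitState_even, splitState_even] at hmn
      simp only [Prod.mk.injEq, and_true] at hmn
      have h1 := supp₂_eq_iff.1 (h.det m n hmn).1
      rw [splitLabel_even, splitLabel_even, splitState_odd, splitState_odd, supp₂_eq_iff]
      exact ⟨⟨h1.1, rfl⟩, fun hl => by simp_all⟩
    · simp [splitState_even, splitState_odd] at hmn
    · simp [splitState_even, splitState_odd] at hmn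
    · rw [splitState_odd, splitState_odd] at hmn
      simp only [Prod.mk.injEq, Option.some.injEq] at hmn
      have h1 := supp₂_eq_iff.1 (h.det m n hmn.1).1
      rw [splitLabel_odd, splitLabel_odd, supp₂_eq_iff]
      refine ⟨⟨rfl, h1.2⟩, fun hl => ?_⟩
      rw [show 2 * m + 1 + 1 = 2 * (m + 1) by ring, show 2 * n + 1 + 1 = 2 * (n + 1) by ring,
        splitState_even, splitState_even, (h.det m n hmn.1).2]
      exact Prod.ext hmn.2 (by simpa using hl)
  · refine (spells_subseq_iff (t := fun k => 2 * k) (fun a b h => by simpa using h)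
      (fun k => by simp only [splitLabel_even]) fun n hn => ?_).2 h.fst
    obtain ⟨k, rfl | rfl⟩ := Nat.even_or_odd' n
    · exact absurd ⟨k, rfl⟩ hn
    · simp only [splitLabel_odd]
  · refine (spells_subseq_iff (t := fun k => 2 * k + 1) (fun a b h => by simpa using h)
      (fun k => by simp only [splitLabel_odd]) fun n hn => ?_).2 h.snd
    obtain ⟨k, rfl | rfl⟩ := Nat.even_or_odd' n
    · simp only [splitLabel_even]
    · exact absurd ⟨k, rfl⟩ hn

end Split

lemma sum_range_two_mul (F : ℕ → ℝ) (n : ℕ) :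
    ∑ k ∈ Finset.range (2 * n), F k = ∑ k ∈ Finset.range n, (F (2 * k) + F (2 * k + 1)) := by
  induction n with
  | zero => simp
  | succ n ih =>
    rw [show 2 * (n + 1) = 2 * n + 1 + 1 by ring, Finset.sum_range_succ, Finset.sum_range_succ,
      Finset.sum_range_succ, ih, add_assoc]

/-! ### Equidistributed runs -/

variable [Fintype A] [Fintype B]

lemma weight_eq_mul (o₁ : Option A) (o₂ : Option B) :
    TwoAutomaton.weight (o₁, o₂) =
      TwoAutomaton.weight (o₁, (none : Option B)) *
        TwoAutomaton.weight ((none : Option A), o₂) := by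
  simp [TwoAutomaton.weight]

lemma weight_nonneg (lab : Option A × Option B) : 0 ≤ TwoAutomaton.weight lab := by
  unfold TwoAutomaton.weight
  split_ifs <;> positivity

lemma weight_swap (lab : Option A × Option B) :
    TwoAutomaton.weight lab.swap = TwoAutomaton.weight lab := by
  simp [TwoAutomaton.weight, mul_comm]

/-- The difference between the number of occurrences of the label `lab` at the state `p` and the
number expected for random input. -/
def dev (s : ℕ → Q) (l : ℕ → Option A × Option B) (p : Q) (lab : Option A × Option B) (n : ℕ) :
    ℝ :=
  ∑ k ∈ Finset.range n, ind (s k = p) * (ind (l k = lab) - TwoAutomaton.weight lab)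

/-- At each state of the run, the labels are asymptotically equidistributed. -/
def Equidistributed (s : ℕ → Q) (l : ℕ → Option A × Option B) : Prop :=
  ∀ k₀ lab, supp₂ (l k₀) = supp₂ lab → dev s l (s k₀) lab =o[atTop] fun n => (n : ℝ)

lemma dev_comp {Q' : Type*} (s : ℕ → Q) (l : ℕ → Option A × Option B) {e : Q → Q'}
    (he : Function.Injective e) (p : Q) (lab : Option A × Option B) :
    dev (fun n => e (s n)) l (e p) lab = dev s l p lab := by
  funext n
  simp only [dev, he.eq_iff]

lemma dev_swap (s : ℕ → Q) (l : ℕ → Option A × Option B) (p : Q) (lab : Option A × Option B) :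
    dev s (fun n => (l n).swap) p lab.swap = dev s l p lab := by
  funext n
  simp only [dev, Prod.swap_injective.eq_iff, weight_swap]

lemma dev_eq_zero_of_not_visited {s : ℕ → Q} {p : Q} (h : ∀ k, s k ≠ p)
    (l : ℕ → Option A × Option B) (lab : Option A × Option B) : dev s l p lab = 0 := by
  funext n
  exact Finset.sum_eq_zero fun k _ => by rw [ind_of_not (h k), zero_mul]

lemma DetRun.dev_silent {s : ℕ → Q} {l : ℕ → Option A × Option B} (h : DetRun s l) {k₀ : ℕ}
    (hk : l k₀ = (none, none)) : dev s l (s k₀) (none, none) = 0 := by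
  funext n
  refine Finset.sum_eq_zero fun k _ => ?_
  by_cases hs : s k = s k₀
  · have h1 := (h k k₀ hs).1
    rw [hk, supp₂_eq_iff] at h1
    have : l k = (none, none) := by
      ext1
      · simpa using h1.1
      · simpa using h1.2
    rw [ind_of this]
    simp [TwoAutomaton.weight]
  · rw [ind_of_not hs, zero_mul]

/-- Exactly one of the two tapes is read. -/
def Single (lab : Option A × Option B) : Prop := lab.1.isSome = !lab.2.isSome

/-- In runs that read one symbol at a time, the symbols of `x` are asymptotically equidistributed
at each state. -/
def HalfUniform (x : ℕ → A) (y : ℕ → B) : Prop :=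
  ∀ (N : ℕ) (s : ℕ → Fin N) (l : ℕ → Option A × Option B), DetRunOn s l x y →
    (∀ k, Single (l k)) → ∀ k₀ a, (l k₀).1.isSome →
      dev s l (s k₀) (some a, none) =o[atTop] fun n => (n : ℝ)

/-- All runs on suffixes of `x` and `y` are equidistributed. -/
def Uniform (x : ℕ → A) (y : ℕ → B) : Prop :=
  ∀ (N i j : ℕ) (s : ℕ → Fin N) (l : ℕ → Option A × Option B),
    DetRunOn s l (suffix x i) (suffix y j) → Equidistributed s l

lemma Equidistributed.of_comp {Q' : Type*} {s : ℕ → Q} {l : ℕ → Option A × Option B} {e : Q → Q'}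
    (he : Function.Injective e) (h : Equidistributed (fun n => e (s n)) l) :
    Equidistributed s l := by
  intro k₀ lab hk
  have := h k₀ lab hk
  rwa [dev_comp s l he] at this

lemma equidistributed_of_single {x : ℕ → A} {y : ℕ → B} (hx : HalfUniform x y)
    (hy : HalfUniform y x) [Finite Q] {s : ℕ → Q} {l : ℕ → Option A × Option B}
    (h : DetRunOn s l x y) (hl : ∀ k, Single (l k)) : Equidistributed s l := by
  obtain ⟨N, ⟨e⟩⟩ := Finite.exists_equiv_fin Q
  apply Equidistributed.of_comp e.injective
  have h' := h.comp e.injective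
  rintro k₀ ⟨o₁, o₂⟩ hk
  rw [supp₂_eq_iff] at hk
  have hs := hl k₀
  unfold Single at hs
  cases o₁ with
  | some a =>
    cases o₂ with
    | some b => simp_all
    | none => exact hx N _ l h' hl k₀ a (by simpa using hk.1)
  | none =>
    cases o₂ with
    | none => simp_all
    | some b =>
      have := hy N _ _ h'.swap (fun k => by have := hl k; unfold Single at this ⊢; simp [this])
        k₀ b (by simpa using hk.2)
      rw [← dev_swap] at this
      exact this

lemma DetRunOn.equidistributed_of_visible {s : ℕ → Q} {l : ℕ → Option A × Option B}
    {x : ℕ → A} {y : ℕ → B} (h : DetRunOn s l x y)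
    (hu : Equidistributed (fun n => s (Nat.nth (fun k => Visible (l k)) n))
      (fun n => l (Nat.nth (fun k => Visible (l k)) n))) : Equidistributed s l := by
  intro k₀ lab hk
  have hV := h.infinite_visible
  by_cases hv : Visible (l k₀)
  · obtain ⟨j, rfl⟩ : k₀ ∈ Set.range (Nat.nth fun k => Visible (l k)) := by
      rw [Nat.range_nth_of_infinite hV]; exact hv
    refine isLittleO_of_sum_nth hV (fun k hk' => ?_) (hu j lab hk)
    rw [ind_of_not, zero_mul]
    intro hs
    exact hk' ((visible_iff_of_supp (h.det _ _ hs).1).2 hv)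
  · have h1 : l k₀ = (none, none) := by simpa [Visible] using hv
    have h2 : lab = (none, none) := by
      have := (visible_iff_of_supp hk).not.1 hv
      simpa [Visible] using this
    rw [h2, h.det.dev_silent h1]
    exact isLittleO_zero _ _

/-- Telescoping of a product: with indicators `e₁`, `e₂` and weights `w₁`, `w₂` of the two
components, `e₁ e₂ - w₁ w₂ = e₁ (e₂ - w₂) + w₂ (e₁ - w₁)`. The first summand is counted at the odd
states, the second at the even ones. -/
lemma dev_split (s : ℕ → Q) (l : ℕ → Option A × Option B) (p : Q) (o₁ : Option A) (o₂ : Option B)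
    (n : ℕ) :
    dev s l p (o₁, o₂) n = dev (splitState s l) (splitLabel l) (p, some o₁) (none, o₂) (2 * n) +
      TwoAutomaton.weight ((none : Option A), o₂) *
        dev (splitState s l) (splitLabel l) (p, none) (o₁, none) (2 * n) := by
  unfold dev
  rw [sum_range_two_mul, sum_range_two_mul, Finset.mul_sum, ← Finset.sum_add_distrib]
  refine Finset.sum_congr rfl fun k _ => ?_
  simp only [splitState_even, splitState_odd, splitLabel_even, splitLabel_odd, Prod.mk.injEq,
    and_true, true_and, reduceCtorEq, and_false, Option.some.injEq, ind_of_not not_false]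
  rw [weight_eq_mul o₁ o₂, ind_and (s k = p),
    show (l k = (o₁, o₂)) = ((l k).1 = o₁ ∧ (l k).2 = o₂) by
    rw [Prod.ext_iff], ind_and]
  ring

lemma DetRun.equidistributed_of_split {s : ℕ → Q} {l : ℕ → Option A × Option B}
    (h : DetRun s l) (hu : Equidistributed (splitState s l) (splitLabel l)) :
    Equidistributed s l := by
  rintro k₀ ⟨o₁, o₂⟩ hk
  rw [supp₂_eq_iff] at hk
  have htwo : Tendsto (fun n : ℕ => 2 * n) atTop atTop := tendsto_id.const_mul_atTop' two_pos
  have hO : (fun n : ℕ => ((2 * n : ℕ) : ℝ)) =O[atTop] fun n : ℕ => (n : ℝ) := by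
    refine IsBigO.of_bound 2 (Eventually.of_forall fun n => ?_)
    simp
  have h1 : dev (splitState s l) (splitLabel l) (s k₀, none) (o₁, none)
      =o[atTop] fun n => (n : ℝ) := by
    have := hu (2 * k₀) (o₁, none) (by rw [splitLabel_even, supp₂_eq_iff]; exact ⟨hk.1, rfl⟩)
    rwa [splitState_even] at this
  have h2 : dev (splitState s l) (splitLabel l) (s k₀, some o₁) (none, o₂)
      =o[atTop] fun n => (n : ℝ) := by
    -- The intermediate state is never visited if `o₁` is never read at this state, and
    -- equidistribution is only assumed at visited states.
    by_cases hv : ∃ k, splitState s l k = (s k₀, some o₁)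
    · obtain ⟨k, hv⟩ := hv
      obtain ⟨k, rfl | rfl⟩ := Nat.even_or_odd' k
      · simp [splitState_even] at hv
      · rw [← hv]
        refine hu _ _ ?_
        rw [splitState_odd] at hv
        simp only [Prod.mk.injEq] at hv
        rw [splitLabel_odd, supp₂_eq_iff]
        exact ⟨rfl, (supp₂_eq_iff.1 (h k k₀ hv.1).1).2.trans hk.2⟩
    · push Not at hv
      rw [dev_eq_zero_of_not_visited hv]
      exact isLittleO_zero _ _
  have h3 := ((h2.comp_tendsto htwo).trans_isBigO hO).add
    (((h1.comp_tendsto htwo).trans_isBigO hO).const_mul_left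
      (TwoAutomaton.weight ((none : Option A), o₂)))
  refine h3.congr_left fun n => ?_
  rw [dev_split]
  rfl

end Runs

/-! ### Prepending a transition: from words to their suffixes -/

section Prefix

variable {A B Q : Type*}

lemma DetRun.cons {s : ℕ → Q} {l : ℕ → Option A × Option B} (h : DetRun s l)
    (l₀ : Option A × Option B) :
    DetRun (consSeq none fun n => some (s n)) (consSeq l₀ l) := by
  rintro (_ | m) (_ | n) hmn
  · exact ⟨rfl, fun _ => rfl⟩
  · cases hmn
  · cases hmn
  · have := h m n (Option.some_injective _ hmn)
    exact ⟨this.1, fun hl => congrArg some (this.2 hl)⟩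

lemma consSeq_suffix (x : ℕ → A) (i : ℕ) : consSeq (x i) (suffix x (i + 1)) = suffix x i := by
  funext n
  cases n with
  | zero => simp [consSeq, suffix]
  | succ n => simp only [consSeq, suffix]; congr 1; ring

variable [Fintype A] [Fintype B]

/-- The prepended transition starts at the fresh state `none`, so it does not contribute to the
counts at the old states. -/
lemma dev_cons (s : ℕ → Q) (l : ℕ → Option A × Option B) (l₀ : Option A × Option B) (p : Q)
    (lab : Option A × Option B) (n : ℕ) :
    dev (consSeq none fun n => some (s n)) (consSeq l₀ l) (some p) lab (n + 1)
      = dev s l p lab n := by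
  simp only [dev]
  rw [Finset.sum_range_succ', ind_of_not (P := consSeq none (fun n => some (s n)) 0 = some p),
    zero_mul, add_zero]
  · refine Finset.sum_congr rfl fun k _ => ?_
    simp only [consSeq, Option.some.injEq]
  · simp [consSeq]

lemma Equidistributed.of_cons {s : ℕ → Q} {l : ℕ → Option A × Option B}
    {l₀ : Option A × Option B}
    (h : Equidistributed (consSeq none fun n => some (s n)) (consSeq l₀ l)) :
    Equidistributed s l := by
  intro k₀ lab hk
  have h1 := (h (k₀ + 1) lab hk).comp_tendsto (tendsto_add_atTop_nat 1)
  have h2 : (fun n : ℕ => ((n + 1 : ℕ) : ℝ)) =O[atTop] fun n : ℕ => (n : ℝ) := by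
    refine IsBigO.of_bound 2 (eventually_atTop.2 ⟨1, fun n hn => ?_⟩)
    have : (1 : ℝ) ≤ n := by exact_mod_cast hn
    rw [Real.norm_natCast, Real.norm_natCast]
    push_cast
    linarith
  exact (h1.trans_isBigO h2).congr_left fun n => dev_cons s l l₀ (s k₀) lab n

/-- Splitting each transition and dropping the silent half-steps leaves a run that reads one symbol
at a time, where the two hypotheses apply. A run on a suffix becomes a run on the whole word by
adding, one at a time, states that read the missing symbols. -/
theorem uniform_of_halfUniform {x : ℕ → A} {y : ℕ → B} (hx : HalfUniform x y)
    (hy : HalfUniform y x) : Uniform x y := by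
  have base : ∀ (N : ℕ) (s : ℕ → Fin N) (l : ℕ → Option A × Option B),
      DetRunOn s l x y → Equidistributed s l := by
    intro N s l h
    have h1 := h.split
    refine h.det.equidistributed_of_split (h1.equidistributed_of_visible ?_)
    refine equidistributed_of_single hx hy h1.visible fun k => ?_
    have hv : Visible (splitLabel l (Nat.nth (fun k => Visible (splitLabel l k)) k)) :=
      Nat.nth_mem_of_infinite h1.infinite_visible k
    revert hv
    generalize Nat.nth (fun k => Visible (splitLabel l k)) k = n
    obtain ⟨n, rfl | rfl⟩ := Nat.even_or_odd' n
    · rw [splitLabel_even]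
      cases (l n).1 <;> simp [Single, Visible]
    · rw [splitLabel_odd]
      cases (l n).2 <;> simp [Single, Visible]
  have step₁ : ∀ i (N : ℕ) (s : ℕ → Fin N) (l : ℕ → Option A × Option B),
      DetRunOn s l (suffix x i) y → Equidistributed s l := by
    intro i
    induction i with
    | zero => intro N s l h; rw [suffix_zero] at h; exact base N s l h
    | succ i ih =>
      intro N s l h
      have h1 : DetRunOn (consSeq none fun n => some (s n)) (consSeq (some (x i), none) l)
          (suffix x i) y := by
        refine ⟨h.det.cons _, ?_, ?_⟩
        · rw [consSeq_comp, ← consSeq_suffix]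
          exact h.fst.cons_some _
        · rw [consSeq_comp]
          exact h.snd.cons_none
      obtain ⟨N', ⟨e⟩⟩ := Finite.exists_equiv_fin (Option (Fin N))
      exact Equidistributed.of_cons (Equidistributed.of_comp e.injective
        (ih N' _ _ (h1.comp e.injective)))
  intro N i j
  induction j generalizing N with
  | zero => intro s l h; rw [suffix_zero] at h; exact step₁ i N s l h
  | succ j ih =>
    intro s l h
    have h1 : DetRunOn (consSeq none fun n => some (s n)) (consSeq (none, some (y j)) l)
        (suffix x i) (suffix y j) := by
      refine ⟨h.det.cons _, ?_, ?_⟩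
      · rw [consSeq_comp]
        exact h.fst.cons_none
      · rw [consSeq_comp, ← consSeq_suffix]
        exact h.snd.cons_some _
    obtain ⟨N', ⟨e⟩⟩ := Finite.exists_equiv_fin (Option (Fin N))
    exact Equidistributed.of_cons (Equidistributed.of_comp e.injective
      (ih N' _ _ (h1.comp e.injective)))

lemma Uniform.equidistributed [Finite Q] {x : ℕ → A} {y : ℕ → B} (hu : Uniform x y) {i j : ℕ}
    {s : ℕ → Q} {l : ℕ → Option A × Option B} (h : DetRunOn s l (suffix x i) (suffix y j)) :
    Equidistributed s l := by
  obtain ⟨N, ⟨e⟩⟩ := Finite.exists_equiv_fin Q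
  exact Equidistributed.of_comp e.injective (hu N i j _ _ (h.comp e.injective))

end Prefix

/-! ### State frequencies -/

section Frequencies

variable {A B Q : Type*} [Fintype A] [Fintype B]

lemma weight_pos (lab : Option A × Option B) : 0 < TwoAutomaton.weight lab := by
  obtain ⟨_ | a, _ | b⟩ := lab
  · simp [TwoAutomaton.weight]
  · have : Nonempty B := ⟨b⟩
    simp [TwoAutomaton.weight, Fintype.card_pos]
  · have : Nonempty A := ⟨a⟩
    simp [TwoAutomaton.weight, Fintype.card_pos]
  · have : Nonempty A := ⟨a⟩
    have : Nonempty B := ⟨b⟩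
    simp only [TwoAutomaton.weight, Option.isSome_some, if_true]
    have h1 : (0 : ℝ) < Fintype.card A := by exact_mod_cast Fintype.card_pos
    have h2 : (0 : ℝ) < Fintype.card B := by exact_mod_cast Fintype.card_pos
    positivity

lemma markovMatrix_eq (M : TwoAutomaton A B Q) (p q : Q) :
    M.markovMatrix p q = ∑ lab, ind ((p, lab, q) ∈ M.trans) * TwoAutomaton.weight lab := by
  unfold TwoAutomaton.markovMatrix
  refine Finset.sum_congr rfl fun lab _ => ?_
  by_cases h : (p, lab, q) ∈ M.trans <;> simp [ind, h]

lemma markovMatrix_nonneg (M : TwoAutomaton A B Q) (p q : Q) : 0 ≤ M.markovMatrix p q := by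
  rw [markovMatrix_eq]
  exact Finset.sum_nonneg fun lab _ => mul_nonneg (ind_nonneg _) (weight_nonneg _)

lemma markovMatrix_pos {M : TwoAutomaton A B Q} {p q : Q} {lab : Option A × Option B}
    (h : (p, lab, q) ∈ M.trans) : 0 < M.markovMatrix p q := by
  rw [markovMatrix_eq]
  refine lt_of_lt_of_le ?_ (Finset.single_le_sum (f := fun lab =>
    ind ((p, lab, q) ∈ M.trans) * TwoAutomaton.weight lab)
    (fun lab _ => mul_nonneg (ind_nonneg _) (weight_nonneg _)) (Finset.mem_univ lab))
  rw [ind_of h, one_mul]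
  exact weight_pos lab

/-- A nonnegative invariant vector of a strongly connected automaton is `0` or positive. -/
lemma eq_zero_of_invariant [Fintype Q] {M : TwoAutomaton A B Q} (hM : M.StronglyConnected)
    {f : Q → ℝ} (hf : ∀ q, 0 ≤ f q) (hinv : Matrix.vecMul f M.markovMatrix = f) {q₀ : Q}
    (h0 : f q₀ = 0) : f = 0 := by
  funext p
  have h := hM p q₀
  induction h using Relation.ReflTransGen.head_induction_on with
  | refl => exact h0
  | @head p q hpq _ ih =>
    obtain ⟨lab, hlab⟩ := hpq
    have h1 : ∑ p, f p * M.markovMatrix p q = 0 := by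
      have := congrFun hinv q
      rw [ih] at this
      simpa [Matrix.vecMul, dotProduct] using this
    have h2 := (Finset.sum_eq_zero_iff_of_nonneg
      (fun p _ => mul_nonneg (hf p) (markovMatrix_nonneg M p q))).1 h1 p (Finset.mem_univ p)
    exact (mul_eq_zero.1 h2).resolve_right (markovMatrix_pos hlab).ne'

/-- No sign is assumed for `g`. For the minimum `t` of `g / f`, the vector `g - t • f` is
nonnegative and invariant and vanishes somewhere, hence everywhere; the sums force `t = 1`. -/
lemma invariant_unique [Fintype Q] {M : TwoAutomaton A B Q} (hM : M.StronglyConnected)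
    {f g : Q → ℝ} (hf : ∀ q, 0 < f q) (hinv : Matrix.vecMul f M.markovMatrix = f)
    (hsum : ∑ q, f q = 1) (hinv' : Matrix.vecMul g M.markovMatrix = g) (hsum' : ∑ q, g q = 1) :
    g = f := by
  have : Nonempty Q := by
    by_contra h
    rw [not_nonempty_iff] at h
    simp at hsum
  obtain ⟨q₀, hq₀⟩ := Finite.exists_min fun q => g q / f q
  set t := g q₀ / f q₀ with ht
  have h1 : g - t • f = 0 := by
    refine eq_zero_of_invariant hM (fun q => ?_) ?_ (q₀ := q₀) ?_
    · have := (le_div_iff₀ (hf q)).1 (hq₀ q)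
      simpa using this
    · rw [Matrix.sub_vecMul, Matrix.smul_vecMul, hinv, hinv']
    · simp [ht, div_mul_cancel₀ _ (hf q₀).ne']
  have h2 : g = t • f := sub_eq_zero.1 h1
  have h3 : t = 1 := by
    rw [h2] at hsum'
    simpa [← Finset.mul_sum, hsum] using hsum'
  rw [h2, h3, one_smul]

/-- The proportion of the visits of `q` among the first `n` steps. -/
def freq (s : ℕ → Q) (q : Q) (n : ℕ) : ℝ := (∑ k ∈ Finset.range n, ind (s k = q)) / n

lemma freq_nonneg (s : ℕ → Q) (q : Q) (n : ℕ) : 0 ≤ freq s q n :=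
  div_nonneg (Finset.sum_nonneg fun _ _ => ind_nonneg _) (Nat.cast_nonneg n)

lemma freq_le_one (s : ℕ → Q) (q : Q) (n : ℕ) : freq s q n ≤ 1 := by
  refine div_le_one_of_le₀ ?_ (Nat.cast_nonneg n)
  calc ∑ k ∈ Finset.range n, ind (s k = q) ≤ ∑ k ∈ Finset.range n, (1 : ℝ) :=
        Finset.sum_le_sum fun _ _ => ind_le_one _
    _ = n := by simp

lemma sum_freq [Fintype Q] (s : ℕ → Q) {n : ℕ} (hn : n ≠ 0) : ∑ q, freq s q n = 1 := by
  unfold freq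
  rw [← Finset.sum_div, Finset.sum_comm]
  simp only [sum_ind_eq]
  have : (n : ℝ) ≠ 0 := by exact_mod_cast hn
  simp [this]

variable {s : ℕ → Q} {l : ℕ → Option A × Option B} {φ : ℕ → ℕ}

lemma tendsto_label_freq (hφ : Tendsto φ atTop atTop) (hu : Equidistributed s l) {k₀ : ℕ}
    {lab : Option A × Option B} (hlab : supp₂ (l k₀) = supp₂ lab) {c : ℝ}
    (hf : Tendsto (fun n => freq s (s k₀) (φ n)) atTop (𝓝 c)) :
    Tendsto (fun n => (∑ k ∈ Finset.range (φ n), ind (s k = s k₀) * ind (l k = lab)) / φ n)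
      atTop (𝓝 (c * TwoAutomaton.weight lab)) := by
  have h1 := ((hu k₀ lab hlab).tendsto_div_nhds_zero).comp hφ
  have h2 := h1.add (hf.mul_const (TwoAutomaton.weight lab))
  rw [zero_add] at h2
  refine h2.congr fun n => ?_
  simp only [Function.comp, dev, freq]
  rw [div_mul_eq_mul_div, ← add_div, Finset.sum_mul, ← Finset.sum_add_distrib]
  congr 1
  exact Finset.sum_congr rfl fun k _ => by ring

lemma sum_shift_div_tendsto (hφ : Tendsto φ atTop atTop) {q : Q} {c : ℝ}
    (hf : Tendsto (fun n => freq s q (φ n)) atTop (𝓝 c)) :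
    Tendsto (fun n => (∑ k ∈ Finset.range (φ n), ind (s (k + 1) = q)) / φ n) atTop (𝓝 c) := by
  have h1 : Tendsto (fun n : ℕ => (ind (s n = q) - ind (s 0 = q)) / n) atTop (𝓝 0) := by
    refine squeeze_zero_norm (a := fun n : ℕ => 1 / (n : ℝ)) (fun n => ?_)
      tendsto_one_div_atTop_nhds_zero_nat
    rw [norm_div, Real.norm_natCast]
    gcongr
    exact abs_ind_sub_le (ind_nonneg _) (ind_le_one _)
  have h2 := (h1.comp hφ).add hf
  rw [zero_add] at h2
  refine h2.congr fun n => ?_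
  simp only [Function.comp, freq]
  rw [← add_div]
  congr 1
  have := Finset.sum_range_succ' (fun k => ind (s k = q)) (φ n)
  rw [Finset.sum_range_succ] at this
  linarith

/-- Limit points of the state frequencies of an equidistributed run are stationary. -/
lemma invariant_of_tendsto [Fintype Q] {M : TwoAutomaton A B Q} (hM : M.IsDet₂)
    (hrun : M.IsRun s l) (hu : Equidistributed s l) (hφ : Tendsto φ atTop atTop) {f : Q → ℝ}
    (hf : ∀ q, Tendsto (fun n => freq s q (φ n)) atTop (𝓝 (f q))) :
    Matrix.vecMul f M.markovMatrix = f := by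
  funext q
  refine tendsto_nhds_unique ?_ (sum_shift_div_tendsto hφ (hf q))
  have key : ∀ p lab, Tendsto (fun n => ind ((p, lab, q) ∈ M.trans) *
      ((∑ k ∈ Finset.range (φ n), ind (s k = p) * ind (l k = lab)) / φ n)) atTop
      (𝓝 (ind ((p, lab, q) ∈ M.trans) * (f p * TwoAutomaton.weight lab))) := by
    intro p lab
    by_cases ht : (p, lab, q) ∈ M.trans
    · refine Tendsto.const_mul _ ?_
      by_cases hv : ∃ k, s k = p
      · obtain ⟨k₀, rfl⟩ := hv
        exact tendsto_label_freq hφ hu (hM.2 _ _ _ _ _ (hrun k₀) ht).1 (hf _)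
      · push Not at hv
        have h0 : f p = 0 := by
          refine tendsto_nhds_unique (hf p) ?_
          simp [freq, ind_of_not (hv _)]
        simp [ind_of_not (hv _), h0]
    · simp [ind_of_not ht]
  have h1 := tendsto_finsetSum Finset.univ fun p _ =>
    tendsto_finsetSum (Finset.univ : Finset (Option A × Option B)) fun lab _ => key p lab
  have h2 : ∑ p, ∑ lab, ind ((p, lab, q) ∈ M.trans) * (f p * TwoAutomaton.weight lab)
      = Matrix.vecMul f M.markovMatrix q := by
    simp only [Matrix.vecMul, dotProduct, markovMatrix_eq, Finset.mul_sum]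
    exact Finset.sum_congr rfl fun p _ => Finset.sum_congr rfl fun lab _ => by ring
  rw [h2] at h1
  refine h1.congr fun n => ?_
  -- By determinism, the state after step `k` is `q` exactly if the automaton has a transition from
  -- `s k` to `q` with label `l k`; only one term of the double sum can be nonzero.
  have h3 : ∀ k, ind (s (k + 1) = q)
      = ∑ p, ∑ lab, ind ((p, lab, q) ∈ M.trans) * (ind (s k = p) * ind (l k = lab)) := by
    intro k
    have h4 : ∀ p, ∑ lab, ind ((p, lab, q) ∈ M.trans) * (ind (s k = p) * ind (l k = lab))
        = ind (s k = p) * ind ((p, l k, q) ∈ M.trans) := by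
      intro p
      rw [← sum_ind_eq_mul (l k) fun lab => ind ((p, lab, q) ∈ M.trans), Finset.mul_sum]
      exact Finset.sum_congr rfl fun lab _ => by ring
    simp only [h4]
    rw [sum_ind_eq_mul (s k) fun p => ind ((p, l k, q) ∈ M.trans)]
    refine ind_congr ⟨fun h => h ▸ hrun k, fun h => ((hM.2 _ _ _ _ _ (hrun k) h).2 rfl).2⟩
  simp only [h3]
  rw [Finset.sum_comm (s := Finset.range (φ n)), Finset.sum_div]
  refine Finset.sum_congr rfl fun p _ => ?_
  rw [Finset.sum_comm (s := Finset.range (φ n)), Finset.sum_div]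
  refine Finset.sum_congr rfl fun lab _ => ?_
  rw [← Finset.mul_sum, mul_div_assoc]

/-- The frequency vectors lie in a compact cube. All their limit points are invariant probability
vectors, positive by strong connectivity and therefore equal, which gives convergence. -/
theorem stateFrequencies_of_uniform {x : ℕ → A} {y : ℕ → B} (hu : Uniform x y) :
    StateFrequencies x y := by
  intro Q _ M hM hconn i j s l hrun
  have hdet : DetRunOn s l (suffix x i) (suffix y j) := by
    refine ⟨fun m n hmn => ?_, hrun.2.1, hrun.2.2⟩
    have h1 := hrun.1 m
    rw [hmn] at h1
    have h2 := hM.2 _ _ _ _ _ h1 (hrun.1 n)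
    exact ⟨h2.1, fun hl => (h2.2 hl).2⟩
  have hE := hu.equidistributed hdet
  have hcomp : ∀ φ : ℕ → ℕ, Tendsto φ atTop atTop → ∃ (ψ : ℕ → ℕ) (f : Q → ℝ),
      Tendsto ψ atTop atTop ∧ (∀ q, Tendsto (fun n => freq s q (φ (ψ n))) atTop (𝓝 (f q))) := by
    intro φ hφ
    obtain ⟨f, -, ψ, hψ, h⟩ := (isCompact_Icc (a := (0 : Q → ℝ)) (b := 1)).tendsto_subseq
      (x := fun n q => freq s q (φ n))
      (fun n => ⟨fun q => freq_nonneg s q _, fun q => freq_le_one s q _⟩)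
    exact ⟨ψ, f, hψ.tendsto_atTop, fun q => (tendsto_pi_nhds.1 h) q⟩
  have hprop : ∀ (φ : ℕ → ℕ) (f : Q → ℝ), Tendsto φ atTop atTop →
      (∀ q, Tendsto (fun n => freq s q (φ n)) atTop (𝓝 (f q))) →
      Matrix.vecMul f M.markovMatrix = f ∧ ∑ q, f q = 1 ∧ ∀ q, 0 < f q := by
    intro φ f hφ hf
    have h1 := invariant_of_tendsto hM hrun.1 hE hφ hf
    have h2 : ∑ q, f q = 1 := by
      refine tendsto_nhds_unique (tendsto_finsetSum Finset.univ fun q _ => hf q) ?_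
      refine tendsto_const_nhds.congr' ?_
      filter_upwards [hφ.eventually_ne_atTop 0] with n hn
      exact (sum_freq s hn).symm
    have h3 : ∀ q, 0 ≤ f q := fun q => ge_of_tendsto' (hf q) fun n => freq_nonneg s q _
    refine ⟨h1, h2, fun q => (h3 q).lt_of_ne fun h0 => ?_⟩
    rw [eq_zero_of_invariant hconn h3 h1 h0.symm] at h2
    simp at h2
  obtain ⟨ψ, f, hψ, hf⟩ := hcomp id tendsto_id
  obtain ⟨hinv, hsum, hpos⟩ := hprop ψ f hψ hf
  refine ⟨?_, f, ⟨⟨hinv, hsum⟩, fun g hg hg' => invariant_unique hconn hpos hinv hsum hg hg'⟩, ?_⟩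
  -- A missing label with the right support would have frequency 0 at `p`, while equidistribution
  -- gives it the positive frequency `f p` times its weight.
  · intro p lab q ht lab' hlab'
    by_contra hno
    push Not at hno
    have hv : ∃ k, s k = p := by
      by_contra hv
      push Not at hv
      refine (hpos p).ne' (tendsto_nhds_unique (hf p) ?_)
      simp [freq, ind_of_not (hv _)]
    obtain ⟨k₀, rfl⟩ := hv
    have h1 : supp₂ (l k₀) = supp₂ lab' := (hM.2 _ _ _ _ _ (hrun.1 k₀) ht).1.trans hlab'.symm
    have h2 := tendsto_label_freq hψ hE h1 (hf (s k₀))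
    refine (mul_pos (hpos (s k₀)) (weight_pos lab')).ne' (tendsto_nhds_unique h2 ?_)
    refine tendsto_const_nhds.congr fun n => ?_
    rw [Finset.sum_eq_zero, zero_div]
    intro k _
    by_cases hs : s k = s k₀
    · rw [ind_of_not (P := l k = lab'), mul_zero]
      intro hl
      have := hrun.1 k
      rw [hs] at this
      exact hno _ _ this hl
    · rw [ind_of_not hs, zero_mul]
  · intro q
    refine Tendsto.congr (f₁ := freq s q) (fun n => ?_) ?_
    · rw [freq, count_eq_sum_ind]
    · refine tendsto_of_subseq_tendsto fun φ hφ => ?_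
      obtain ⟨ψ', f', hψ', hf'⟩ := hcomp φ hφ
      obtain ⟨hinv', hsum', -⟩ := hprop (φ ∘ ψ') f' (hφ.comp hψ') hf'
      refine ⟨ψ', ?_⟩
      rw [← invariant_unique hconn hpos hinv hsum hinv' hsum']
      exact hf' q

end Frequencies

/-! ### Consequences of the state frequencies -/

section Ergodic

variable {A B Q : Type*}

lemma tendsto_freq_of_tail {s : ℕ → Q} {q : Q} {c : ℝ} (m : ℕ)
    (h : Tendsto (freq (fun k => s (m + k)) q) atTop (𝓝 c)) :
    Tendsto (freq s q) atTop (𝓝 c) := by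
  induction m generalizing s with
  | zero => simpa using h
  | succ m ih =>
    apply ih
    have h0 : Tendsto (fun n : ℕ => (ind (s m = q) - ind (s (m + n) = q)) / n) atTop (𝓝 0) := by
      refine squeeze_zero_norm (a := fun n : ℕ => 1 / (n : ℝ)) (fun n => ?_)
        tendsto_one_div_atTop_nhds_zero_nat
      rw [norm_div, Real.norm_natCast]
      gcongr
      exact abs_ind_sub_le (ind_nonneg _) (ind_le_one _)
    have h2 := h0.add h
    rw [zero_add] at h2
    refine h2.congr fun n => ?_
    simp only [freq]
    rw [← add_div]
    congr 1
    have := Finset.sum_range_succ' (fun k => ind (s (m + k) = q)) n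
    rw [Finset.sum_range_succ] at this
    have h3 : ∑ k ∈ Finset.range n, ind (s (m + (k + 1)) = q)
        = ∑ k ∈ Finset.range n, ind (s (m + 1 + k) = q) :=
      Finset.sum_congr rfl fun k _ => by rw [add_comm k 1, add_assoc]
    rw [h3] at this
    simp only [add_zero] at this
    linarith

lemma isLittleO_sum_of_eventually_zero {F : ℕ → ℝ} (h : ∀ᶠ k in atTop, F k = 0) :
    (fun n => ∑ k ∈ Finset.range n, F k) =o[atTop] fun n => (n : ℝ) := by
  obtain ⟨m, hm⟩ := eventually_atTop.1 h
  have h1 : (fun n => ∑ k ∈ Finset.range n, F k) =ᶠ[atTop]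
      fun _ => ∑ k ∈ Finset.range m, F k := by
    filter_upwards [eventually_ge_atTop m] with n hn
    rw [← Finset.sum_range_add_sum_Ico _ hn, Finset.sum_eq_zero (s := Finset.Ico m n), add_zero]
    intro k hk
    exact hm k (Finset.mem_Ico.1 hk).1
  refine IsLittleO.congr' ?_ h1.symm EventuallyEq.rfl
  exact isLittleO_const_left.2 (Or.inr (by
    simpa [Function.comp_def] using tendsto_natCast_atTop_atTop (R := ℝ)))

variable [Fintype A] [Fintype B]

/-- The runs on `x` and `y` are equidistributed, and recurrent states have positive density. -/
def RunsErgodic (x : ℕ → A) (y : ℕ → B) : Prop :=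
  ∀ (N : ℕ) (s : ℕ → Fin N) (l : ℕ → Option A × Option B), DetRunOn s l x y →
    Equidistributed s l ∧ ∀ q, (∃ᶠ n in atTop, s n = q) →
      ∃ κ > (0 : ℝ), ∀ᶠ n : ℕ in atTop, κ * n ≤ ∑ k ∈ Finset.range n, ind (s k = q)

/-- State frequencies alone do not count labels, so the hypothesis is applied to an automaton whose
states are the recurrent pairs of state and label (edges) of the run. Its invariance equation at
`(p, lab)` says that the frequency of this edge is the frequency of `p` times the weight of `lab`,
which is equidistribution; positivity of the invariant vector gives the densities. -/
theorem runsErgodic_of_stateFrequencies {x : ℕ → A} {y : ℕ → B} (hsf : StateFrequencies x y) :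
    RunsErgodic x y := by
  intro N s l h
  set E : ℕ → Fin N × (Option A × Option B) := fun k => (s k, l k) with hE
  have hEdet : ∀ m n, E m = E n → s (m + 1) = s (n + 1) := fun m n hmn =>
    (h.det m n (congrArg Prod.fst hmn)).2 (congrArg Prod.snd hmn)
  -- There are finitely many edges, so from some `n₀` on only recurrent ones occur.
  obtain ⟨n₀, hn₀⟩ : ∃ n₀, ∀ k ≥ n₀, ∃ᶠ j in atTop, E j = E k := by
    have : ∀ e : Fin N × (Option A × Option B), ∀ᶠ k in atTop,
        E k = e → ∃ᶠ j in atTop, E j = e := by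
      intro e
      by_cases he : ∃ᶠ j in atTop, E j = e
      · exact Eventually.of_forall fun k _ => he
      · filter_upwards [not_frequently.1 he] with k hk hk'
        exact absurd hk' hk
    obtain ⟨n₀, h1⟩ := eventually_atTop.1 (eventually_all.2 this)
    exact ⟨n₀, fun k hk => h1 k hk _ rfl⟩
  let T := {e : Fin N × (Option A × Option B) // ∃ᶠ j in atTop, E j = e}
  obtain ⟨n, ⟨φ⟩⟩ := Finite.exists_equiv_fin T
  let s' : ℕ → Fin n := fun k => φ ⟨E (n₀ + k), hn₀ _ (by omega)⟩
  let l' : ℕ → Option A × Option B := fun k => l (n₀ + 1 + k)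
  have hs'E : ∀ k j, s' k = s' j ↔ E (n₀ + k) = E (n₀ + j) := by
    intro k j
    exact φ.injective.eq_iff.trans Subtype.ext_iff
  have hs'e : ∀ k (e : T), s' k = φ e ↔ E (n₀ + k) = e.1 := by
    intro k e
    exact φ.injective.eq_iff.trans Subtype.ext_iff
  have hE1 : ∀ k, E (n₀ + (k + 1)) = (s (n₀ + 1 + k), l' k) := by
    intro k
    rw [show n₀ + (k + 1) = n₀ + 1 + k by ring]
  have hsnext : ∀ k j, s' k = s' j → s (n₀ + 1 + k) = s (n₀ + 1 + j) := by
    intro k j hkj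
    have := hEdet _ _ ((hs'E k j).1 hkj)
    rwa [show n₀ + k + 1 = n₀ + 1 + k by ring, show n₀ + j + 1 = n₀ + 1 + j by ring] at this
  let M : TwoAutomaton A B (Fin n) :=
    -- The label of a transition is the label component of the edge that it leads to. Only
    -- transitions used by the run are included; recurrence of the edges makes the automaton
    -- strongly connected.
    ⟨{t | ∃ k, t = (s' k, l' k, s' (k + 1))}, {s' 0}⟩
  have htr : ∀ k, (s' k, l' k, s' (k + 1)) ∈ M.trans := fun k => ⟨k, rfl⟩
  have hMdet : M.IsDet₂ := by
    refine ⟨⟨s' 0, rfl⟩, ?_⟩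
    rintro p lab q lab' q' ⟨k, hk⟩ ⟨j, hj⟩
    simp only [Prod.mk.injEq] at hk hj
    obtain ⟨rfl, rfl, rfl⟩ := hk
    obtain ⟨hkj, rfl, rfl⟩ := hj
    have h1 := hsnext k j hkj
    refine ⟨(h.det _ _ h1).1, fun hl => ⟨hl, ?_⟩⟩
    rw [hs'E, hE1, hE1, h1]
    exact congrArg _ hl
  have hreach : ∀ k d, Relation.ReflTransGen (fun p' q' => ∃ lab, (p', lab, q') ∈ M.trans)
      (s' k) (s' (k + d)) := by
    intro k d
    induction d with
    | zero => exact Relation.ReflTransGen.refl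
    | succ d ih => exact ih.tail ⟨_, htr (k + d)⟩
  have hocc : ∀ (q : Fin n) (m : ℕ), ∃ k ≥ m, s' k = q := by
    intro q m
    obtain ⟨k, hk, hk'⟩ := frequently_atTop.1 (φ.symm q).2 (n₀ + m)
    refine ⟨k - n₀, by omega, ?_⟩
    rw [← φ.apply_symm_apply q, hs'e, Nat.add_sub_cancel' (by omega)]
    exact hk'
  have hconn : Automaton.StronglyConnected M := by
    intro p q
    obtain ⟨k, -, rfl⟩ := hocc p 0
    obtain ⟨j, hj, rfl⟩ := hocc q k
    obtain ⟨d, rfl⟩ := Nat.exists_eq_add_of_le hj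
    exact hreach k d
  obtain ⟨hcomp, π, ⟨⟨hinv, hsum⟩, -⟩, hfreq⟩ := hsf (Fin n) M hMdet hconn _ _ s' l'
    ⟨htr, h.fst.tail (n₀ + 1), h.snd.tail (n₀ + 1)⟩
  have hfreq' : ∀ q, Tendsto (freq s' q) atTop (𝓝 (π q)) := by
    intro q
    refine (hfreq q).congr fun m => ?_
    rw [freq, count_eq_sum_ind]
  have hnn : ∀ q, 0 ≤ π q := fun q => ge_of_tendsto' (hfreq' q) fun m => freq_nonneg s' q m
  have hpos : ∀ q, 0 < π q := by
    refine fun q => (hnn q).lt_of_ne fun h0 => ?_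
    rw [eq_zero_of_invariant hconn hnn hinv h0.symm] at hsum
    simp at hsum
  -- the limit of the frequency of `p` is the sum of `π` over the edges that lead to `p`
  let pred : Fin N → Fin n → Prop := fun p q => ∃ k, s' k = q ∧ s (n₀ + 1 + k) = p
  have hpred : ∀ p k, pred p (s' k) ↔ s (n₀ + 1 + k) = p := by
    intro p k
    exact ⟨fun ⟨j, hj, hj'⟩ => (hsnext k j hj.symm).trans hj', fun hk => ⟨k, rfl, hk⟩⟩
  let c : Fin N → ℝ := fun p => ∑ q, ind (pred p q) * π q
  have hc : ∀ p, Tendsto (freq s p) atTop (𝓝 (c p)) := by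
    intro p
    refine tendsto_freq_of_tail (n₀ + 1) ?_
    refine (tendsto_finsetSum Finset.univ fun q _ => (hfreq' q).const_mul (ind (pred p q))).congr
      fun m => ?_
    simp only [freq, ← mul_div_assoc]
    rw [← Finset.sum_div]
    congr 1
    simp only [Finset.mul_sum]
    rw [Finset.sum_comm]
    refine Finset.sum_congr rfl fun k _ => ?_
    rw [← ind_congr (hpred p k), ← sum_ind_eq_mul (s' k) fun q => ind (pred p q)]
    exact Finset.sum_congr rfl fun q _ => mul_comm _ _
  have hexists : ∀ p, (∃ᶠ m in atTop, s m = p) → ∃ k, s (n₀ + 1 + k) = p := by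
    intro p hp
    obtain ⟨m, hm, hm'⟩ := frequently_atTop.1 hp (n₀ + 1)
    exact ⟨m - (n₀ + 1), by rw [Nat.add_sub_cancel' hm]; exact hm'⟩
  refine ⟨fun k₀ lab hlab => ?_, fun p hp => ?_⟩
  · by_cases hp : ∃ᶠ m in atTop, s m = s k₀
    swap
    · refine isLittleO_sum_of_eventually_zero ?_
      filter_upwards [not_frequently.1 hp] with k hk
      rw [ind_of_not hk, zero_mul]
    obtain ⟨k₁, hk₁⟩ := hexists _ hp
    -- Completeness is needed here: whenever the run is about to leave the state `s k₀`, the same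
    -- edge is at some time followed by the label `lab`, so that `(s k₀, lab)` really is one of the
    -- recurrent edges.
    have hsucc : ∀ k, s (n₀ + 1 + k) = s k₀ →
        ∃ j, s' j = s' k ∧ E (n₀ + (j + 1)) = (s k₀, lab) := by
      intro k hk
      obtain ⟨lab', q', ⟨j, hj⟩, rfl⟩ := hcomp _ _ _ (htr k) lab
        (hlab.symm.trans (h.det _ _ hk).1.symm)
      simp only [Prod.mk.injEq] at hj
      refine ⟨j, hj.1.symm, ?_⟩
      rw [hE1, ← hsnext k j hj.1, hk, hj.2.1]
    have hmem : ∃ᶠ j in atTop, E j = (s k₀, lab) := by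
      obtain ⟨j, -, hj⟩ := hsucc k₁ hk₁
      rw [← hj]
      exact hn₀ _ (by omega)
    -- The edges with a transition to `(s k₀, lab)` are those leading to the state `s k₀`, and each
    -- has only one such transition, labelled `lab`.
    have hπ : π (φ ⟨_, hmem⟩) = c (s k₀) * TwoAutomaton.weight lab := by
      rw [← hinv]
      simp only [Matrix.vecMul, dotProduct, markovMatrix_eq, c, Finset.sum_mul]
      refine Finset.sum_congr rfl fun q _ => ?_
      have h1 : ∀ lab', ind ((q, lab', φ ⟨_, hmem⟩) ∈ M.trans)
          = ind (lab = lab') * ind (pred (s k₀) q) := by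
        intro lab'
        rw [← ind_and]
        refine ind_congr ⟨?_, ?_⟩
        · rintro ⟨k, hk⟩
          simp only [Prod.mk.injEq] at hk
          obtain ⟨rfl, rfl, hk⟩ := hk
          rw [eq_comm, hs'e, hE1, Prod.mk.injEq] at hk
          exact ⟨hk.2.symm, k, rfl, hk.1⟩
        · rintro ⟨rfl, k, rfl, hk⟩
          obtain ⟨j, hj, hj'⟩ := hsucc k hk
          refine ⟨j, ?_⟩
          rw [hj]
          have h2 := (hs'e (j + 1) ⟨_, hmem⟩).2 hj'
          rw [hE1, Prod.mk.injEq] at hj'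
          rw [h2, hj'.2]
      simp only [h1, mul_assoc]
      rw [sum_ind_eq_mul lab fun lab' => ind (pred (s k₀) q) * TwoAutomaton.weight lab']
      ring
    have h3 : Tendsto (freq E (s k₀, lab)) atTop (𝓝 (π (φ ⟨_, hmem⟩))) := by
      refine tendsto_freq_of_tail n₀ ((hfreq' _).congr fun m => ?_)
      simp only [freq, hs'e]
    have h4 := h3.sub ((hc (s k₀)).mul_const (TwoAutomaton.weight lab))
    rw [hπ, sub_self] at h4
    rw [isLittleO_iff_tendsto' (by
      filter_upwards [eventually_ne_atTop 0] with m hm h0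
      exact absurd (by exact_mod_cast h0) hm)]
    refine h4.congr fun m => ?_
    simp only [freq, dev]
    rw [div_mul_eq_mul_div, ← sub_div, Finset.sum_mul, ← Finset.sum_sub_distrib]
    congr 1
    refine Finset.sum_congr rfl fun k _ => ?_
    rw [show (E k = (s k₀, lab)) = (s k = s k₀ ∧ l k = lab) by simp [hE], ind_and]
    ring
  · obtain ⟨k₁, hk₁⟩ := hexists p hp
    have hcpos : 0 < c p := by
      refine lt_of_lt_of_le ?_ (Finset.single_le_sum (f := fun q => ind (pred p q) * π q)
        (fun q _ => mul_nonneg (ind_nonneg _) (hnn q)) (Finset.mem_univ (s' k₁)))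
      rw [ind_of ((hpred p k₁).2 hk₁), one_mul]
      exact hpos _
    refine ⟨c p / 2, by positivity, ?_⟩
    filter_upwards [(hc p).eventually (lt_mem_nhds (half_lt_self hcpos)), eventually_gt_atTop 0]
      with m hm hm0
    have : (0 : ℝ) < m := by exact_mod_cast hm0
    exact ((lt_div_iff₀ this).1 hm).le

lemma RunsErgodic.swap {x : ℕ → A} {y : ℕ → B} (h : RunsErgodic x y) : RunsErgodic y x := by
  intro N s l hr
  obtain ⟨h1, h2⟩ := h N s _ hr.swap
  refine ⟨fun k₀ lab hlab => ?_, h2⟩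
  have h3 := h1 k₀ lab.swap (by
    rw [supp₂_eq_iff] at hlab ⊢
    exact ⟨hlab.2, hlab.1⟩)
  rwa [dev_swap] at h3

lemma RunsErgodic.equidistributed [Finite Q] {x : ℕ → A} {y : ℕ → B} (h : RunsErgodic x y)
    {s : ℕ → Q} {l : ℕ → Option A × Option B} (hr : DetRunOn s l x y) : Equidistributed s l := by
  obtain ⟨N, ⟨e⟩⟩ := Finite.exists_equiv_fin Q
  exact Equidistributed.of_comp e.injective (h N _ _ (hr.comp e.injective)).1

lemma RunsErgodic.density [Finite Q] {x : ℕ → A} {y : ℕ → B} (h : RunsErgodic x y)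
    {s : ℕ → Q} {l : ℕ → Option A × Option B} (hr : DetRunOn s l x y) {q : Q}
    (hq : ∃ᶠ n in atTop, s n = q) :
    ∃ κ > (0 : ℝ), ∀ᶠ n : ℕ in atTop, κ * n ≤ ∑ k ∈ Finset.range n, ind (s k = q) := by
  obtain ⟨N, ⟨e⟩⟩ := Finite.exists_equiv_fin Q
  simpa using (h N _ _ (hr.comp e.injective)).2 (e q) (by simpa using hq)

end Ergodic

/-! ### Normality and automata with one tape -/

section OneTape

variable {A Q : Type*}

/-- The states `t` form a run of a deterministic automaton reading `z`. -/
def DetRead (t : ℕ → Q) (z : ℕ → A) : Prop :=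
  ∀ m n, t m = t n → z m = z n → t (m + 1) = t (n + 1)

lemma sum_range_mul_eq (F : ℕ → ℝ) (n ℓ : ℕ) :
    ∑ r ∈ Finset.range (n * ℓ), F r
      = ∑ i ∈ Finset.range n, ∑ j ∈ Finset.range ℓ, F (i * ℓ + j) := by
  induction n with
  | zero => simp
  | succ n ih => rw [Nat.succ_mul, Finset.sum_range_add, ih, Finset.sum_range_succ]

lemma alignedOcc_eq_sum (z : ℕ → A) {ℓ : ℕ} (u : Fin ℓ → A) (n : ℕ) :
    (alignedOcc z u n : ℝ) = ∑ i ∈ Finset.range n, ind (∀ j : Fin ℓ, z (i * ℓ + j) = u j) := by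
  classical
  unfold alignedOcc
  rw [← count_eq_sum_ind]

/-- The block `u` agrees with the current aligned block of `z` up to the position `r`. -/
def Agrees (z : ℕ → A) {ℓ : ℕ} (u : Fin ℓ → A) (r : ℕ) : Prop :=
  ∀ j : Fin ℓ, j < r % ℓ → z (r / ℓ * ℓ + j) = u j

/-- The sum of the values of `g` along the run on `u` starting at the state `q`. -/
def runSum (δ : Q → A → Q) (g : Q → A → ℝ) : (m : ℕ) → Q → (Fin m → A) → ℝ
  | 0, _, _ => 0
  | m + 1, q, u => g q (u 0) + runSum δ g m (δ q (u 0)) (Fin.tail u)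

lemma runSum_eq_sum {δ : Q → A → Q} {g : Q → A → ℝ} {t : ℕ → Q} {z : ℕ → A}
    (ht : ∀ r, t (r + 1) = δ (t r) (z r)) (m r : ℕ) :
    runSum δ g m (t r) (fun j => z (r + j)) = ∑ j ∈ Finset.range m, g (t (r + j)) (z (r + j)) := by
  induction m generalizing r with
  | zero => simp [runSum]
  | succ m ih =>
    rw [Finset.sum_range_succ']
    simp only [runSum, Fin.val_zero, add_zero]
    rw [← ht, add_comm]
    congr 1
    have := ih (r + 1)
    simp only [add_assoc, add_comm 1] at this
    rw [← this]
    congr 1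

variable [Fintype A]

/-- At each state of a deterministic automaton reading `z`, the symbols are asymptotically
equidistributed. -/
def ReadsUniform (z : ℕ → A) : Prop :=
  ∀ (N : ℕ) (t : ℕ → Fin N), DetRead t z → ∀ p a,
    (fun n : ℕ => ∑ k ∈ Finset.range n, ind (t k = p) * (ind (z k = a) - 1 / Fintype.card A))
      =o[atTop] fun n => (n : ℝ)

lemma ReadsUniform.isLittleO [Finite Q] {z : ℕ → A} (hz : ReadsUniform z) {t : ℕ → Q}
    (ht : DetRead t z) (p : Q) (a : A) :
    (fun n : ℕ => ∑ k ∈ Finset.range n, ind (t k = p) * (ind (z k = a) - 1 / Fintype.card A))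
      =o[atTop] fun n => (n : ℝ) := by
  obtain ⟨N, ⟨e⟩⟩ := Finite.exists_equiv_fin Q
  have := hz N (fun n => e (t n)) (fun m n hmn hz => congrArg e (ht m n (e.injective hmn) hz))
    (e p) a
  simpa using this

/-- The automaton that compares each aligned block with `u` symbol by symbol is finite.
Equidistribution at its states shows that extending the matched part by one symbol divides the
number of matching blocks by the size of the alphabet, up to o(n). -/
theorem isNormal_of_readsUniform {z : ℕ → A} (hz : ReadsUniform z) : IsNormal z := by
  intro ℓ hℓ u
  -- The state is the position in the block together with the truth value of the agreement so far;
  -- `Prop` serves as a two-element type.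
  let t : ℕ → Fin ℓ × Prop := fun r => (⟨r % ℓ, Nat.mod_lt r hℓ⟩, Agrees z u r)
  have hmod : ∀ i j, j < ℓ → (i * ℓ + j) % ℓ = j := fun i j hj => by
    rw [Nat.mul_add_mod', Nat.mod_eq_of_lt hj]
  have hdiv : ∀ i j, j < ℓ → (i * ℓ + j) / ℓ = i := fun i j hj => by
    rw [mul_comm, Nat.mul_add_div hℓ, Nat.div_eq_of_lt hj, add_zero]
  have hsucc : ∀ r, r % ℓ + 1 < ℓ → (r + 1) % ℓ = r % ℓ + 1 ∧
      (Agrees z u (r + 1) ↔ Agrees z u r ∧ z r = u ⟨r % ℓ, Nat.mod_lt r hℓ⟩) := by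
    intro r hr
    have h0 : r / ℓ * ℓ + r % ℓ = r := Nat.div_add_mod' r ℓ
    have h1 : (r + 1) % ℓ = r % ℓ + 1 := by
      conv_lhs => rw [← h0, add_assoc]
      exact hmod _ _ hr
    have h2 : (r + 1) / ℓ = r / ℓ := by
      conv_lhs => rw [← h0, add_assoc]
      exact hdiv _ _ hr
    refine ⟨h1, ?_⟩
    unfold Agrees
    rw [h1, h2]
    constructor
    · intro h
      refine ⟨fun j hj => h j (by omega), ?_⟩
      have := h ⟨r % ℓ, Nat.mod_lt r hℓ⟩ (by simp)
      simpa [h0] using this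
    · rintro ⟨h3, h4⟩ j hj
      rcases Nat.lt_succ_iff_lt_or_eq.1 hj with hj | hj
      · exact h3 j hj
      · rw [hj, h0, h4]
        congr 1
        exact Fin.ext hj.symm
  have hreset : ∀ r, ¬ r % ℓ + 1 < ℓ → (r + 1) % ℓ = 0 := by
    intro r hr
    have h0 : r / ℓ * ℓ + r % ℓ = r := Nat.div_add_mod' r ℓ
    have h1 : r % ℓ + 1 = ℓ := by have := Nat.mod_lt r hℓ; omega
    rw [← h0, add_assoc, h1, ← Nat.succ_mul, Nat.mul_mod_left]
  have ht : DetRead t z := by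
    intro m n hmn hzmn
    simp only [t, Prod.mk.injEq, Fin.mk.injEq] at hmn ⊢
    obtain ⟨h1, h2⟩ := hmn
    by_cases h : m % ℓ + 1 < ℓ
    · have h' : n % ℓ + 1 < ℓ := h1 ▸ h
      refine ⟨by rw [(hsucc m h).1, (hsucc n h').1, h1], ?_⟩
      rw [propext (hsucc m h).2, propext (hsucc n h').2, h2, hzmn]
      simp only [h1]
    · have h' : ¬ n % ℓ + 1 < ℓ := h1 ▸ h
      refine ⟨by rw [hreset m h, hreset n h'], ?_⟩
      simp [Agrees, hreset m h, hreset n h']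
  -- `D j n` counts the blocks among the first `n` whose first `j` symbols agree with `u`.
  let D : ℕ → ℕ → ℝ := fun j n => ∑ i ∈ Finset.range n,
    ind (∀ j' : Fin ℓ, j' < j → z (i * ℓ + j') = u j')
  have hO : (fun n : ℕ => ((n * ℓ : ℕ) : ℝ)) =O[atTop] fun n : ℕ => (n : ℝ) := by
    refine IsBigO.of_bound ℓ (Eventually.of_forall fun n => ?_)
    simp [mul_comm]
  have hmul : Tendsto (fun n : ℕ => n * ℓ) atTop atTop := tendsto_id.atTop_mul_const' hℓ
  have hstep : ∀ j, j < ℓ →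
      (fun n => D (j + 1) n - D j n * (1 / Fintype.card A)) =o[atTop] fun n => (n : ℝ) := by
    intro j hj
    have h1 := ((hz.isLittleO ht (⟨j, hj⟩, True) (u ⟨j, hj⟩)).comp_tendsto hmul).trans_isBigO hO
    refine h1.congr_left fun n => ?_
    simp only [Function.comp, D]
    rw [sum_range_mul_eq, Finset.sum_mul, ← Finset.sum_sub_distrib]
    refine Finset.sum_congr rfl fun i _ => ?_
    rw [Finset.sum_eq_single j]
    · have h2 : ind (t (i * ℓ + j) = (⟨j, hj⟩, True))
          = ind (∀ j' : Fin ℓ, j' < j → z (i * ℓ + j') = u j') := by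
        refine ind_congr ?_
        simp [t, Agrees, hmod i j hj, hdiv i j hj]
      have h3 : ind (∀ j' : Fin ℓ, j' < j + 1 → z (i * ℓ + j') = u j')
          = ind (∀ j' : Fin ℓ, j' < j → z (i * ℓ + j') = u j')
            * ind (z (i * ℓ + j) = u ⟨j, hj⟩) := by
        rw [← ind_and]
        refine ind_congr ⟨fun h => ⟨fun j' hj' => h j' (by omega), h ⟨j, hj⟩ (by simp)⟩, ?_⟩
        rintro ⟨h3, h4⟩ j' hj'
        rcases Nat.lt_succ_iff_lt_or_eq.1 hj' with hj' | hj'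
        · exact h3 j' hj'
        · rw [hj', h4]
          congr 1
          exact Fin.ext hj'.symm
      rw [h2, h3]
      ring
    · intro j' hj' hne
      rw [ind_of_not, zero_mul]
      simp [t, hmod i j' (Finset.mem_range.1 hj'), hne]
    · intro h
      exact absurd (Finset.mem_range.2 hj) h
  have hD : ∀ j, j ≤ ℓ →
      (fun n : ℕ => D j n - n * ((Fintype.card A : ℝ) ^ j)⁻¹) =o[atTop] fun n => (n : ℝ) := by
    intro j
    induction j with
    | zero =>
      intro _
      simp [D, ind_of]
    | succ j ih =>
      intro hj
      have h1 := (hstep j hj).add ((ih (by omega)).const_mul_left (1 / (Fintype.card A : ℝ)))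
      refine h1.congr_left fun n => ?_
      rw [pow_succ, mul_inv]
      ring
  have hfin := (hD ℓ le_rfl).tendsto_div_nhds_zero.add_const (((Fintype.card A : ℝ) ^ ℓ)⁻¹)
  rw [zero_add] at hfin
  refine hfin.congr' ?_
  filter_upwards [eventually_ne_atTop 0] with n hn
  have hn' : (n : ℝ) ≠ 0 := by exact_mod_cast hn
  have h1 : D ℓ n = alignedOcc z u n := by
    rw [alignedOcc_eq_sum]
    simp [D]
  rw [h1]
  field_simp
  ring

/-! ### Runs on normal words -/

/-- Averages over the aligned blocks of a normal word. -/
lemma tendsto_block_average {z : ℕ → A} (hz : IsNormal z) {m : ℕ} (hm : 0 < m)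
    (G : (Fin m → A) → ℝ) :
    Tendsto (fun n : ℕ => (∑ i ∈ Finset.range n, G fun j => z (i * m + j)) / n) atTop
      (𝓝 (∑ u, ((Fintype.card A : ℝ) ^ m)⁻¹ * G u)) := by
  refine (tendsto_finsetSum Finset.univ fun u _ => (hz m hm u).mul_const (G u)).congr fun n => ?_
  simp only [alignedOcc_eq_sum, div_mul_eq_mul_div, Finset.sum_mul]
  rw [← Finset.sum_div, Finset.sum_comm]
  congr 1
  refine Finset.sum_congr rfl fun i _ => ?_
  rw [← sum_ind_eq_mul (fun j : Fin m => z (i * m + j)) G]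
  refine Finset.sum_congr rfl fun u _ => ?_
  rw [funext_iff]

lemma sum_fin_succ (m : ℕ) (F : A → (Fin m → A) → ℝ) :
    ∑ u : Fin (m + 1) → A, F (u 0) (Fin.tail u) = ∑ b, ∑ v, F b v := by
  rw [← Fintype.sum_prod_type', ← (Fin.consEquiv fun _ : Fin (m + 1) => A).sum_comp]
  refine Finset.sum_congr rfl fun p _ => ?_
  simp [Fin.consEquiv]

lemma sum_runSum {δ : Q → A → Q} {g : Q → A → ℝ} (hg : ∀ q, ∑ b, g q b = 0) (m : ℕ) (q : Q) :
    ∑ u, runSum δ g m q u = 0 := by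
  induction m generalizing q with
  | zero => simp [runSum]
  | succ m ih =>
    simp only [runSum]
    rw [sum_fin_succ m fun b v => g q b + runSum δ g m (δ q b) v]
    simp [Finset.sum_add_distrib, ih, ← Finset.mul_sum, hg]

/-- Orthogonality of centred increments: expanding the square, the cross term vanishes by
`sum_runSum`, whatever state the first symbol leads to, so each step adds at most 1 to the mean
square. -/
lemma sum_runSum_sq {δ : Q → A → Q} {g : Q → A → ℝ} (hg : ∀ q, ∑ b, g q b = 0)
    (hg' : ∀ q b, |g q b| ≤ 1) (m : ℕ) (q : Q) :
    ∑ u, runSum δ g m q u ^ 2 ≤ m * (Fintype.card A : ℝ) ^ m := by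
  induction m generalizing q with
  | zero => simp [runSum]
  | succ m ih =>
    simp only [runSum]
    rw [sum_fin_succ m fun b v => (g q b + runSum δ g m (δ q b) v) ^ 2]
    calc ∑ b, ∑ v, (g q b + runSum δ g m (δ q b) v) ^ 2
        ≤ ∑ _b : A, ((m + 1 : ℕ) * (Fintype.card A : ℝ) ^ m) := by
          refine Finset.sum_le_sum fun b _ => ?_
          have h1 : ∑ v, (g q b + runSum δ g m (δ q b) v) ^ 2
              = ∑ _v : Fin m → A, g q b ^ 2 + 2 * g q b * ∑ v, runSum δ g m (δ q b) v
                + ∑ v, runSum δ g m (δ q b) v ^ 2 := by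
            rw [Finset.mul_sum, ← Finset.sum_add_distrib, ← Finset.sum_add_distrib]
            exact Finset.sum_congr rfl fun v _ => by ring
          rw [h1, sum_runSum hg, mul_zero, add_zero]
          have h2 : ∑ _v : Fin m → A, g q b ^ 2 ≤ (Fintype.card A : ℝ) ^ m := by
            simp only [Finset.sum_const, Finset.card_univ, nsmul_eq_mul, Fintype.card_pi,
              Finset.prod_const, Fintype.card_fin, Nat.cast_pow]
            have h3 : g q b ^ 2 ≤ 1 := by
              rw [← sq_abs]
              exact pow_le_one₀ (abs_nonneg _) (hg' q b)
            have h4 : (0 : ℝ) ≤ (Fintype.card A : ℝ) ^ m := by positivity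
            nlinarith
          push_cast
          linarith [ih (δ q b)]
      _ = (m + 1 : ℕ) * (Fintype.card A : ℝ) ^ (m + 1) := by
          simp only [Finset.sum_const, Finset.card_univ, nsmul_eq_mul]
          ring

/-- The run is cut into blocks of length `m = M * M`. On a uniformly random block the sum of the
deviations has second moment at most `m`, hence mean absolute value at most `M`, from every starting
state. Normality turns this mean into an average over the aligned blocks of `z`, with a loss of
order `N / M` per symbol. -/
theorem readsUniform_of_isNormal [Nonempty A] {z : ℕ → A} (hz : IsNormal z) : ReadsUniform z := by
  intro N t ht p a
  classical
  have hA : (1 : ℝ) ≤ Fintype.card A := by exact_mod_cast Fintype.card_pos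
  obtain ⟨δ, hδ⟩ : ∃ δ : Fin N → A → Fin N, ∀ r, t (r + 1) = δ (t r) (z r) := by
    -- A transition function is extracted from the run; its value `q` on pairs that never occur is
    -- irrelevant.
    refine ⟨fun q b => if h : ∃ r, t r = q ∧ z r = b then t (h.choose + 1) else q, fun r => ?_⟩
    have h : ∃ r', t r' = t r ∧ z r' = z r := ⟨r, rfl, rfl⟩
    simp only [dif_pos h]
    exact (ht _ _ h.choose_spec.1 h.choose_spec.2).symm
  set g : Fin N → A → ℝ := fun q b => ind (q = p) * (ind (b = a) - 1 / Fintype.card A) with hgdef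
  have hg : ∀ q, ∑ b, g q b = 0 := by
    intro q
    simp only [hgdef, ← Finset.mul_sum, Finset.sum_sub_distrib]
    have h1 : ∑ b, ind (b = a) = 1 := by
      rw [← sum_ind_eq a]
      exact Finset.sum_congr rfl fun b _ => ind_congr eq_comm
    rw [h1]
    simp only [Finset.sum_const, Finset.card_univ, nsmul_eq_mul]
    field_simp
    ring
  have hg' : ∀ q b, |g q b| ≤ 1 := by
    intro q b
    rw [hgdef, abs_mul, abs_of_nonneg (ind_nonneg _)]
    have := abs_ind_sub_le (P := b = a) (w := 1 / Fintype.card A) (by positivity)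
      (by rw [div_le_one] <;> linarith)
    exact mul_le_one₀ (ind_le_one _) (abs_nonneg _) this
  change (fun n => ∑ k ∈ Finset.range n, g (t k) (z k)) =o[atTop] _
  rw [isLittleO_iff]
  intro ε hε
  -- This makes `(N * M + 1) / M ^ 2 ≤ (N + 1) / M < ε / 2`; the other half of `ε` is left for the
  -- incomplete last block.
  obtain ⟨M, hM⟩ := exists_nat_gt (max 1 (2 * (N + 1) / ε))
  have hM1 : (1 : ℝ) < M := (le_max_left _ _).trans_lt hM
  have hM2 : 2 * (N + 1) / ε < M := (le_max_right _ _).trans_lt hM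
  set m := M * M with hm
  have hm0 : 0 < m := by
    have : 0 < M := by
      have : (0 : ℝ) < M := by linarith
      exact_mod_cast this
    positivity
  -- The state at the beginning of a block is not controlled, so the bound is summed over all
  -- states.
  let G : (Fin m → A) → ℝ := fun u => ∑ q, |runSum δ g m q u|
  have hGavg : ∑ u, ((Fintype.card A : ℝ) ^ m)⁻¹ * G u ≤ N * M := by
    rw [← Finset.mul_sum]
    have h1 : ∑ u, G u ≤ N * (M * (Fintype.card A : ℝ) ^ m) := by
      simp only [G]
      rw [Finset.sum_comm]
      calc ∑ q : Fin N, ∑ u, |runSum δ g m q u|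
          ≤ ∑ _q : Fin N, (M * (Fintype.card A : ℝ) ^ m) := by
            refine Finset.sum_le_sum fun q _ => ?_
            -- The inequality of the means for `M` and `|runSum|`, scaled so that the second moment
            -- bound `m = M ^ 2` yields exactly `M` on average.
            have h2 : ∀ u, |runSum δ g m q u| ≤ M / 2 + runSum δ g m q u ^ 2 / (2 * M) := by
              intro u
              have h3 : 0 ≤ (|runSum δ g m q u| - M) ^ 2 := sq_nonneg _
              rw [sub_sq, sq_abs] at h3
              have h4 : M / 2 + runSum δ g m q u ^ 2 / (2 * M)
                  = (M ^ 2 + runSum δ g m q u ^ 2) / (2 * M) := by field_simp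
              rw [h4, le_div_iff₀ (by linarith)]
              linarith
            calc ∑ u, |runSum δ g m q u| ≤ ∑ u, (M / 2 + runSum δ g m q u ^ 2 / (2 * M)) :=
                  Finset.sum_le_sum fun u _ => h2 u
              _ = (Fintype.card A : ℝ) ^ m * (M / 2)
                    + (∑ u, runSum δ g m q u ^ 2) / (2 * M) := by
                  rw [Finset.sum_add_distrib, Finset.sum_div]
                  simp
              _ ≤ (Fintype.card A : ℝ) ^ m * (M / 2)
                    + (m * (Fintype.card A : ℝ) ^ m) / (2 * M) := by
                  gcongr
                  exact sum_runSum_sq hg hg' m q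
              _ = M * (Fintype.card A : ℝ) ^ m := by
                  rw [hm]
                  push_cast
                  field_simp
                  ring
        _ = N * (M * (Fintype.card A : ℝ) ^ m) := by simp
    have h5 : (0 : ℝ) < (Fintype.card A : ℝ) ^ m := by positivity
    calc ((Fintype.card A : ℝ) ^ m)⁻¹ * ∑ u, G u
        ≤ ((Fintype.card A : ℝ) ^ m)⁻¹ * (N * (M * (Fintype.card A : ℝ) ^ m)) := by gcongr
      _ = N * M := by field_simp
  have hev := (tendsto_block_average hz hm0 G).eventually (gt_mem_nhds
    (lt_of_le_of_lt hGavg (lt_add_one _)))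
  have hdivT : Tendsto (fun n : ℕ => n / m) atTop atTop := Nat.tendsto_div_const_atTop hm0.ne'
  filter_upwards [hdivT.eventually hev, hdivT.eventually (eventually_gt_atTop 0),
    tendsto_natCast_atTop_atTop.eventually (eventually_ge_atTop (2 * m / ε))] with n h1 h2 h3
  rw [Real.norm_natCast, Real.norm_eq_abs]
  set K := n / m with hK
  have hK0 : (0 : ℝ) < K := by exact_mod_cast h2
  have hn : n = K * m + n % m := (Nat.div_add_mod' n m).symm
  have hsplit : ∑ k ∈ Finset.range n, g (t k) (z k)
      = ∑ i ∈ Finset.range K, runSum δ g m (t (i * m)) (fun j => z (i * m + j))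
        + ∑ j ∈ Finset.range (n % m), g (t (K * m + j)) (z (K * m + j)) := by
    conv_lhs => rw [hn]
    rw [Finset.sum_range_add, sum_range_mul_eq]
    simp only [runSum_eq_sum hδ]
  have hb1 : |∑ i ∈ Finset.range K, runSum δ g m (t (i * m)) (fun j => z (i * m + j))|
      ≤ K * (N * M + 1) := by
    calc _ ≤ ∑ i ∈ Finset.range K, |runSum δ g m (t (i * m)) (fun j => z (i * m + j))| :=
          Finset.abs_sum_le_sum_abs _ _
      _ ≤ ∑ i ∈ Finset.range K, G fun j => z (i * m + j) := by
          refine Finset.sum_le_sum fun i _ => ?_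
          exact Finset.single_le_sum (f := fun q => |runSum δ g m q fun j => z (i * m + j)|)
            (fun q _ => abs_nonneg _) (Finset.mem_univ (t (i * m)))
      _ ≤ K * (N * M + 1) := by
          rw [div_lt_iff₀ hK0] at h1
          linarith
  have hb2 : |∑ j ∈ Finset.range (n % m), g (t (K * m + j)) (z (K * m + j))| ≤ m := by
    calc _ ≤ ∑ j ∈ Finset.range (n % m), |g (t (K * m + j)) (z (K * m + j))| :=
          Finset.abs_sum_le_sum_abs _ _
      _ ≤ ∑ j ∈ Finset.range (n % m), (1 : ℝ) := Finset.sum_le_sum fun j _ => hg' _ _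
      _ = (n % m : ℕ) := by simp
      _ ≤ m := by exact_mod_cast (Nat.mod_lt n hm0).le
  have hKm : (K : ℝ) * (M * M) ≤ n := by
    have : K * m ≤ n := Nat.div_mul_le_self n m
    rw [hm] at this
    exact_mod_cast this
  have hMε : 2 * (N + 1) < M * ε := (div_lt_iff₀ hε).1 hM2
  have hnε : 2 * m ≤ n * ε := (div_le_iff₀ hε).1 h3
  have hKN : K * (N * M + 1) ≤ n * ε / 2 := by
    have h6 : (K : ℝ) * (N * M + 1) ≤ K * M * (N + 1) := by nlinarith
    have h7 : (K : ℝ) * M * (2 * (N + 1)) ≤ K * M * (M * ε) := by gcongr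
    have h8 : (K : ℝ) * M * (M * ε) ≤ n * ε := by nlinarith
    linarith
  rw [hsplit]
  calc _ ≤ _ := abs_add_le _ _
    _ ≤ ε * n := by linarith

end OneTape

/-! ### Selectors -/

section Selectors

variable {A B Q : Type*}

lemma ThreeAutomaton.IsDet₂.run {C : Type*} {M : ThreeAutomaton A B C Q} (hM : M.IsDet₂)
    {s : ℕ → Q} {l : ℕ → Option A × Option B × Option C} (hr : M.IsRun s l) {m n : ℕ}
    (h : s m = s n) :
    supp₂ ((l m).1, (l m).2.1) = supp₂ ((l n).1, (l n).2.1) ∧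
      (((l m).1, (l m).2.1) = ((l n).1, (l n).2.1) → l m = l n ∧ s (m + 1) = s (n + 1)) := by
  have h1 := hr m
  rw [h] at h1
  exact hM.2 _ _ _ _ _ h1 (hr n)

lemma exists_frequently_eq [Finite Q] {s : ℕ → Q} {P : ℕ → Prop} (h : ∃ᶠ k in atTop, P k) :
    ∃ q, ∃ᶠ k in atTop, s k = q ∧ P k := by
  by_contra hno
  push Not at hno
  refine h ((eventually_all.2 hno).mono fun k hk hP => ?_)
  exact hk (s k) rfl hP

lemma weight_some_none [Fintype A] [Fintype B] (a : A) :
    TwoAutomaton.weight (some a, (none : Option B)) = 1 / Fintype.card A := by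
  simp [TwoAutomaton.weight]

lemma weight_none_some [Fintype A] [Fintype B] (b : B) :
    TwoAutomaton.weight ((none : Option A), some b) = 1 / Fintype.card B := by
  simp [TwoAutomaton.weight]

/-- An automaton reading the output is run in parallel with the selector, which gives a
deterministic run on `x` and `y`. The deviation along the output is a sum of deviations at the
copying states of the product. This yields o(n) in the number of steps; positive density of a
copying state turns it into a bound in the number of output symbols. -/
theorem selectionsNormal_of_runsErgodic [Fintype A] [Fintype B] {x : ℕ → A} {y : ℕ → B}
    (h : RunsErgodic x y) : SelectionsNormal x y := by
  rintro Q _ S ⟨hdet, htype⟩ hobl z ⟨s, l, hrun, -, hx, hy, hz⟩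
  refine isNormal_of_readsUniform fun N t ht p a => isLittleO_of_comp_lengthRead hz ?_
  set out : ℕ → Option A := fun n => (l n).2.2 with hout
  set R : ℕ → ℕ := lengthRead out with hR
  set inp : ℕ → Option A × Option B := fun n => ((l n).1, (l n).2.1) with hinp
  have hcopy : ∀ k, (out k).isSome → CopiesFirst (l k) := by
    intro k hk
    rcases htype _ _ _ (hrun k) with h1 | ⟨b, h1⟩ | ⟨b, h1⟩
    · exact h1
    · simp [hout, h1] at hk
    · simp [hout, h1] at hk
  have hrun' : DetRunOn (fun k => (s k, t (R k))) inp x y := by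
    refine ⟨fun m n hmn => ?_, hx, hy⟩
    simp only [Prod.mk.injEq] at hmn ⊢
    have h1 := hdet.run hrun hmn.1
    refine ⟨h1.1, fun hl => ⟨(h1.2 hl).2, ?_⟩⟩
    have h2 : out m = out n := congrArg (fun w => w.2.2) (h1.2 hl).1
    cases hm : out m with
    | none => rw [hR, lengthRead_succ_none hm, lengthRead_succ_none (h2.symm.trans hm), hmn.2]
    | some b =>
      have hn := h2.symm.trans hm
      rw [hR, lengthRead_succ_some hm, lengthRead_succ_some hn]
      refine ht _ _ hmn.2 ?_
      rw [hz.1 m b hm, hz.1 n b hn]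
  have hE := h.equidistributed hrun'
  let copy : Q → Prop := fun q => ∃ k, s k = q ∧ CopiesFirst (l k)
  -- Obliviousness enters here: whether a symbol is copied depends on the state and not on the
  -- symbol, so the selected symbols are not biased by the selection.
  have hcopy' : ∀ k, copy (s k) → ∃ b, l k = (some b, none, some b) := by
    rintro k ⟨j, hj, hj'⟩
    have h1 := hrun j
    rw [hj] at h1
    exact (hobl _ _ _ _ _ h1 (hrun k)).1.1 hj'
  have := Fintype.ofFinite Q
  have hsum : ∀ n, ∑ r ∈ Finset.range (R n), ind (t r = p) * (ind (z r = a) - 1 / Fintype.card A)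
      = ∑ q, ind (copy q) * dev (fun k => (s k, t (R k))) inp (q, p) (some a, none) n := by
    intro n
    rw [← sum_lengthRead out fun r => ind (t r = p) * (ind (z r = a) - 1 / Fintype.card A)]
    simp only [dev, Finset.mul_sum]
    rw [Finset.sum_comm]
    refine Finset.sum_congr rfl fun k _ => ?_
    have h1 : ∑ q, ind (copy q) * (ind ((s k, t (R k)) = (q, p)) * (ind (inp k = (some a, none))
        - TwoAutomaton.weight (some a, (none : Option B))))
        = ind (copy (s k)) * (ind (t (R k) = p) * (ind (inp k = (some a, none))
          - 1 / Fintype.card A)) := by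
      rw [← sum_ind_eq_mul (s k) fun q => ind (copy q) * (ind (t (R k) = p) *
        (ind (inp k = (some a, none)) - 1 / Fintype.card A))]
      refine Finset.sum_congr rfl fun q _ => ?_
      rw [Prod.mk.injEq, ind_and, weight_some_none]
      ring
    rw [h1]
    by_cases hk : copy (s k)
    · obtain ⟨b, hb⟩ := hcopy' k hk
      have h2 : z (R k) = b := hz.1 k b (show out k = some b by simp [hout, hb])
      rw [ind_of hk, ind_of (show (out k).isSome by simp [hout, hb]), ← hR, h2]
      simp only [hinp, hb, Prod.mk.injEq, Option.some.injEq, and_true]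
    · rw [ind_of_not hk, ind_of_not (fun h' => hk ⟨k, rfl, hcopy k h'⟩), zero_mul, zero_mul]
  have hlittle : (fun n => ∑ r ∈ Finset.range (R n),
      ind (t r = p) * (ind (z r = a) - 1 / Fintype.card A)) =o[atTop] fun n => (n : ℝ) := by
    simp only [hsum]
    refine IsLittleO.fun_sum fun q _ => ?_
    by_cases hq : copy q
    · refine IsLittleO.const_mul_left ?_ _
      by_cases hv : ∃ k, (s k, t (R k)) = (q, p)
      · obtain ⟨k₀, hk₀⟩ := hv
        have h1 := hE k₀ (some a, none) (by
          obtain ⟨b, hb⟩ := hcopy' k₀ (by rw [(Prod.mk.inj hk₀).1]; exact hq)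
          simp [hinp, hb, supp₂])
        simp only [hk₀] at h1
        exact h1
      · push Not at hv
        rw [dev_eq_zero_of_not_visited hv]
        exact isLittleO_zero _ _
    · simp [ind_of_not hq]
  -- The output is infinite, so some copying state recurs; its density bounds the output length from
  -- below by `κ * n`.
  obtain ⟨q, hq⟩ := exists_frequently_eq (s := s) (frequently_atTop.2 hz.2)
  have hqc : copy q := by
    obtain ⟨k, hk, hk'⟩ := hq.exists
    exact ⟨k, hk, hcopy k hk'⟩
  have hrun₀ : DetRunOn s inp x y :=
    ⟨fun m n hmn => ⟨(hdet.run hrun hmn).1, fun hl => ((hdet.run hrun hmn).2 hl).2⟩, hx, hy⟩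
  obtain ⟨κ, hκ, hκ'⟩ := h.density hrun₀ (hq.mono fun k hk => hk.1)
  refine hlittle.trans_isBigO (IsBigO.of_bound κ⁻¹ ?_)
  filter_upwards [hκ'] with n hn
  rw [Real.norm_natCast, Real.norm_natCast, inv_mul_eq_div, le_div_iff₀ hκ, mul_comm]
  refine hn.trans ?_
  rw [lengthRead_eq_sum]
  refine Finset.sum_le_sum fun k _ => ?_
  by_cases hk : s k = q
  · obtain ⟨b, hb⟩ := hcopy' k (by rw [hk]; exact hqc)
    rw [ind_of (P := (out k).isSome) (by simp [hout, hb])]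
    exact ind_le_one _
  · rw [ind_of_not hk]
    exact ind_nonneg _

lemma Single.cases {lab : Option A × Option B} (h : Single lab) :
    (∃ a, lab = (some a, none)) ∨ ∃ b, lab = (none, some b) := by
  obtain ⟨_ | a, _ | b⟩ := lab <;> simp_all [Single]

/-- The run itself becomes an oblivious selector that copies precisely the symbols read at the state
`p`. Normality of this output includes the right frequency of each single symbol. If `p` is visited
only finitely often, the deviation is bounded and there is nothing to select. -/
theorem halfUniform_of_selectionsNormal [Fintype A] [Fintype B] [Nonempty A] {x : ℕ → A}
    {y : ℕ → B} (h : SelectionsNormal x y) : HalfUniform x y := by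
  intro N s l hrun hl k₀ a hk₀
  set p := s k₀ with hp
  by_cases hio : ∃ᶠ k in atTop, s k = p
  swap
  · refine isLittleO_sum_of_eventually_zero ?_
    filter_upwards [not_frequently.1 hio] with k hk
    rw [ind_of_not hk, zero_mul]
  have hpx : ∀ k, s k = p → ∃ b, l k = (some b, none) := by
    intro k hk
    rcases (hl k).cases with h1 | ⟨b, hb⟩
    · exact h1
    · have h2 := (supp₂_eq_iff.1 (hrun.det k k₀ hk).1).1
      simp [hb, hk₀] at h2
  set out : ℕ → Option A := fun k => if s k = p then (l k).1 else none with hout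
  let S : ThreeAutomaton A B A (Fin N) :=
    ⟨{w | ∃ k, w = (s k, ((l k).1, (l k).2, out k), s (k + 1))}, {s 0}⟩
  have hsel : ThreeAutomaton.IsSelector S := by
    refine ⟨⟨⟨s 0, rfl⟩, ?_⟩, ?_⟩
    · rintro q lab r lab' r' ⟨k, hk⟩ ⟨j, hj⟩
      simp only [Prod.mk.injEq] at hk hj
      obtain ⟨rfl, rfl, rfl⟩ := hk
      obtain ⟨hkj, rfl, rfl⟩ := hj
      have h1 := hrun.det k j hkj
      refine ⟨h1.1, fun hlab => ?_⟩
      have h2 : l k = l j := hlab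
      refine ⟨?_, h1.2 h2⟩
      simp only [hout, h2, hkj]
    · rintro q lab r ⟨k, hk⟩
      simp only [Prod.mk.injEq] at hk
      obtain ⟨rfl, rfl, rfl⟩ := hk
      by_cases hs : s k = p
      · obtain ⟨b, hb⟩ := hpx k hs
        exact Or.inl ⟨b, by simp [hout, hs, hb]⟩
      · rcases (hl k).cases with ⟨b, hb⟩ | ⟨b, hb⟩
        · exact Or.inr (Or.inl ⟨b, by simp [hout, hs, hb]⟩)
        · exact Or.inr (Or.inr ⟨b, by simp [hout, hs, hb]⟩)
  have hobl : ThreeAutomaton.IsOblivious S := by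
    have htypes : ∀ k,
        (CopiesFirst ((l k).1, (l k).2, out k) ↔ s k = p) ∧
        (SkipsFirst ((l k).1, (l k).2, out k) ↔ s k ≠ p ∧ (l k).1.isSome) ∧
        (SkipsSecond ((l k).1, (l k).2, out k) ↔ (l k).2.isSome) := by
      intro k
      by_cases hs : s k = p
      · obtain ⟨b, hb⟩ := hpx k hs
        simp [CopiesFirst, SkipsFirst, SkipsSecond, hout, hs, hb]
      · rcases (hl k).cases with ⟨b, hb⟩ | ⟨b, hb⟩ <;>
          simp [CopiesFirst, SkipsFirst, SkipsSecond, hout, hs, hb]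
    rintro q lab r lab' r' ⟨k, hk⟩ ⟨j, hj⟩
    simp only [Prod.mk.injEq] at hk hj
    obtain ⟨rfl, rfl, rfl⟩ := hk
    obtain ⟨hkj, rfl, rfl⟩ := hj
    have h1 := supp₂_eq_iff.1 (hrun.det k j hkj).1
    rw [(htypes k).1, (htypes j).1, (htypes k).2.1, (htypes j).2.1, (htypes k).2.2,
      (htypes j).2.2, hkj, h1.1, h1.2]
    exact ⟨Iff.rfl, Iff.rfl, Iff.rfl⟩
  obtain ⟨z, hz⟩ : ∃ z, Spells out z := by
    refine exists_spells fun m => ?_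
    obtain ⟨k, hk, hk'⟩ := frequently_atTop.1 hio m
    obtain ⟨b, hb⟩ := hpx k hk'
    exact ⟨k, hk, by simp [hout, hk', hb]⟩
  have hnorm := h (Fin N) S hsel hobl z
    ⟨s, fun k => ((l k).1, (l k).2, out k), fun k => ⟨k, rfl⟩, rfl, hrun.fst, hrun.snd, hz⟩
  have h1 := (readsUniform_of_isNormal hnorm).isLittleO (t := fun _ => ()) (fun _ _ _ _ => rfl)
    () a
  simp only [ind_of, one_mul] at h1
  have h2 := h1.comp_tendsto hz.tendsto_lengthRead
  refine (h2.trans_isBigO (IsBigO.of_bound 1 (Eventually.of_forall fun n => ?_))).congr_left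
    fun n => ?_
  · simp only [Function.comp, Real.norm_natCast, one_mul, Nat.cast_le]
    exact lengthRead_le _ _
  · simp only [Function.comp, dev]
    rw [← sum_lengthRead out fun r => ind (z r = a) - 1 / Fintype.card A]
    refine Finset.sum_congr rfl fun k _ => ?_
    by_cases hs : s k = p
    · obtain ⟨b, hb⟩ := hpx k hs
      have h3 : out k = some b := by simp [hout, hs, hb]
      rw [hz.1 k b h3, h3, ind_of hs, ind_of (by simp), weight_some_none, hb]
      simp
    · rw [ind_of_not hs, ind_of_not (by simp [hout, hs]), zero_mul, zero_mul]

end Selectors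

/-! ### Shufflers -/

section Shufflers

variable {A Q : Type*} [Fintype A]

lemma lengthRead_eq_self {X : Type*} {α : ℕ → Option X} (h : ∀ k, (α k).isSome) (n : ℕ) :
    lengthRead α n = n := by
  induction n with
  | zero => simp
  | succ n ih =>
    obtain ⟨a, ha⟩ := Option.isSome_iff_exists.1 (h n)
    rw [lengthRead_succ_some ha, ih]

/-- As for selectors, but every step writes one symbol, so steps and output positions agree and no
density is needed. -/
theorem shufflesNormal_of_runsErgodic {x y : ℕ → A} (h : RunsErgodic x y) :
    ShufflesNormal x y := by
  rintro Q _ S ⟨hdet, htype⟩ z ⟨s, l, hrun, -, hx, hy, hz⟩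
  refine isNormal_of_readsUniform fun N t ht p a => ?_
  have hlab : ∀ k, (∃ b, l k = (some b, none, some b)) ∨ ∃ b, l k = (none, some b, some b) :=
    fun k => htype _ _ _ (hrun k)
  have hz' : ∀ k, (l k).2.2 = some (z k) := by
    have h1 : ∀ k, (l k).2.2.isSome := by
      intro k
      rcases hlab k with ⟨b, hb⟩ | ⟨b, hb⟩ <;> simp [hb]
    intro k
    obtain ⟨b, hb⟩ := Option.isSome_iff_exists.1 (h1 k)
    have := hz.1 k b hb
    rw [lengthRead_eq_self h1] at this
    rw [hb, this]
  set inp : ℕ → Option A × Option A := fun n => ((l n).1, (l n).2.1) with hinp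
  have hinp' : ∀ k, inp k = (some (z k), none) ∨ inp k = (none, some (z k)) := by
    intro k
    have h1 := hz' k
    rcases hlab k with ⟨b, hb⟩ | ⟨b, hb⟩ <;> simp_all
  have hrun' : DetRunOn (fun k => (s k, t k)) inp x y := by
    refine ⟨fun m n hmn => ?_, hx, hy⟩
    simp only [Prod.mk.injEq] at hmn ⊢
    have h1 := hdet.run hrun hmn.1
    refine ⟨h1.1, fun hl => ⟨(h1.2 hl).2, ht _ _ hmn.2 ?_⟩⟩
    have h2 : (l m).2.2 = (l n).2.2 := congrArg (fun w => w.2.2) (h1.2 hl).1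
    rw [hz', hz'] at h2
    exact Option.some_injective _ h2
  have hE := h.equidistributed hrun'
  -- The input label that writes `a` at the given state; the state determines which tape is read.
  let lab : Q → Option A × Option A := fun q => open Classical in
    if ∃ k, s k = q ∧ (inp k).1.isSome then (some a, none) else (none, some a)
  have hlab' : ∀ k, (inp k = (some (z k), none) ∧ lab (s k) = (some a, none)) ∨
      (inp k = (none, some (z k)) ∧ lab (s k) = (none, some a)) := by
    intro k
    rcases hinp' k with hk | hk
    · exact Or.inl ⟨hk, if_pos ⟨k, rfl, by simp [hk]⟩⟩
    · refine Or.inr ⟨hk, if_neg ?_⟩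
      rintro ⟨j, hj, hj'⟩
      have h1 := (supp₂_eq_iff.1 (hdet.run hrun hj).1).1
      have h2 : (inp k).1.isSome := h1 ▸ hj'
      simp [hk] at h2
  have := Fintype.ofFinite Q
  have hsum : ∀ n, ∑ k ∈ Finset.range n, ind (t k = p) * (ind (z k = a) - 1 / Fintype.card A)
      = ∑ q, dev (fun k => (s k, t k)) inp (q, p) (lab q) n := by
    intro n
    simp only [dev]
    rw [Finset.sum_comm]
    refine Finset.sum_congr rfl fun k _ => ?_
    have h1 : ∑ q, ind ((s k, t k) = (q, p)) * (ind (inp k = lab q) - TwoAutomaton.weight (lab q))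
        = ind (t k = p) * (ind (inp k = lab (s k)) - TwoAutomaton.weight (lab (s k))) := by
      rw [← sum_ind_eq_mul (s k) fun q => ind (t k = p) *
        (ind (inp k = lab q) - TwoAutomaton.weight (lab q))]
      refine Finset.sum_congr rfl fun q _ => ?_
      rw [Prod.mk.injEq, ind_and]
      ring
    rw [h1]
    rcases hlab' k with ⟨h2, h3⟩ | ⟨h2, h3⟩
    · rw [h2, h3, weight_some_none]
      simp
    · rw [h2, h3, weight_none_some]
      simp
  simp only [hsum]
  refine IsLittleO.fun_sum fun q _ => ?_
  by_cases hv : ∃ k, (s k, t k) = (q, p)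
  · obtain ⟨k₀, hk₀⟩ := hv
    have h1 := hE k₀ (lab q) (by
      rw [← (Prod.mk.inj hk₀).1]
      rcases hlab' k₀ with ⟨h2, h3⟩ | ⟨h2, h3⟩ <;> rw [h2, h3] <;> rfl)
    simp only [hk₀] at h1
    exact h1
  · push Not at hv
    rw [dev_eq_zero_of_not_visited hv]
    exact isLittleO_zero _ _

/-- A run reading one symbol at a time becomes a shuffler by writing what it reads. The state
determines the tape, so the written symbol determines the label, and the run is also a deterministic
one-tape run on the normal output. -/
lemma equidistributed_of_shufflesNormal [Nonempty A] {x y : ℕ → A} (h : ShufflesNormal x y)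
    {N : ℕ} {s : ℕ → Fin N} {l : ℕ → Option A × Option A} (hrun : DetRunOn s l x y)
    (hl : ∀ k, Single (l k)) : Equidistributed s l := by
  set out : ℕ → Option A := fun k => (l k).1 <|> (l k).2 with hout
  have hsome : ∀ k, (out k).isSome := by
    intro k
    rcases (hl k).cases with ⟨b, hb⟩ | ⟨b, hb⟩ <;> simp [hout, hb]
  let S : ThreeAutomaton A A A (Fin N) :=
    ⟨{w | ∃ k, w = (s k, ((l k).1, (l k).2, out k), s (k + 1))}, {s 0}⟩
  have hS : ThreeAutomaton.IsShuffler S := by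
    refine ⟨⟨⟨s 0, rfl⟩, ?_⟩, ?_⟩
    · rintro q lab r lab' r' ⟨k, hk⟩ ⟨j, hj⟩
      simp only [Prod.mk.injEq] at hk hj
      obtain ⟨rfl, rfl, rfl⟩ := hk
      obtain ⟨hkj, rfl, rfl⟩ := hj
      have h1 := hrun.det k j hkj
      refine ⟨h1.1, fun hlab => ?_⟩
      have h2 : l k = l j := hlab
      refine ⟨?_, h1.2 h2⟩
      simp only [hout, h2]
    · rintro q lab r ⟨k, hk⟩
      simp only [Prod.mk.injEq] at hk
      obtain ⟨rfl, rfl, rfl⟩ := hk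
      rcases (hl k).cases with ⟨b, hb⟩ | ⟨b, hb⟩
      · exact Or.inl ⟨b, by simp [hout, hb]⟩
      · exact Or.inr ⟨b, by simp [hout, hb]⟩
  obtain ⟨z, hz⟩ : ∃ z, Spells out z := exists_spells fun m => ⟨m, le_rfl, hsome m⟩
  have hnorm := h (Fin N) S hS z
    ⟨s, fun k => ((l k).1, (l k).2, out k), fun k => ⟨k, rfl⟩, rfl, hrun.fst, hrun.snd, hz⟩
  have hz' : ∀ k, l k = (some (z k), none) ∨ l k = (none, some (z k)) := by
    intro k
    obtain ⟨b, hb⟩ := Option.isSome_iff_exists.1 (hsome k)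
    have h1 := hz.1 k b hb
    rw [lengthRead_eq_self hsome] at h1
    subst h1
    rcases (hl k).cases with ⟨c, hc⟩ | ⟨c, hc⟩ <;> simp_all
  have hread : DetRead s z := by
    intro m n hmn hzmn
    have h1 := hrun.det m n hmn
    refine h1.2 ?_
    have h2 := h1.1
    rcases hz' m with hm | hm <;> rcases hz' n with hn | hn <;> rw [hm, hn] at h2 ⊢ <;>
      simp_all [supp₂]
  intro k₀ lab hlab
  obtain ⟨a, ha⟩ : ∃ a, ∀ k, s k = s k₀ → (l k = lab ↔ z k = a) ∧
      TwoAutomaton.weight lab = 1 / Fintype.card A := by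
    obtain ⟨o₁, o₂⟩ := lab
    have hs : ∀ k, s k = s k₀ → supp₂ (l k) = supp₂ (o₁, o₂) := fun k hk =>
      (hrun.det k k₀ hk).1.trans hlab
    have h0 := hs k₀ rfl
    rcases hz' k₀ with hk | hk
    · rw [hk, supp₂_eq_iff] at h0
      obtain ⟨a, rfl⟩ : ∃ a, o₁ = some a := Option.isSome_iff_exists.1 h0.1.symm
      obtain rfl : o₂ = none := by simpa using h0.2
      refine ⟨a, fun k hk => ⟨?_, weight_some_none a⟩⟩
      have h1 := hs k hk
      rcases hz' k with hk | hk <;> rw [hk] at h1 ⊢ <;> simp_all [supp₂]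
    · rw [hk, supp₂_eq_iff] at h0
      obtain rfl : o₁ = none := by simpa using h0.1
      obtain ⟨a, rfl⟩ : ∃ a, o₂ = some a := Option.isSome_iff_exists.1 h0.2.symm
      refine ⟨a, fun k hk => ⟨?_, weight_none_some a⟩⟩
      have h1 := hs k hk
      rcases hz' k with hk | hk <;> rw [hk] at h1 ⊢ <;> simp_all [supp₂]
  refine (readsUniform_of_isNormal hnorm N s hread (s k₀) a).congr_left fun n => ?_
  refine Finset.sum_congr rfl fun k _ => ?_
  by_cases hs : s k = s k₀
  · rw [(ha k hs).2, ind_congr (ha k hs).1]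
  · rw [ind_of_not hs, zero_mul, zero_mul]

theorem halfUniform_of_shufflesNormal [Nonempty A] {x y : ℕ → A} (h : ShufflesNormal x y) :
    HalfUniform x y ∧ HalfUniform y x := by
  constructor
  · intro N s l hrun hl k₀ a hk₀
    refine equidistributed_of_shufflesNormal h hrun hl k₀ _ ?_
    rcases (hl k₀).cases with ⟨b, hb⟩ | ⟨b, hb⟩
    · simp [hb, supp₂]
    · simp [hb] at hk₀
  · intro N s l hrun hl k₀ a hk₀
    have hE := equidistributed_of_shufflesNormal h hrun.swap
      (fun k => by have := hl k; unfold Single at this ⊢; simp [this])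
    rw [← dev_swap]
    refine hE k₀ _ ?_
    rcases (hl k₀).cases with ⟨b, hb⟩ | ⟨b, hb⟩
    · simp [hb, supp₂]
    · simp [hb] at hk₀

end Shufflers

/-! ### Paths along the transitions of a run -/

section Paths

variable {Λ Q : Type*} (s : ℕ → Q) (l : ℕ → Λ)

/-- The label `lab` occurs at the state `p`. -/
def Occurs (p : Q) (lab : Λ) : Prop := ∃ k, s k = p ∧ l k = lab

/-- The state following an occurrence of the label `lab` at the state `p`. -/
def next (p : Q) (lab : Λ) : Q := open Classical in
  if h : Occurs s l p lab then s (h.choose + 1) else p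

/-- The list of labels is the label of a path, starting at `p`, that uses transitions of the
run. -/
def IsPath : Q → List Λ → Prop
  | _, [] => True
  | p, lab :: γ => Occurs s l p lab ∧ IsPath (next s l p lab) γ

/-- The last state of a path. -/
def pathEnd (p : Q) (γ : List Λ) : Q := γ.foldl (next s l) p

variable {s l}

lemma isPath_append {p : Q} {γ γ' : List Λ} (h : IsPath s l p γ)
    (h' : IsPath s l (pathEnd s l p γ) γ') : IsPath s l p (γ ++ γ') := by
  induction γ generalizing p with
  | nil => exact h'
  | cons lab γ ih => exact ⟨h.1, ih h.2 h'⟩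

lemma next_eq (hdet : ∀ m n, s m = s n → l m = l n → s (m + 1) = s (n + 1)) (k : ℕ) :
    next s l (s k) (l k) = s (k + 1) := by
  have h : Occurs s l (s k) (l k) := ⟨k, rfl, rfl⟩
  rw [next, dif_pos h]
  exact hdet _ _ h.choose_spec.1 h.choose_spec.2

lemma Occurs.exists_next {p : Q} {lab : Λ}
    (hdet : ∀ m n, s m = s n → l m = l n → s (m + 1) = s (n + 1)) (h : Occurs s l p lab) :
    ∃ k, s k = p ∧ l k = lab ∧ s (k + 1) = next s l p lab := by
  obtain ⟨k, rfl, rfl⟩ := h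
  exact ⟨k, rfl, rfl, (next_eq hdet k).symm⟩

lemma exists_pathEnd (hdet : ∀ m n, s m = s n → l m = l n → s (m + 1) = s (n + 1)) {γ : List Λ}
    {k : ℕ} (h : IsPath s l (s k) γ) : ∃ j, s j = pathEnd s l (s k) γ := by
  induction γ generalizing k with
  | nil => exact ⟨k, rfl⟩
  | cons lab γ ih =>
    obtain ⟨j, -, -, h3⟩ := h.1.exists_next hdet
    have h4 := h.2
    rw [← h3] at h4
    obtain ⟨i, hi⟩ := ih h4
    exact ⟨i, by rw [hi, h3]; rfl⟩

lemma exists_path_to (hdet : ∀ m n, s m = s n → l m = l n → s (m + 1) = s (n + 1)) (k : ℕ) :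
    ∃ γ, IsPath s l (s 0) γ ∧ pathEnd s l (s 0) γ = s k := by
  induction k with
  | zero => exact ⟨[], trivial, rfl⟩
  | succ k ih =>
    obtain ⟨γ, h1, h2⟩ := ih
    refine ⟨γ ++ [l k], isPath_append h1 ?_, ?_⟩
    · rw [h2]
      exact ⟨⟨k, rfl, rfl⟩, trivial⟩
    · rw [pathEnd, List.foldl_append]
      change next s l (pathEnd s l (s 0) γ) (l k) = _
      rw [h2, next_eq hdet]

/-- A path, continued by an infinite run, is an infinite run. -/
lemma exists_run_of_path {M : Automaton Λ Q}
    (hdet : ∀ m n, s m = s n → l m = l n → s (m + 1) = s (n + 1)) (hrun : M.IsRun s l) {p : Q}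
    {γ : List Λ} (h : IsPath s l p γ) {σ : ℕ → Q} {l' : ℕ → Λ} (hσ : M.IsRun σ l')
    (h0 : σ 0 = pathEnd s l p γ) : ∃ σ', M.IsRun σ' (appendSeq γ l') ∧ σ' 0 = p := by
  induction γ generalizing p with
  | nil => exact ⟨σ, hσ, h0⟩
  | cons lab γ ih =>
    obtain ⟨σ', h1, h2⟩ := ih h.2 h0
    refine ⟨consSeq p σ', ?_, rfl⟩
    rintro (_ | n)
    · obtain ⟨k, rfl, rfl, hk⟩ := h.1.exists_next hdet
      have := hrun k
      rw [hk, ← h2] at this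
      exact this
    · exact h1 n

end Paths

/-! ### Paths of compressors -/

section Compressor

variable {A B C Q : Type*}

/-- The word read on the first tape along a path. -/
def pathFst (γ : List (Option A × Option B × Option C)) : List A :=
  (γ.map fun w => w.1).reduceOption

/-- The word read on the second tape along a path. -/
def pathSnd (γ : List (Option A × Option B × Option C)) : List B :=
  (γ.map fun w => w.2.1).reduceOption

/-- The word written along a path. -/
def pathOut (γ : List (Option A × Option B × Option C)) : List C :=
  (γ.map fun w => w.2.2).reduceOption

variable {M : ThreeAutomaton A B C Q} {s : ℕ → Q} {l : ℕ → Option A × Option B × Option C}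

lemma ThreeAutomaton.IsDet₂.run_next (hM : M.IsDet₂) (hr : M.IsRun s l) (m n : ℕ)
    (h : s m = s n) (hl : l m = l n) : s (m + 1) = s (n + 1) :=
  ((hM.run hr h).2 (by rw [hl])).2

/-- Determinism, applied transition by transition. Equal numbers of transitions are required since
one path could otherwise continue with silent transitions. -/
lemma path_eq_of_inputs_eq (hM : M.IsDet₂) (hr : M.IsRun s l) {p : Q}
    {γ γ' : List (Option A × Option B × Option C)} (h : IsPath s l p γ) (h' : IsPath s l p γ')
    (hlen : γ.length = γ'.length) (hu : pathFst γ = pathFst γ') (hv : pathSnd γ = pathSnd γ') :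
    γ = γ' := by
  induction γ generalizing p γ' with
  | nil => exact (List.length_eq_zero_iff.1 hlen.symm).symm
  | cons w γ ih =>
    cases γ' with
    | nil => simp at hlen
    | cons w' γ' =>
      obtain ⟨⟨k, rfl, rfl⟩, h2⟩ := h
      obtain ⟨⟨j, hj, rfl⟩, h2'⟩ := h'
      have hd := hM.run hr hj
      have hs := supp₂_eq_iff.1 hd.1
      have h1 : (l k).1 = (l j).1 ∧ pathFst γ = pathFst γ' := by
        have := hs.1
        cases hk : (l k).1 <;> cases hj' : (l j).1 <;>
          simp_all [pathFst, List.reduceOption_cons_of_some, List.reduceOption_cons_of_none]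
      have h1' : (l k).2.1 = (l j).2.1 ∧ pathSnd γ = pathSnd γ' := by
        have := hs.2
        cases hk : (l k).2.1 <;> cases hj' : (l j).2.1 <;>
          simp_all [pathSnd, List.reduceOption_cons_of_some, List.reduceOption_cons_of_none]
      have hl := (hd.2 (by rw [h1.1, h1'.1])).1
      rw [hl] at h2'
      rw [hl, ih h2 h2' (by simpa using hlen) h1.2 h1'.2]

/-- A path of a compressor is determined by its ends, by the oracle and the output, and by the
length of the input. -/
lemma path_eq_of_output_eq (hM : M.IsCompressor) {x : ℕ → A} {y : ℕ → B} {z : ℕ → C}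
    (hr : M.IsAcceptingRun s l x y z) {k₀ : ℕ}
    {γ γ' : List (Option A × Option B × Option C)} (h : IsPath s l (s k₀) γ)
    (h' : IsPath s l (s k₀) γ') (hlen : γ.length = γ'.length)
    (hend : pathEnd s l (s k₀) γ = pathEnd s l (s k₀) γ')
    (hu : (pathFst γ).length = (pathFst γ').length) (hv : pathSnd γ = pathSnd γ')
    (hw : pathOut γ = pathOut γ') : γ = γ' := by
  obtain ⟨hrun, hinit, hx, hy, hz⟩ := hr
  have hdet := hM.1.run_next hrun
  obtain ⟨pre, hpre, hpre'⟩ := exists_path_to hdet k₀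
  obtain ⟨j, hj⟩ := exists_pathEnd hdet h
  -- Each path is completed to an accepting run by a common initial path and a common tail of the
  -- given run. Then injectivity of the compressor identifies the complete inputs, and equal lengths
  -- allow the common tail to be removed.
  have hacc : ∀ γ, IsPath s l (s k₀) γ → pathEnd s l (s k₀) γ = s j →
      M.Accepts (appendSeq (pathFst (pre ++ γ)) (suffix x (lengthRead (fun n => (l n).1) j)))
        (appendSeq (pathSnd (pre ++ γ)) (suffix y (lengthRead (fun n => (l n).2.1) j)))
        (appendSeq (pathOut (pre ++ γ)) (suffix z (lengthRead (fun n => (l n).2.2) j))) := by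
    intro γ hγ hγ'
    have h1 : IsPath s l (s 0) (pre ++ γ) := isPath_append hpre (by rw [hpre']; exact hγ)
    have h2 : pathEnd s l (s 0) (pre ++ γ) = s j := by
      rw [pathEnd, List.foldl_append, ← hγ', ← hpre']
      rfl
    obtain ⟨σ, hσ, hσ0⟩ := exists_run_of_path hdet hrun h1 (σ := fun n => s (j + n))
      (l' := fun n => l (j + n)) (fun n => hrun (j + n)) h2.symm
    refine ⟨σ, _, hσ, by rw [hσ0]; exact hinit, ?_, ?_, ?_⟩
    · rw [appendSeq_comp]
      exact (hx.tail j).append _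
    · rw [appendSeq_comp (fun w : Option A × Option B × Option C => w.2.1)]
      exact (hy.tail j).append _
    · rw [appendSeq_comp (fun w : Option A × Option B × Option C => w.2.2)]
      exact (hz.tail j).append _
  have h1 := hacc γ h hj.symm
  have h2 := hacc γ' h' (hend ▸ hj.symm)
  have hsnd : pathSnd (pre ++ γ) = pathSnd (pre ++ γ') := by
    simp only [pathSnd, List.map_append, List.reduceOption_append] at hv ⊢
    rw [hv]
  have hout : pathOut (pre ++ γ) = pathOut (pre ++ γ') := by
    simp only [pathOut, List.map_append, List.reduceOption_append] at hw ⊢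
    rw [hw]
  rw [← hsnd, ← hout] at h2
  have h3 := hM.2 _ _ _ _ h1 h2
  have hfst : ∀ γ, pathFst (pre ++ γ) = pathFst pre ++ pathFst γ := by
    intro γ
    simp only [pathFst, List.map_append, List.reduceOption_append]
  rw [hfst, hfst] at h3
  have h4 := (appendSeq_injective (by simp [hu]) h3).1
  exact path_eq_of_inputs_eq hM.1 hrun h h' hlen (List.append_cancel_left h4) hv

end Compressor

/-! ### The weight of the paths of a compressor -/

section PathWeight

lemma prod_weight_eq {A B C : Type*} [Fintype B] [Fintype C]
    (γ : List (Option A × Option B × Option C)) :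
    (γ.map fun w => TwoAutomaton.weight w.2).prod
      = ((Fintype.card B : ℝ) ^ (pathSnd γ).length *
          (Fintype.card C : ℝ) ^ (pathOut γ).length)⁻¹ := by
  induction γ with
  | nil => simp [pathSnd, pathOut]
  | cons w γ ih =>
    rw [List.map_cons, List.prod_cons, ih]
    obtain ⟨o, _ | b, _ | c⟩ := w <;>
      simp [pathSnd, pathOut, TwoAutomaton.weight, List.reduceOption_cons_of_some,
        List.reduceOption_cons_of_none, pow_succ] <;> ring

lemma length_reduceOption_map_le {X Y : Type*} (f : X → Option Y) (γ : List X) :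
    ((γ.map f).reduceOption).length ≤ γ.length :=
  (List.reduceOption_length_le _).trans (by simp)

variable {A B C Q : Type*} [Fintype A] [Fintype B] [Fintype C]
  (s : ℕ → Q) (l : ℕ → Option A × Option B × Option C)

/-- The total weight of the paths of length `r` starting at `p`, where the weight takes into
account the second and the third tape. -/
def pathWeight : ℕ → Q → ℝ
  | 0, _ => 1
  | r + 1, p => ∑ w : Option A × Option B × Option C,
      ind (Occurs s l p w) * (TwoAutomaton.weight w.2 * pathWeight r (next s l p w))

variable {s l}

lemma pathWeight_eq_sum (r : ℕ) (p : Q) :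
    pathWeight s l r p = ∑ γ : Fin r → Option A × Option B × Option C,
      ind (IsPath s l p (List.ofFn γ)) *
        ((List.ofFn γ).map fun w => TwoAutomaton.weight w.2).prod := by
  induction r generalizing p with
  | zero => simp [pathWeight, IsPath, ind_of]
  | succ r ih =>
    let Φ : Option A × Option B × Option C → (Fin r → Option A × Option B × Option C) → ℝ :=
      fun w v => ind (Occurs s l p w) * ind (IsPath s l (next s l p w) (List.ofFn v)) *
        (TwoAutomaton.weight w.2 * ((List.ofFn v).map fun w => TwoAutomaton.weight w.2).prod)
    have h1 : ∀ γ : Fin (r + 1) → Option A × Option B × Option C,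
        ind (IsPath s l p (List.ofFn γ)) *
          ((List.ofFn γ).map fun w => TwoAutomaton.weight w.2).prod = Φ (γ 0) (Fin.tail γ) := by
      intro γ
      rw [List.ofFn_succ, List.map_cons, List.prod_cons]
      simp only [IsPath, ind_and]
      rfl
    rw [Finset.sum_congr rfl fun γ _ => h1 γ, sum_fin_succ r Φ]
    simp only [pathWeight, ih, Φ]
    refine Finset.sum_congr rfl fun w _ => ?_
    rw [Finset.mul_sum, Finset.mul_sum]
    refine Finset.sum_congr rfl fun v _ => ?_
    ring

/-- A Kraft inequality. Paths are grouped by last state and by the lengths of input, oracle and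
output. In one group a path is determined by its oracle and output words, so there are at most `|B|
^ j * |C| ^ k` paths, each of exactly the inverse weight, and the group contributes at most 1. -/
theorem pathWeight_le [Fintype Q] [Nonempty B] [Nonempty C] {M : ThreeAutomaton A B C Q}
    (hM : M.IsCompressor) {x : ℕ → A} {y : ℕ → B} {z : ℕ → C} (hr : M.IsAcceptingRun s l x y z)
    (N k₀ : ℕ) : pathWeight s l N (s k₀) ≤ Fintype.card Q * ((N : ℝ) + 1) ^ 3 := by
  classical
  rw [pathWeight_eq_sum]
  let key : (Fin N → Option A × Option B × Option C) →
      Q × Fin (N + 1) × Fin (N + 1) × Fin (N + 1) := fun γ =>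
    (pathEnd s l (s k₀) (List.ofFn γ),
      ⟨(pathFst (List.ofFn γ)).length, Nat.lt_succ_of_le
        ((length_reduceOption_map_le _ _).trans (by simp))⟩,
      ⟨(pathSnd (List.ofFn γ)).length, Nat.lt_succ_of_le
        ((length_reduceOption_map_le _ _).trans (by simp))⟩,
      ⟨(pathOut (List.ofFn γ)).length, Nat.lt_succ_of_le
        ((length_reduceOption_map_le _ _).trans (by simp))⟩)
  rw [← Finset.sum_fiberwise _ key]
  have hfib : ∀ κ, ∑ γ ∈ Finset.univ.filter (fun γ => key γ = κ),
      ind (IsPath s l (s k₀) (List.ofFn γ)) *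
        ((List.ofFn γ).map fun w => TwoAutomaton.weight w.2).prod ≤ 1 := by
    rintro ⟨q, i, j, k⟩
    have hBC : (0 : ℝ) < (Fintype.card B : ℝ) ^ (j : ℕ) * (Fintype.card C : ℝ) ^ (k : ℕ) := by
      have h1 : (0 : ℝ) < Fintype.card B := by exact_mod_cast Fintype.card_pos
      have h2 : (0 : ℝ) < Fintype.card C := by exact_mod_cast Fintype.card_pos
      positivity
    let F := Finset.univ.filter fun γ : Fin N → Option A × Option B × Option C =>
      key γ = (q, i, j, k) ∧ IsPath s l (s k₀) (List.ofFn γ)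
    have hF : ∀ γ ∈ F, pathEnd s l (s k₀) (List.ofFn γ) = q ∧ (pathFst (List.ofFn γ)).length = i ∧
        (pathSnd (List.ofFn γ)).length = j ∧ (pathOut (List.ofFn γ)).length = k ∧
        IsPath s l (s k₀) (List.ofFn γ) := by
      intro γ hγ
      simp only [F, Finset.mem_filter, Finset.mem_univ, true_and, key, Prod.mk.injEq,
        Fin.ext_iff] at hγ
      tauto
    have hcard : F.card ≤ Fintype.card B ^ (j : ℕ) * Fintype.card C ^ (k : ℕ) := by
      have h1 : F.card ≤ Fintype.card (List.Vector B j × List.Vector C k) := by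
        rw [← Fintype.card_coe F]
        refine Fintype.card_le_of_injective (fun γ : F =>
          ((⟨pathSnd (List.ofFn γ.1), (hF γ.1 γ.2).2.2.1⟩ : List.Vector B j),
            (⟨pathOut (List.ofFn γ.1), (hF γ.1 γ.2).2.2.2.1⟩ : List.Vector C k))) ?_
        intro γ γ' hγ
        have g1 := congrArg (fun t : List.Vector B j × List.Vector C k => t.1.1) hγ
        have g2 := congrArg (fun t : List.Vector B j × List.Vector C k => t.2.1) hγ
        obtain ⟨e1, e2, -, -, e5⟩ := hF γ.1 γ.2
        obtain ⟨f1, f2, -, -, f5⟩ := hF γ'.1 γ'.2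
        refine Subtype.ext (List.ofFn_injective ?_)
        exact path_eq_of_output_eq hM hr e5 f5 (by simp) (e1.trans f1.symm) (e2.trans f2.symm)
          g1 g2
      simpa [card_vector] using h1
    calc _ = ∑ γ ∈ F, ((Fintype.card B : ℝ) ^ (j : ℕ) * (Fintype.card C : ℝ) ^ (k : ℕ))⁻¹ := by
          simp only [F]
          rw [← Finset.filter_filter, Finset.sum_filter (p := fun γ => IsPath s l _ _)]
          refine Finset.sum_congr rfl fun γ hγ => ?_
          by_cases hp : IsPath s l (s k₀) (List.ofFn γ)
          · have := hF γ (by simpa [F, hp] using hγ)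
            rw [if_pos hp, ind_of hp, one_mul, prod_weight_eq, this.2.2.1, this.2.2.2.1]
          · rw [if_neg hp, ind_of_not hp, zero_mul]
      _ ≤ 1 := by
          rw [Finset.sum_const, nsmul_eq_mul, ← div_eq_mul_inv, div_le_one hBC]
          exact_mod_cast hcard
  calc _ ≤ ∑ _κ : Q × Fin (N + 1) × Fin (N + 1) × Fin (N + 1), (1 : ℝ) :=
        Finset.sum_le_sum fun κ _ => hfib κ
    _ = Fintype.card Q * ((N : ℝ) + 1) ^ 3 := by
        simp only [Finset.sum_const, Finset.card_univ, Fintype.card_prod, Fintype.card_fin,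
          nsmul_eq_mul, mul_one]
        push_cast
        ring

end PathWeight

/-! ### Words on which runs are ergodic are not compressible -/

section Incompressible

variable {A B C Q : Type*} [Fintype A] [Fintype C]

/-- The factor by which a transition changes the ratio of the sizes of the sets of inputs and of
outputs. -/
def gainFactor (w : Option A × Option B × Option C) : ℝ :=
  (if w.1.isSome then (Fintype.card A : ℝ) else 1) *
    (if w.2.2.isSome then 1 / (Fintype.card C : ℝ) else 1)

/-- The weights in `pathWeight` are those of uniform input and oracle symbols, multiplied by the
gain. Hence `pathWeight` is a mean of products of gains and can serve as a potential. -/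
lemma weight_mul_gainFactor [Fintype B] (w : Option A × Option B × Option C) :
    TwoAutomaton.weight (w.1, w.2.1) * gainFactor w = TwoAutomaton.weight w.2 := by
  obtain ⟨_ | a, o⟩ := w
  · simp [TwoAutomaton.weight, gainFactor]
  · have : (Fintype.card A : ℝ) ≠ 0 := by
      have : Nonempty A := ⟨a⟩
      exact_mod_cast Fintype.card_ne_zero
    simp only [TwoAutomaton.weight, gainFactor, Option.isSome_some, if_true]
    field_simp

lemma gainFactor_pos [Fintype B] (w : Option A × Option B × Option C) : 0 < gainFactor w := by
  have h := weight_mul_gainFactor w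
  have h1 := weight_pos (A := A) (B := B) (w.1, w.2.1)
  have h2 := weight_pos (A := B) (B := C) w.2
  rw [← h] at h2
  exact (mul_pos_iff_of_pos_left h1).1 h2

lemma log_gainFactor (w : Option A × Option B × Option C) :
    Real.log (gainFactor w) = ind (w.1.isSome) * Real.log (Fintype.card A)
      - ind (w.2.2.isSome) * Real.log (Fintype.card C) := by
  obtain ⟨_ | a, o, _ | c⟩ := w
  · simp [gainFactor, ind]
  · simp [gainFactor, ind]
  · simp [gainFactor, ind]
  · have h1 : (Fintype.card A : ℝ) ≠ 0 := by
      have : Nonempty A := ⟨a⟩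
      exact_mod_cast Fintype.card_ne_zero
    have h2 : (Fintype.card C : ℝ) ≠ 0 := by
      have : Nonempty C := ⟨c⟩
      exact_mod_cast Fintype.card_ne_zero
    simp [gainFactor, ind, Real.log_mul h1 (inv_ne_zero h2)]
    ring

variable [Fintype B] {s : ℕ → Q} {l : ℕ → Option A × Option B × Option C}

lemma pathWeight_nonneg (r : ℕ) (p : Q) : 0 ≤ pathWeight s l r p := by
  induction r generalizing p with
  | zero => simp [pathWeight]
  | succ r ih =>
    exact Finset.sum_nonneg fun w _ => mul_nonneg (ind_nonneg _)
      (mul_nonneg (weight_nonneg _) (ih _))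

lemma pathWeight_pos (hdet : ∀ m n, s m = s n → l m = l n → s (m + 1) = s (n + 1)) (r k : ℕ) :
    0 < pathWeight s l r (s k) := by
  induction r generalizing k with
  | zero => simp [pathWeight]
  | succ r ih =>
    refine lt_of_lt_of_le ?_ (Finset.single_le_sum (f := fun w => ind (Occurs s l (s k) w) *
      (TwoAutomaton.weight w.2 * pathWeight s l r (next s l (s k) w)))
      (fun w _ => mul_nonneg (ind_nonneg _)
        (mul_nonneg (weight_nonneg _) (pathWeight_nonneg _ _))) (Finset.mem_univ (l k)))
    rw [ind_of ⟨k, rfl, rfl⟩, next_eq hdet, one_mul]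
    exact mul_pos (weight_pos _) (ih _)

/-- The ratio of the path weights before and after a transition, if `j + 1` steps have been made
in the current block of length `N`. -/
def weightRatio (s : ℕ → Q) (l : ℕ → Option A × Option B × Option C) (N : ℕ) (q : Q × Fin N)
    (w : Option A × Option B × Option C) : ℝ :=
  gainFactor w * pathWeight s l (N - q.2 - 1) (next s l q.1 w) / pathWeight s l (N - q.2) q.1

lemma sum_ind_succ_mod {N : ℕ} (n : ℕ) :
    ∑ k ∈ Finset.range n, ind ((k + 1) % N = 0) ≤ (n : ℝ) / N := by
  have : ∑ k ∈ Finset.range n, ind ((k + 1) % N = 0) = ((n / N : ℕ) : ℝ) := by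
    induction n with
    | zero => simp
    | succ n ih =>
      rw [Finset.sum_range_succ, ih, Nat.succ_div]
      by_cases h : N ∣ n + 1
      · rw [ind_of (Nat.mod_eq_zero_of_dvd h), if_pos h]
        push_cast
        ring
      · rw [ind_of_not (fun h' => h (Nat.dvd_of_mod_eq_zero h')), if_neg h]
        simp
  rw [this]
  exact Nat.cast_div_le

/-- At a fixed state and position in the block, the ratio is a function of the label, and its mean
for uniform input symbols is 1. So the sum is a finite linear combination of deviations. -/
lemma sum_weightRatio_isLittleO [Finite Q] {x : ℕ → A} {y : ℕ → B} (h : RunsErgodic x y)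
    {M : ThreeAutomaton A B C Q} (hM : M.IsDet₂) (hrun : M.IsRun s l)
    (hx : Spells (fun n => (l n).1) x) (hy : Spells (fun n => (l n).2.1) y)
    {N : ℕ} (hN : 0 < N) :
    (fun n => ∑ k ∈ Finset.range n,
      (weightRatio s l N (s k, ⟨k % N, Nat.mod_lt k hN⟩) (l k) - 1)) =o[atTop]
        fun n => (n : ℝ) := by
  have hdet := hM.run_next hrun
  set σ : ℕ → Q × Fin N := fun k => (s k, ⟨k % N, Nat.mod_lt k hN⟩) with hσ
  set inp : ℕ → Option A × Option B := fun k => ((l k).1, (l k).2.1) with hinp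
  have hrun' : DetRunOn σ inp x y := by
    refine ⟨fun m n hmn => ?_, hx, hy⟩
    simp only [hσ, Prod.mk.injEq, Fin.mk.injEq] at hmn ⊢
    have h1 := hM.run hrun hmn.1
    exact ⟨h1.1, fun hl => ⟨(h1.2 hl).2, Nat.ModEq.add_right 1 hmn.2⟩⟩
  have hE := h.equidistributed hrun'
  have := Fintype.ofFinite Q
  have hocc : ∀ k w, Occurs s l (s k) w → (inp k = (w.1, w.2.1) ↔ l k = w) := by
    rintro k w ⟨j, hj, rfl⟩
    exact ⟨fun hl => ((hM.run hrun hj.symm).2 hl).1, fun hl => by simp only [hinp, hl]⟩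
  have hsum : ∀ n, ∑ k ∈ Finset.range n, (weightRatio s l N (σ k) (l k) - 1)
      = ∑ q, ∑ w : Option A × Option B × Option C, (ind (Occurs s l q.1 w) * weightRatio s l N q w)
        * dev σ inp q (w.1, w.2.1) n := by
    intro n
    simp only [dev, Finset.mul_sum]
    have h1 : ∀ k, weightRatio s l N (σ k) (l k) - 1
        = ∑ q, ∑ w : Option A × Option B × Option C,
          (ind (Occurs s l q.1 w) * weightRatio s l N q w) * (ind (σ k = q) *
            (ind (inp k = (w.1, w.2.1)) - TwoAutomaton.weight (w.1, w.2.1))) := by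
      intro k
      have h2 : ∀ q, ∑ w : Option A × Option B × Option C,
          (ind (Occurs s l q.1 w) * weightRatio s l N q w) * (ind (σ k = q) *
            (ind (inp k = (w.1, w.2.1)) - TwoAutomaton.weight (w.1, w.2.1)))
          = ind (σ k = q) * ∑ w : Option A × Option B × Option C,
            (ind (Occurs s l q.1 w) * weightRatio s l N q w) *
            (ind (inp k = (w.1, w.2.1)) - TwoAutomaton.weight (w.1, w.2.1)) := by
        intro q
        rw [Finset.mul_sum]
        exact Finset.sum_congr rfl fun w _ => by ring
      simp only [h2]
      rw [sum_ind_eq_mul (σ k) fun q => ∑ w : Option A × Option B × Option C,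
            (ind (Occurs s l q.1 w) * weightRatio s l N q w) *
            (ind (inp k = (w.1, w.2.1)) - TwoAutomaton.weight (w.1, w.2.1))]
      -- The mean value 1: the weight times the gain factor is the weight in the recursion of
      -- `pathWeight`, whose sum is the denominator of the ratio.
      have h3 : ∑ w : Option A × Option B × Option C, ind (Occurs s l (s k) w) *
          weightRatio s l N (σ k) w * TwoAutomaton.weight (w.1, w.2.1) = 1 := by
        have hk : k % N < N := Nat.mod_lt k hN
        have hpos := pathWeight_pos hdet (N - k % N) k
        have h4 : pathWeight s l (N - k % N) (s k) = ∑ w : Option A × Option B × Option C,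
            ind (Occurs s l (s k) w) * (TwoAutomaton.weight w.2 *
              pathWeight s l (N - k % N - 1) (next s l (s k) w)) := by
          obtain ⟨r, hr⟩ : ∃ r, N - k % N = r + 1 := ⟨N - k % N - 1, by omega⟩
          rw [hr]
          rfl
        conv_rhs => rw [← div_self hpos.ne']
        conv_rhs => enter [1]; rw [h4]
        rw [Finset.sum_div]
        refine Finset.sum_congr rfl fun w _ => ?_
        rw [← weight_mul_gainFactor w]
        simp only [weightRatio, hσ]
        ring
      have h5 : ∑ w : Option A × Option B × Option C, ind (Occurs s l (s k) w) *
          weightRatio s l N (σ k) w * ind (inp k = (w.1, w.2.1))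
          = weightRatio s l N (σ k) (l k) := by
        rw [← one_mul (weightRatio s l N (σ k) (l k)),
          ← ind_of (show Occurs s l (s k) (l k) from ⟨k, rfl, rfl⟩),
          ← sum_ind_eq_mul (l k) fun w => ind (Occurs s l (s k) w) * weightRatio s l N (σ k) w]
        refine Finset.sum_congr rfl fun w _ => ?_
        by_cases hw : Occurs s l (s k) w
        · rw [ind_congr (hocc k w hw)]
          ring
        · rw [ind_of_not hw]
          ring
      rw [← h3]
      conv_lhs => rw [← h5]
      rw [← Finset.sum_sub_distrib]
      exact Finset.sum_congr rfl fun w _ => by ring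
    simp only [h1]
    rw [Finset.sum_comm]
    refine Finset.sum_congr rfl fun q _ => ?_
    rw [Finset.sum_comm]
  change (fun n => ∑ k ∈ Finset.range n, (weightRatio s l N (σ k) (l k) - 1)) =o[atTop] _
  simp only [hsum]
  refine IsLittleO.fun_sum fun q _ => IsLittleO.fun_sum fun w _ => ?_
  by_cases hw : Occurs s l q.1 w
  · refine IsLittleO.const_mul_left ?_ _
    by_cases hv : ∃ k, σ k = q
    · obtain ⟨k₀, rfl⟩ := hv
      obtain ⟨j, hj, rfl⟩ := hw
      exact hE k₀ _ (hM.run hrun hj.symm).1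
    · push Not at hv
      rw [dev_eq_zero_of_not_visited hv]
      exact isLittleO_zero _ _
  · simp [ind_of_not hw]

/-- The logarithm of the gain is the logarithm of `weightRatio` up to the change of a potential, the
logarithm of the weight of the paths filling the rest of the block. The bound `log t ≤ t - 1` makes
the first part o(n) in sum, and the second telescopes except for a restart once per block. A restart
costs at most the logarithm of a polynomial in `N`, negligible against the block length `N`. -/
lemma eventually_gain_le [Finite Q] [Nonempty B] [Nonempty C] {x : ℕ → A} {y : ℕ → B}
    {z : ℕ → C} (h : RunsErgodic x y) {M : ThreeAutomaton A B C Q} (hM : M.IsCompressor)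
    (hr : M.IsAcceptingRun s l x y z) {ε : ℝ} (hε : 0 < ε) :
    ∀ᶠ n : ℕ in atTop, lengthRead (fun k => (l k).1) n * Real.log (Fintype.card A)
      - lengthRead (fun k => (l k).2.2) n * Real.log (Fintype.card C) ≤ ε * n := by
  have := Fintype.ofFinite Q
  have hdet := hM.1.run_next hr.1
  have hQ : (1 : ℝ) ≤ Fintype.card Q := by
    have : Nonempty Q := ⟨s 0⟩
    exact_mod_cast Fintype.card_pos
  -- The error `ε` is divided into three: the restarts of the potential, the deviations of the
  -- ratios, and the two ends of the telescoping sum.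
  obtain ⟨N, hN, hNε⟩ : ∃ N : ℕ, 0 < N ∧
      Real.log (Fintype.card Q * ((N : ℝ) + 1) ^ 3) ≤ ε / 3 * N := by
    have h1 : (fun N : ℕ => Real.log ((N : ℝ) + 1)) =o[atTop] fun N : ℕ => (N : ℝ) + 1 :=
      Real.isLittleO_log_id_atTop.comp_tendsto
        (tendsto_atTop_add_const_right _ 1 tendsto_natCast_atTop_atTop)
    have h2 := h1.def (c := ε / 18) (by positivity)
    have h3 : ∀ᶠ N : ℕ in atTop,
        (Real.log (Fintype.card Q) + ε / 6) / (ε / 6) ≤ (N : ℝ) :=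
      tendsto_natCast_atTop_atTop.eventually (eventually_ge_atTop _)
    obtain ⟨N, h4, h5, h6⟩ := (h2.and (h3.and (eventually_gt_atTop 0))).exists
    refine ⟨N, h6, ?_⟩
    have hN0 : (0 : ℝ) ≤ N := Nat.cast_nonneg N
    rw [Real.log_mul (by positivity) (by positivity), Real.log_pow]
    rw [Real.norm_of_nonneg (Real.log_nonneg (by linarith)), Real.norm_of_nonneg (by positivity)]
      at h4
    rw [div_le_iff₀ (by positivity)] at h5
    push_cast
    nlinarith
  have hN' : (0 : ℝ) < N := by exact_mod_cast hN
  set K := Real.log (Fintype.card Q * ((N : ℝ) + 1) ^ 3) with hK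
  have hK0 : 0 ≤ K := by
    refine Real.log_nonneg (one_le_mul_of_one_le_of_one_le hQ (one_le_pow₀ (by linarith)))
  set U : ℕ → ℝ := fun k => Real.log (pathWeight s l (N - k % N) (s k)) with hU
  -- The potential depends only on the state and the position in the block, so it takes finitely
  -- many values.
  obtain ⟨D, hD⟩ : ∃ D : ℝ, ∀ k, |U k| ≤ D := by
    refine ⟨∑ q : Q × Fin N, |Real.log (pathWeight s l (N - q.2) q.1)|, fun k => ?_⟩
    exact Finset.single_le_sum (f := fun q : Q × Fin N =>
      |Real.log (pathWeight s l (N - q.2) q.1)|) (fun q _ => abs_nonneg _)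
      (Finset.mem_univ (s k, ⟨k % N, Nat.mod_lt k hN⟩))
  have hstep : ∀ k, Real.log (gainFactor (l k)) ≤
      (weightRatio s l N (s k, ⟨k % N, Nat.mod_lt k hN⟩) (l k) - 1) + (U k - U (k + 1))
        + K * ind ((k + 1) % N = 0) := by
    intro k
    have hk : k % N < N := Nat.mod_lt k hN
    have hp1 := pathWeight_pos hdet (N - k % N) k
    have hp2 := pathWeight_pos hdet (N - k % N - 1) (k + 1)
    have hg := gainFactor_pos (l k)
    have h1 : Real.log (weightRatio s l N (s k, ⟨k % N, hk⟩) (l k))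
        = Real.log (gainFactor (l k)) + Real.log (pathWeight s l (N - k % N - 1) (s (k + 1)))
          - U k := by
      simp only [weightRatio, next_eq hdet, hU]
      rw [Real.log_div (by positivity) hp1.ne', Real.log_mul hg.ne' hp2.ne']
    have h2 : Real.log (weightRatio s l N (s k, ⟨k % N, hk⟩) (l k))
        ≤ weightRatio s l N (s k, ⟨k % N, hk⟩) (l k) - 1 := by
      refine Real.log_le_sub_one_of_pos ?_
      simp only [weightRatio, next_eq hdet]
      positivity
    -- Inside a block both potentials agree. At its end the potential of zero remaining steps is
    -- `log 1 = 0`, and the next one, for `N` steps, is at most `K` by `pathWeight_le`.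
    have h3 : U (k + 1) - K * ind ((k + 1) % N = 0)
        ≤ Real.log (pathWeight s l (N - k % N - 1) (s (k + 1))) := by
      have hle := pathWeight_le hM hr N (k + 1)
      by_cases hk1 : k % N + 1 < N
      · have h4 : (k + 1) % N = k % N + 1 := by
          rw [Nat.add_mod, Nat.mod_eq_of_lt (show 1 < N by omega), Nat.mod_eq_of_lt hk1]
        simp only [hU, h4]
        rw [ind_of_not (by omega), mul_zero, sub_zero, Nat.sub_sub]
      · have h4 : (k + 1) % N = 0 := by
          have h5 : k % N + 1 = N := by omega
          rw [← Nat.mod_add_mod, h5, Nat.mod_self]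
        have h5 : N - k % N - 1 = 0 := by omega
        simp only [hU, h4, h5, pathWeight, Real.log_one]
        rw [ind_of trivial, mul_one, sub_nonpos, Nat.sub_zero]
        exact Real.log_le_log (pathWeight_pos hdet N (k + 1)) hle
    linarith
  have ho := (sum_weightRatio_isLittleO h hM.1 hr.1 hr.2.2.1 hr.2.2.2.1 hN).def
    (c := ε / 3) (by positivity)
  filter_upwards [ho, tendsto_natCast_atTop_atTop.eventually
    (eventually_ge_atTop (2 * D / (ε / 3)))] with n h1 h2
  rw [Real.norm_natCast, Real.norm_eq_abs] at h1
  rw [div_le_iff₀ (by positivity)] at h2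
  have h3 : lengthRead (fun k => (l k).1) n * Real.log (Fintype.card A)
      - lengthRead (fun k => (l k).2.2) n * Real.log (Fintype.card C)
      = ∑ k ∈ Finset.range n, Real.log (gainFactor (l k)) := by
    simp only [log_gainFactor, lengthRead_eq_sum, Finset.sum_sub_distrib, Finset.sum_mul]
  have h4 : ∑ k ∈ Finset.range n, Real.log (gainFactor (l k)) ≤
      ∑ k ∈ Finset.range n, (weightRatio s l N (s k, ⟨k % N, Nat.mod_lt k hN⟩) (l k) - 1)
        + (U 0 - U n) + K * ∑ k ∈ Finset.range n, ind ((k + 1) % N = 0) := by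
    rw [← Finset.sum_range_sub' U, Finset.mul_sum, ← Finset.sum_add_distrib,
      ← Finset.sum_add_distrib]
    exact Finset.sum_le_sum fun k _ => hstep k
  have h5 : K * ∑ k ∈ Finset.range n, ind ((k + 1) % N = 0) ≤ ε / 3 * n := by
    calc K * ∑ k ∈ Finset.range n, ind ((k + 1) % N = 0) ≤ K * (n / N) := by
          gcongr
          exact sum_ind_succ_mod n
      _ ≤ (ε / 3 * N) * (n / N) := by gcongr
      _ = ε / 3 * n := by field_simp
  have h6 := (le_abs_self _).trans h1
  have h7 := abs_le.1 (hD 0)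
  have h8 := abs_le.1 (hD n)
  rw [h3]
  linarith

/-- `eventually_gain_le` measures the saving against the number of transitions. Some state that
reads the first tape has density at least `κ`, so with the error `η * κ * log |A|` the saving is at
most the fraction `η` of the input, in bits. -/
theorem one_le_condRho [Nontrivial A] {x : ℕ → A} {y : ℕ → B} (h : RunsErgodic x y) :
    1 ≤ condRho x y := by
  refine le_sInf ?_
  rintro r ⟨C, Q, _, _, _, M, s, l, z, hM, hr, rfl⟩
  have : Nonempty B := ⟨y 0⟩
  have hlogA : 0 < Real.log (Fintype.card A) :=
    Real.log_pos (by exact_mod_cast Fintype.one_lt_card)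
  have hlogC : 0 < Real.log (Fintype.card C) :=
    Real.log_pos (by exact_mod_cast Fintype.one_lt_card)
  have hrun₀ : DetRunOn s (fun k => ((l k).1, (l k).2.1)) x y :=
    ⟨fun m n hmn => ⟨(hM.1.run hr.1 hmn).1, fun hl => ((hM.1.run hr.1 hmn).2 hl).2⟩,
      hr.2.2.1, hr.2.2.2.1⟩
  obtain ⟨q, hq⟩ := exists_frequently_eq (s := s) (frequently_atTop.2 hr.2.2.1.2)
  obtain ⟨κ, hκ, hκ'⟩ := h.density hrun₀ (hq.mono fun k hk => hk.1)
  have hread : ∀ᶠ n : ℕ in atTop, κ * n ≤ lengthRead (fun k => (l k).1) n := by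
    filter_upwards [hκ'] with n hn
    refine hn.trans ?_
    rw [lengthRead_eq_sum]
    refine Finset.sum_le_sum fun k _ => ?_
    by_cases hk : s k = q
    · obtain ⟨j, hj, hj'⟩ := hq.exists
      have h1 := (supp₂_eq_iff.1 (hrun₀.det k j (hk.trans hj.symm)).1).1
      rw [ind_of (P := ((l k).1.isSome : Prop)) (by simpa using h1.trans hj')]
      exact ind_le_one _
    · rw [ind_of_not hk]
      exact ind_nonneg _
  have key : ∀ η : ℝ, 0 < η → ENNReal.ofReal (1 - η) ≤
      compressionRatio (fun n => (l n).1) (fun n => (l n).2.2) := by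
    intro η hη
    refine le_liminf_of_le (by isBoundedDefault) ?_
    filter_upwards [hread, eventually_gain_le h hM hr
      (show 0 < η * κ * Real.log (Fintype.card A) by positivity), eventually_gt_atTop 0]
      with n h1 h2 h3
    refine ENNReal.ofReal_le_ofReal ?_
    have hn : (0 : ℝ) < n := by exact_mod_cast h3
    have ha : (0 : ℝ) < lengthRead (fun k => (l k).1) n := lt_of_lt_of_le (by positivity) h1
    rw [div_mul_div_comm, le_div_iff₀ (by positivity)]
    have h4 : η * κ * Real.log (Fintype.card A) * n
        ≤ η * Real.log (Fintype.card A) * lengthRead (fun k => (l k).1) n := by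
      calc η * κ * Real.log (Fintype.card A) * n = η * Real.log (Fintype.card A) * (κ * n) := by
            ring
        _ ≤ _ := by gcongr
    linarith
  have hlim : Tendsto (fun n : ℕ => ENNReal.ofReal (1 - 1 / ((n : ℝ) + 1))) atTop (𝓝 1) := by
    have := ENNReal.tendsto_ofReal
      (tendsto_const_nhds (x := (1 : ℝ)).sub (tendsto_one_div_add_atTop_nhds_zero_nat (𝕜 := ℝ)))
    simpa using this
  exact le_of_tendsto' hlim fun n => key _ (by positivity)

end Incompressible

/-! ### Compression ratios of normal words -/

section Ratios

variable {A B : Type*} [Fintype A]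

lemma spells_some {X : Type*} (w : ℕ → X) : Spells (fun n => some (w n)) w := by
  refine ⟨fun n b hb => ?_, fun m => ⟨m, le_rfl, rfl⟩⟩
  rw [lengthRead_eq_self fun _ => rfl]
  exact Option.some_injective _ hb

/-- The oracle is ignored, but an accepting run has to read all of it: one arbitrary oracle symbol
is consumed at every step. -/
theorem condRho_le_rho (x : ℕ → A) (y : ℕ → B) : condRho x y ≤ rho x := by
  refine sInf_le_sInf ?_
  rintro r ⟨C, Q, _, _, _, M, s, l, z, ⟨hdet, hinj⟩, ⟨⟨hrun, hx, hz⟩, hinit⟩, rfl⟩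
  let M' : ThreeAutomaton A B C Q :=
    ⟨{t | (t.1, (t.2.1.1, t.2.1.2.2), t.2.2) ∈ M.trans ∧ t.2.1.2.1.isSome}, M.init⟩
  have hacc : ∀ x y z, M'.Accepts x y z → M.Accepts x z := by
    rintro x y z ⟨σ, w, h1, h2, h3, -, h5⟩
    exact ⟨σ, fun n => ((w n).1, (w n).2.2), ⟨fun n => (h1 n).1, h3, h5⟩, h2⟩
  refine ⟨C, Q, inferInstance, inferInstance, inferInstance, M', s,
    fun n => ((l n).1, some (y n), (l n).2), z, ⟨⟨hdet.1, ?_⟩, ?_⟩, ⟨?_, hinit, hx, ?_, hz⟩, rfl⟩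
  · rintro p ⟨a, b, c⟩ q ⟨a', b', c'⟩ q' ⟨h1, h2⟩ ⟨h1', h2'⟩
    have h3 := hdet.2 _ _ _ _ _ h1 h1'
    simp only [Prod.mk.injEq] at h2 h2' h3 ⊢
    refine ⟨supp₂_eq_iff.2 ⟨h3.1, by simp [h2, h2']⟩, fun h4 => ?_⟩
    have h5 := h3.2 h4.1
    exact ⟨⟨h4.1, h4.2, h5.1.2⟩, h5.2⟩
  · exact fun y x x' z h h' => hinj x x' z (hacc _ _ _ h) (hacc _ _ _ h')
  · exact fun n => ⟨hrun n, rfl⟩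
  · exact spells_some y

theorem rho_le_one [Nontrivial A] (x : ℕ → A) : rho x ≤ 1 := by
  have hcard : 1 < Fintype.card A := Fintype.one_lt_card
  have : Nontrivial (Fin (Fintype.card A)) := Fin.nontrivial_iff_two_le.2 hcard
  let e := Fintype.equivFin A
  -- Copying symbol by symbol. The output uses a copy of the alphabet in `Type`, as required in
  -- `rho`.
  let M : TwoAutomaton A (Fin (Fintype.card A)) Unit :=
    ⟨{t | ∃ a, t.2.1 = (some a, some (e a))}, {()}⟩
  have hM : TwoAutomaton.IsCompressor M := by
    refine ⟨⟨⟨(), rfl⟩, ?_⟩, ?_⟩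
    · rintro p ⟨o₁, o₂⟩ q ⟨o₁', o₂'⟩ q' ⟨a, ha⟩ ⟨a', ha'⟩
      simp only [Prod.mk.injEq] at ha ha'
      obtain ⟨rfl, rfl⟩ := ha
      obtain ⟨rfl, rfl⟩ := ha'
      refine ⟨rfl, fun h => ⟨?_, rfl⟩⟩
      simp only [Option.some.injEq] at h
      rw [h]
    · have hout : ∀ x z, M.Accepts x z → ∀ n, z n = e (x n) := by
        rintro x z ⟨s, l, ⟨⟨hrun, hx, hz⟩, -⟩⟩ n
        have h1 : ∀ k, ((l k).1.isSome : Prop) := by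
          intro k
          obtain ⟨a, ha⟩ := hrun k
          simp only at ha
          simp [ha]
        have h2 : ∀ k, ((l k).2.isSome : Prop) := by
          intro k
          obtain ⟨a, ha⟩ := hrun k
          simp only at ha
          simp [ha]
        obtain ⟨a, ha⟩ := hrun n
        simp only at ha
        have h3 := hx.1 n a (by simp [ha])
        have h4 := hz.1 n (e a) (by simp [ha])
        rw [lengthRead_eq_self h1] at h3
        rw [lengthRead_eq_self h2] at h4
        rw [h3, h4]
      intro x x' z h h'
      funext n
      exact e.injective ((hout x z h n).symm.trans (hout x' z h' n))
  refine sInf_le_of_le ⟨Fin (Fintype.card A), Unit, inferInstance, inferInstance, inferInstance, M,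
    fun _ => (), fun n => (some (x n), some (e (x n))), fun n => e (x n), hM,
    ⟨⟨fun n => ⟨x n, rfl⟩, spells_some x, spells_some _⟩, rfl⟩, rfl⟩ ?_
  unfold compressionRatio
  have hlog : 0 < Real.log (Fintype.card A) := Real.log_pos (by exact_mod_cast hcard)
  rw [liminf_congr (v := fun _ => (1 : ENNReal))]
  · simp
  · filter_upwards [eventually_ne_atTop 0] with n hn
    have hn' : (n : ℝ) ≠ 0 := by exact_mod_cast hn
    rw [lengthRead_eq_self fun _ => rfl, lengthRead_eq_self fun _ => rfl, Fintype.card_fin,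
      div_self hn', div_self hlog.ne', one_mul, ENNReal.ofReal_one]

lemma halfUniform_unit_left [Fintype B] (x : ℕ → Unit) (y : ℕ → B) : HalfUniform x y := by
  intro N s l hrun hl k₀ a hk₀
  have : dev s l (s k₀) (some a, none) = 0 := by
    funext n
    refine Finset.sum_eq_zero fun k _ => ?_
    by_cases hs : s k = s k₀
    · have h1 : ((l k).1.isSome : Prop) := by
        rw [(supp₂_eq_iff.1 (hrun.det k k₀ hs).1).1]
        exact hk₀
      rcases (hl k).cases with ⟨b, hb⟩ | ⟨b, hb⟩
      · rw [ind_of (P := l k = _) hb, weight_some_none]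
        simp
      · simp [hb] at h1
    · rw [ind_of_not hs, zero_mul]
  rw [this]
  exact isLittleO_zero _ _

/-- A tape over one letter carries no information: the states at which `x` is read form a
deterministic one-tape run on `x`, to which normality applies. -/
lemma halfUniform_unit_right [Nonempty A] {x : ℕ → A} (hx : IsNormal x) (y : ℕ → Unit) :
    HalfUniform x y := by
  intro N s l hrun hl k₀ a hk₀
  let V : Option A × Option Unit → Prop := fun lab => lab.1.isSome
  have hV : {k | V (l k)}.Infinite := infinite_of_frequently_isSome hrun.fst.2
  have hlab : ∀ r, l (Nat.nth (fun k => V (l k)) r) = (some (x r), none) := by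
    intro r
    have h1 : V (l (Nat.nth (fun k => V (l k)) r)) := Nat.nth_mem_of_infinite hV r
    have h2 : lengthRead (fun k => (l k).1) (Nat.nth (fun k => V (l k)) r) = r :=
      Nat.count_nth_of_infinite hV r
    rcases (hl (Nat.nth (fun k => V (l k)) r)).cases with ⟨b, hb⟩ | ⟨b, hb⟩
    · have h3 := hrun.fst.1 _ b (congrArg Prod.fst hb)
      rw [h2] at h3
      rw [hb, h3]
    · simp [V, hb] at h1
  have hread : DetRead (fun r => s (Nat.nth (fun k => V (l k)) r)) x := by
    intro m n hmn hxmn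
    refine nth_succ_eq_of_succ_eq hV (fun i j hij => ?_) ((hrun.det _ _ hmn).2 (by
      rw [hlab, hlab, hxmn]))
    have h1 := hrun.det i j hij
    have h2 := supp₂_eq_iff.1 h1.1
    refine ⟨by simp only [V, h2.1], fun hi => h1.2 ?_⟩
    rcases (hl i).cases with ⟨b, hb⟩ | ⟨b, hb⟩
    · simp [V, hb] at hi
    · rcases (hl j).cases with ⟨c, hc⟩ | ⟨c, hc⟩
      · simp [hb, hc] at h2
      · rw [hb, hc]
  refine isLittleO_of_sum_nth hV (fun k hk => ?_) ?_
  · rw [ind_of_not, zero_mul]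
    intro hs
    apply hk
    change ((l k).1.isSome : Prop)
    rw [(supp₂_eq_iff.1 (hrun.det k k₀ hs).1).1]
    exact hk₀
  · refine (readsUniform_of_isNormal hx N _ hread (s k₀) a).congr_left fun n => ?_
    refine Finset.sum_congr rfl fun r _ => ?_
    rw [hlab, weight_some_none]
    simp

/-- The lower bound is the theorem on oracles for an oracle over a one-letter alphabet. -/
theorem rho_eq_one [Nontrivial A] {x : ℕ → A} (hx : IsNormal x) : rho x = 1 := by
  refine le_antisymm (rho_le_one x) ?_
  refine le_trans ?_ (condRho_le_rho x fun _ => ())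
  exact one_le_condRho (runsErgodic_of_stateFrequencies (stateFrequencies_of_uniform
    (uniform_of_halfUniform (halfUniform_unit_right hx _) (halfUniform_unit_left _ x))))

theorem independent_of_runsErgodic [Fintype B] [Nontrivial A] [Nontrivial B] {x : ℕ → A}
    {y : ℕ → B} (h : RunsErgodic x y) : Independent x y := by
  have h1 := one_le_condRho h
  have h2 := one_le_condRho h.swap
  have hx : rho x = 1 := le_antisymm (rho_le_one x) (h1.trans (condRho_le_rho x y))
  have hy : rho y = 1 := le_antisymm (rho_le_one y) (h2.trans (condRho_le_rho y x))
  refine ⟨le_antisymm (condRho_le_rho x y) ?_, le_antisymm (condRho_le_rho y x) ?_, ?_, ?_⟩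
  · rwa [hx]
  · rwa [hy]
  · simp [hx]
  · simp [hy]

end Ratios

/-! ### Block codes -/

section Codes

/-- A finite set with weights of sum at most `1` has a prefix code in which the code word of `u`
has length `L u + 1`, if `c ^ (- L u)` does not exceed the weight of `u`. -/
lemma exists_prefix_code {U : Type*} [Fintype U] {P : U → ℝ} (hP : ∀ u, 0 ≤ P u)
    (hsum : ∑ u, P u ≤ 1) {c : ℕ} {L : U → ℕ} (hL : ∀ u, 1 ≤ (c : ℝ) ^ L u * P u)
    (hLc : ∀ u, L u < c) :
    ∃ K : U → List (Fin c), (∀ u, (K u).length = L u + 1) ∧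
      ∀ u u' f f', appendSeq (K u) f = appendSeq (K u') f' → u = u' := by
  classical
  have hcard : ∀ k, Fintype.card {u // L u = k} ≤ Fintype.card (Fin k → Fin c) := by
    intro k
    rw [Fintype.card_fun, Fintype.card_fin, Fintype.card_fin]
    have h1 : ((Fintype.card {u // L u = k} : ℕ) : ℝ) ≤ (c : ℝ) ^ k := by
      calc ((Fintype.card {u // L u = k} : ℕ) : ℝ) = ∑ _u : {u // L u = k}, (1 : ℝ) := by simp
        _ ≤ ∑ u : {u // L u = k}, (c : ℝ) ^ k * P u := by
            refine Finset.sum_le_sum fun u _ => ?_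
            have := hL u
            rwa [u.2] at this
        _ = (c : ℝ) ^ k * ∑ u : {u // L u = k}, P u := by rw [Finset.mul_sum]
        _ ≤ (c : ℝ) ^ k * ∑ u, P u := by
            gcongr
            rw [← Finset.sum_subtype (Finset.univ.filter fun u => L u = k) (by simp) P]
            exact Finset.sum_le_univ_sum_of_nonneg hP
        _ ≤ (c : ℝ) ^ k * 1 := by gcongr
        _ = (c : ℝ) ^ k := mul_one _
    exact_mod_cast h1
  have idx := fun k => Classical.choice (Function.Embedding.nonempty_of_card_le (hcard k))
  have hidx : ∀ k u (h : L u = k), List.ofFn (idx (L u) ⟨u, rfl⟩) = List.ofFn (idx k ⟨u, h⟩) := by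
    intro k u h
    subst h
    rfl
  -- The first symbol announces the length of the rest, which is possible since `L u < c`; the rest
  -- numbers the elements with this value of `L`, at most `c ^ L u` of them.
  refine ⟨fun u => ⟨L u, hLc u⟩ :: List.ofFn (idx (L u) ⟨u, rfl⟩), fun u => by simp, ?_⟩
  intro u u' f f' h
  obtain ⟨h1, h2⟩ := consSeq_injective (f := appendSeq _ f) (g := appendSeq _ f') h
  have h3 : L u = L u' := by simpa using h1
  rw [hidx _ u h3] at h2
  have h4 := (appendSeq_injective (by simp) h2).1
  have h5 := (idx _).injective (List.ofFn_injective h4)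
  exact congrArg Subtype.val h5

lemma sum_prod_ofFn {A : Type*} [Fintype A] (q : A → ℝ) (j : ℕ) :
    ∑ f : Fin j → A, ((List.ofFn f).map q).prod = (∑ a, q a) ^ j := by
  induction j with
  | zero => simp
  | succ j ih =>
    have h1 : ∀ f : Fin (j + 1) → A, ((List.ofFn f).map q).prod
        = (fun a v => q a * ((List.ofFn v).map q).prod) (f 0) (Fin.tail f) := by
      intro f
      rw [List.ofFn_succ, List.map_cons, List.prod_cons]
      rfl
    rw [Finset.sum_congr rfl fun f _ => h1 f,
      sum_fin_succ j fun a v => q a * ((List.ofFn v).map q).prod]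
    simp only [← Finset.mul_sum, ih, ← Finset.sum_mul]
    ring

lemma log_prod_map {A : Type*} {q g : A → ℝ} (hq : ∀ a, 0 < q a) (hg : ∀ a, Real.log (q a) = g a)
    (w : List A) : 0 < (w.map q).prod ∧ Real.log (w.map q).prod = (w.map g).sum := by
  induction w with
  | nil => simp
  | cons a w ih =>
    rw [List.map_cons, List.prod_cons, List.map_cons, List.sum_cons, ← ih.2, ← hg a,
      Real.log_mul (hq a).ne' ih.1.ne']
    exact ⟨mul_pos (hq a) ih.1, rfl⟩

variable {A : Type*} [Fintype A]

/-- Prefix codes for pairs of words of total length `m`. -/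
lemma exists_pair_code [Nonempty A] {q : A → ℝ} (hq : ∀ a, 0 ≤ q a) (hq1 : ∑ a, q a = 1) (m : ℕ)
    {c : ℕ} {L : List A → List A → ℕ}
    (hL : ∀ o w : List A, o.length + w.length = m → 1 ≤ (c : ℝ) ^ L o w *
      (((Fintype.card A : ℝ) ^ o.length)⁻¹ * (w.map q).prod / (m + 1)))
    (hLc : ∀ o w : List A, o.length + w.length = m → L o w < c) :
    ∃ K : List A → List A → List (Fin c),
      (∀ o w, o.length + w.length = m → (K o w).length = L o w + 1) ∧
      ∀ o w o' w' f f', o.length + w.length = m → o'.length + w'.length = m →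
        appendSeq (K o w) f = appendSeq (K o' w') f' → o = o' ∧ w = w' := by
  classical
  let U := Σ p : {p // p ∈ Finset.HasAntidiagonal.antidiagonal m}, (Fin p.1.1 → A) × (Fin p.1.2 → A)
  have hA : (0 : ℝ) < Fintype.card A := by exact_mod_cast Fintype.card_pos
  -- A probability distribution: uniform on the `m + 1` ways of dividing the length `m`, then
  -- uniform symbols in the first word and symbols distributed by `q` in the second.
  let P : U → ℝ := fun u => ((Fintype.card A : ℝ) ^ u.1.1.1)⁻¹ *
    ((List.ofFn u.2.2).map q).prod / (m + 1)
  have hlen : ∀ u : U, (List.ofFn u.2.1).length + (List.ofFn u.2.2).length = m := by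
    intro u
    simpa using Finset.HasAntidiagonal.mem_antidiagonal.1 u.1.2
  have hsum : ∑ u, P u ≤ 1 := by
    rw [Fintype.sum_sigma]
    have h1 : ∀ p : {p // p ∈ Finset.HasAntidiagonal.antidiagonal m},
        ∑ v : (Fin p.1.1 → A) × (Fin p.1.2 → A),
        P ⟨p, v⟩ = 1 / ((m : ℝ) + 1) := by
      intro p
      simp only [P]
      rw [Fintype.sum_prod_type]
      simp only [← Finset.sum_div, ← Finset.mul_sum, sum_prod_ofFn, hq1, one_pow, mul_one]
      simp only [Finset.sum_const, Finset.card_univ, nsmul_eq_mul, Fintype.card_fun,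
        Fintype.card_fin]
      push_cast
      field_simp
    simp only [h1]
    simp only [Finset.sum_const, Finset.card_univ, Fintype.card_coe, Finset.Nat.card_antidiagonal,
      nsmul_eq_mul]
    push_cast
    rw [mul_one_div_cancel (by positivity)]
  have hPnn : ∀ u, 0 ≤ P u := by
    intro u
    have : 0 ≤ ((List.ofFn u.2.2).map q).prod :=
      List.prod_nonneg (by simp only [List.mem_map]; rintro _ ⟨a, -, rfl⟩; exact hq a)
    positivity
  obtain ⟨K, hK1, hK2⟩ := exists_prefix_code hPnn hsum
    (L := fun u => L (List.ofFn u.2.1) (List.ofFn u.2.2))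
    (fun u => by simpa [P] using hL _ _ (hlen u)) (fun u => hLc _ _ (hlen u))
  let enc : (o w : List A) → o.length + w.length = m → U := fun o w h =>
    ⟨⟨(o.length, w.length), Finset.HasAntidiagonal.mem_antidiagonal.2 h⟩, (o.get, w.get)⟩
  refine ⟨fun o w => if h : o.length + w.length = m then K (enc o w h) else [], ?_, ?_⟩
  · intro o w h
    simp only [dif_pos h]
    rw [hK1]
    simp [enc, List.ofFn_get]
  · intro o w o' w' f f' h h' heq
    simp only [dif_pos h, dif_pos h'] at heq
    have h1 := hK2 _ _ _ _ heq
    have h2 := congrArg (fun u : U => List.ofFn u.2.1) h1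
    have h3 := congrArg (fun u : U => List.ofFn u.2.2) h1
    simp only [enc, List.ofFn_get] at h2 h3
    exact ⟨h2, h3⟩

lemma le_log_one_add {t : ℝ} (ht : |t| ≤ 1 / 2) : t - 2 * t ^ 2 ≤ Real.log (1 + t) := by
  obtain ⟨h1, h2⟩ := abs_le.1 ht
  have hpos : 0 < 1 + t := by linarith
  refine le_trans ?_ (Real.one_sub_inv_le_log_of_pos hpos)
  have h3 : 1 - (1 + t)⁻¹ - (t - 2 * t ^ 2) = t ^ 2 * (1 + 2 * t) / (1 + t) := by
    field_simp
    ring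
  have h4 : 0 ≤ t ^ 2 * (1 + 2 * t) / (1 + t) :=
    div_nonneg (mul_nonneg (sq_nonneg t) (by linarith)) hpos.le
  linarith

lemma abs_log_one_add_le {t : ℝ} (ht : |t| ≤ 1 / 2) : |Real.log (1 + t)| ≤ 1 := by
  obtain ⟨h1, h2⟩ := abs_le.1 ht
  rw [abs_le]
  constructor
  · have h3 := le_log_one_add ht
    nlinarith
  · have := Real.log_le_sub_one_of_pos (show 0 < 1 + t by linarith)
    linarith

/-- Block codes for pairs of words: if `1 + τ * r a` is the factor by which the symbol `a` is more
frequent than expected in the second word, the code words are shorter accordingly. -/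
lemma exists_block_code [Nonempty A] {r : A → ℝ} (hr : ∀ a, |r a| ≤ 1) (hr0 : ∑ a, r a = 0)
    {τ : ℝ} (hτ : |τ| ≤ 1 / 2) {κ : ℝ} (hκ : 0 < κ) :
    ∃ (m c : ℕ) (K : List A → List A → List (Fin c)), 0 < m ∧ 2 ≤ c ∧
      (∀ o w, o.length + w.length = m → 0 < (K o w).length ∧ (K o w).length ≤ c ∧
        (K o w).length * Real.log c ≤ m * (Real.log (Fintype.card A) + κ)
          - (w.map fun a => Real.log (1 + τ * r a)).sum) ∧
      ∀ o w o' w' f f', o.length + w.length = m → o'.length + w'.length = m →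
        appendSeq (K o w) f = appendSeq (K o' w') f' → o = o' ∧ w = w' := by
  have hA : (1 : ℝ) ≤ Fintype.card A := by exact_mod_cast Fintype.card_pos
  have hlogA : 0 ≤ Real.log (Fintype.card A) := Real.log_nonneg hA
  have ht : ∀ a, |τ * r a| ≤ 1 / 2 := by
    intro a
    rw [abs_mul]
    calc |τ| * |r a| ≤ 1 / 2 * 1 := mul_le_mul hτ (hr a) (abs_nonneg _) (by norm_num)
      _ = 1 / 2 := by norm_num
  have htpos : ∀ a, 0 < 1 + τ * r a := fun a => by linarith [(abs_le.1 (ht a)).1]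
  -- `m * D` bounds `-log P`: per symbol, `log |A|`, plus 1 for the factors `1 + τ * r a`, plus 1
  -- for the denominator `m + 1`.
  set D := ⌈Real.log (Fintype.card A) + 2⌉₊ with hD
  have hDle : Real.log (Fintype.card A) + 2 ≤ D := Nat.le_ceil _
  -- The overhead of a code word: `log (m + 1)` for the division into two words, and `log c` twice,
  -- for rounding up the length and for the announcing symbol.
  obtain ⟨m, hm0, hmκ⟩ : ∃ m : ℕ, 0 < m ∧
      Real.log ((m : ℝ) + 1) + 2 * Real.log ((m : ℝ) * D + 3) ≤ κ * m := by
    have h1 : (fun n : ℕ => Real.log ((n : ℝ) + 1)) =o[atTop] fun n : ℕ => (n : ℝ) + 1 :=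
      Real.isLittleO_log_id_atTop.comp_tendsto
        (tendsto_atTop_add_const_right _ 1 tendsto_natCast_atTop_atTop)
    have hev := (h1.def (c := κ / 6) (by positivity)).and
      ((tendsto_natCast_atTop_atTop.eventually (eventually_ge_atTop
        ((κ / 2 + 2 * Real.log (D + 3)) / (κ / 2)))).and (eventually_gt_atTop 0))
    obtain ⟨m, h2, h3, h4⟩ := hev.exists
    have hm : (0 : ℝ) ≤ m := Nat.cast_nonneg m
    rw [Real.norm_of_nonneg (Real.log_nonneg (by linarith)), Real.norm_of_nonneg (by positivity)]
      at h2
    rw [div_le_iff₀ (by positivity)] at h3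
    refine ⟨m, h4, ?_⟩
    have h5 : Real.log ((m : ℝ) * D + 3) ≤ Real.log ((m : ℝ) + 1) + Real.log (D + 3) := by
      rw [← Real.log_mul (by positivity) (by positivity)]
      refine Real.log_le_log (by positivity) ?_
      have : (0 : ℝ) ≤ D := Nat.cast_nonneg D
      nlinarith
    nlinarith
  have hm : (0 : ℝ) ≤ m := Nat.cast_nonneg m
  -- Large enough for `log c ≥ 1`, whence the code lengths are at most `m * D < c` and can be
  -- announced by a single symbol.
  set c := m * D + 3 with hc
  have hc1 : 1 ≤ Real.log c := by
    rw [Real.le_log_iff_exp_le (by positivity)]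
    have h1 : Real.exp 1 < 3 := Real.exp_one_lt_d9.trans (by norm_num)
    have h2 : (3 : ℝ) ≤ c := by
      rw [hc]
      push_cast
      have : (0 : ℝ) ≤ m * D := by positivity
      linarith
    linarith
  have hcpos : (0 : ℝ) < c := by rw [hc]; positivity
  let q : A → ℝ := fun a => (1 + τ * r a) / Fintype.card A
  have hq : ∀ a, 0 < q a := fun a => div_pos (htpos a) (by linarith)
  have hq1 : ∑ a, q a = 1 := by
    simp only [q, ← Finset.sum_div, Finset.sum_add_distrib, ← Finset.mul_sum, hr0]
    simp only [Finset.sum_const, Finset.card_univ, nsmul_eq_mul]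
    field_simp
    ring
  let P : List A → List A → ℝ := fun o w =>
    ((Fintype.card A : ℝ) ^ o.length)⁻¹ * (w.map q).prod / (m + 1)
  have hsum : ∀ w : List A, (w.map fun a => Real.log (1 + τ * r a) - Real.log (Fintype.card A)).sum
      = (w.map fun a => Real.log (1 + τ * r a)).sum - w.length * Real.log (Fintype.card A) := by
    intro w
    induction w with
    | nil => simp
    | cons a w ih =>
      simp only [List.map_cons, List.sum_cons, List.length_cons, ih]
      push_cast
      ring
  have hP : ∀ o w, o.length + w.length = m → 0 < P o w ∧ -Real.log (P o w)
      = m * Real.log (Fintype.card A) - (w.map fun a => Real.log (1 + τ * r a)).sum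
        + Real.log (m + 1) := by
    intro o w h
    obtain ⟨h1, h2⟩ := log_prod_map (g := fun a => Real.log (1 + τ * r a) -
      Real.log (Fintype.card A)) hq (fun a => by
        simp only [q]
        rw [Real.log_div (htpos a).ne' (by positivity)]) w
    have h3 : (0 : ℝ) < ((Fintype.card A : ℝ) ^ o.length)⁻¹ := by positivity
    refine ⟨by positivity, ?_⟩
    simp only [P]
    rw [Real.log_div (by positivity) (by positivity), Real.log_mul h3.ne' h1.ne', h2, Real.log_inv,
      Real.log_pow, hsum, ← h]
    push_cast
    ring
  let L : List A → List A → ℕ := fun o w => ⌈-Real.log (P o w) / Real.log c⌉₊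
  have hlist : ∀ w : List A, -(w.length : ℝ) ≤ (w.map fun a => Real.log (1 + τ * r a)).sum := by
    intro w
    induction w with
    | nil => simp
    | cons a w ih =>
      simp only [List.map_cons, List.sum_cons, List.length_cons]
      push_cast
      linarith [(abs_le.1 (abs_log_one_add_le (ht a))).1]
  have hLc : ∀ o w, o.length + w.length = m → L o w < m * D + 1 := by
    intro o w h
    refine Nat.lt_succ_of_le (Nat.ceil_le.2 ?_)
    rw [div_le_iff₀ (by linarith)]
    have h1 : -Real.log (P o w) ≤ m * D := by
      rw [(hP o w h).2]
      have h2 := hlist w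
      have h3 : (w.length : ℝ) ≤ m := by
        rw [← h]
        push_cast
        linarith [(Nat.cast_nonneg o.length : (0 : ℝ) ≤ _)]
      have h4 := Real.log_le_sub_one_of_pos (show (0 : ℝ) < m + 1 by positivity)
      nlinarith
    have h5 : (0 : ℝ) ≤ m * D := by positivity
    push_cast
    nlinarith
  have hLP : ∀ o w, o.length + w.length = m → 1 ≤ (c : ℝ) ^ L o w * P o w := by
    intro o w h
    have h1 : -Real.log (P o w) ≤ L o w * Real.log c :=
      (div_le_iff₀ (by linarith)).1 (Nat.le_ceil _)
    have h2 := (hP o w h).1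
    rw [← Real.log_nonneg_iff (by positivity), Real.log_mul (by positivity) h2.ne', Real.log_pow]
    linarith
  obtain ⟨K, hK1, hK2⟩ := exists_pair_code (fun a => (hq a).le) hq1 m (c := c) (L := L) hLP
    (fun o w h => (hLc o w h).trans_le (by omega))
  refine ⟨m, c, K, hm0, by omega, fun o w h => ?_, hK2⟩
  rw [hK1 o w h]
  refine ⟨by omega, by have := hLc o w h; omega, ?_⟩
  have hq_le : ∀ a, q a ≤ 1 := fun a =>
    hq1 ▸ Finset.single_le_sum (f := q) (fun a _ => (hq a).le) (Finset.mem_univ a)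
  have hprod : ∀ w : List A, (w.map q).prod ≤ 1 := by
    intro w
    induction w with
    | nil => simp
    | cons a w ih =>
      rw [List.map_cons, List.prod_cons]
      exact mul_le_one₀ (hq_le a) (List.prod_nonneg (by
        simp only [List.mem_map]
        rintro _ ⟨b, -, rfl⟩
        exact (hq b).le)) ih
  have hP1 : P o w ≤ 1 := by
    refine div_le_one_of_le₀ ?_ (by positivity)
    have h1 : ((Fintype.card A : ℝ) ^ o.length)⁻¹ * (w.map q).prod ≤ 1 * 1 :=
      mul_le_mul (inv_le_one_of_one_le₀ (one_le_pow₀ hA)) (hprod w) (List.prod_nonneg (by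
        simp only [List.mem_map]
        rintro _ ⟨b, -, rfl⟩
        exact (hq b).le)) zero_le_one
    linarith
  have hneg : 0 ≤ -Real.log (P o w) / Real.log c :=
    div_nonneg (neg_nonneg.2 (Real.log_nonpos (hP o w h).1.le hP1)) (by linarith)
  have h1 : (L o w : ℝ) < -Real.log (P o w) / Real.log c + 1 := Nat.ceil_lt_add_one hneg
  have h2 : (L o w : ℝ) * Real.log c ≤ -Real.log (P o w) + Real.log c := by
    have h3 : (L o w : ℝ) * Real.log c ≤ (-Real.log (P o w) / Real.log c + 1) * Real.log c := by
      gcongr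
    rwa [add_mul, div_mul_cancel₀ _ (by linarith), one_mul] at h3
  rw [(hP o w h).2] at h2
  have h4 : Real.log c = Real.log ((m : ℝ) * D + 3) := by rw [hc]; push_cast; rfl
  push_cast
  nlinarith

end Codes

/-! ### Buffered compressors

A run reads two tapes; the symbols of the first tape are collected in two buffers, depending on the
state at which they are read. When the buffers hold `m` symbols, a code word for their contents is
written. -/

section Transport

variable {A B : Type*} [Fintype A] {C : Type} [Fintype C] [Nontrivial C] {σ : Type*}

/-- It suffices that a compressor visits only finitely many states. -/
lemma condRho_le_of_finite {M : ThreeAutomaton A B C σ} (hM : M.IsCompressor) {T : Set σ}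
    (hT : T.Finite) {s : ℕ → σ} (hs : ∀ n, s n ∈ T) {l : ℕ → Option A × Option B × Option C}
    {x : ℕ → A} {y : ℕ → B} {z : ℕ → C} (hr : M.IsAcceptingRun s l x y z) :
    condRho x y ≤ compressionRatio (fun n => (l n).1) (fun n => (l n).2.2) := by
  have := hT.to_subtype
  obtain ⟨N, ⟨e⟩⟩ := Finite.exists_equiv_fin T
  let M' : ThreeAutomaton A B C (Fin N) :=
    ⟨{t | ((e.symm t.1).1, t.2.1, (e.symm t.2.2).1) ∈ M.trans}, {q | (e.symm q).1 ∈ M.init}⟩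
  have hacc : ∀ x y z, M'.Accepts x y z → M.Accepts x y z := by
    rintro x y z ⟨s', l', h1, h2, h3⟩
    exact ⟨fun n => (e.symm (s' n)).1, l', h1, h2, h3⟩
  refine sInf_le ⟨C, Fin N, inferInstance, inferInstance, inferInstance, M',
    fun n => e ⟨s n, hs n⟩, l, z, ⟨⟨?_, ?_⟩, ?_⟩, ⟨?_, ?_, hr.2.2⟩, rfl⟩
  · obtain ⟨q₀, hq₀⟩ := hM.1.1
    have h0 : s 0 = q₀ := by simpa [hq₀] using hr.2.1
    refine ⟨e ⟨s 0, hs 0⟩, ?_⟩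
    ext q
    simp only [M', hq₀, Set.mem_ofPred_eq, Set.mem_singleton_iff]
    constructor
    · intro h
      rw [← e.apply_symm_apply q]
      congr 1
      exact Subtype.ext (h.trans h0.symm)
    · rintro rfl
      simpa using h0
  · intro p w q w' q' h1 h2
    have h3 := hM.1.2 _ _ _ _ _ h1 h2
    refine ⟨h3.1, fun h => ?_⟩
    obtain ⟨h4, h5⟩ := h3.2 h
    exact ⟨h4, e.symm.injective (Subtype.ext h5)⟩
  · exact fun y x x' z h h' => hM.2 y x x' z (hacc _ _ _ h) (hacc _ _ _ h')
  · intro n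
    simpa [M'] using hr.1 n
  · simpa [M'] using hr.2.1

end Transport

/-! ### Words spelled by runs with interposed writing steps -/

section Delay

lemma lengthRead_congr {X : Type*} {α α' : ℕ → Option X} {k : ℕ} (h : ∀ i < k, α i = α' i) :
    lengthRead α k = lengthRead α' k := by
  rw [lengthRead, lengthRead, Nat.count_eq_card_filter_range, Nat.count_eq_card_filter_range]
  congr 1
  refine Finset.filter_congr fun i hi => ?_
  rw [h i (Finset.mem_range.1 hi)]

variable {X : Type*} {α α' : ℕ → Option X} {t : ℕ → ℕ} {R : ℕ → Prop}

lemma lengthRead_delay (h0 : t 0 = 0) (hR : ∀ k, R k → t (k + 1) = t k + 1 ∧ α' k = α (t k))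
    (hW : ∀ k, ¬ R k → t (k + 1) = t k ∧ α' k = none) (k : ℕ) :
    lengthRead α' k = lengthRead α (t k) := by
  induction k with
  | zero => rw [h0, lengthRead_zero, lengthRead_zero]
  | succ k ih =>
    by_cases hk : R k
    · obtain ⟨h1, h2⟩ := hR k hk
      rw [h1]
      cases h : α (t k) with
      | none => rw [lengthRead_succ_none h, lengthRead_succ_none (h2.trans h), ih]
      | some a => rw [lengthRead_succ_some h, lengthRead_succ_some (h2.trans h), ih]
    · obtain ⟨h1, h2⟩ := hW k hk
      rw [h1, lengthRead_succ_none h2, ih]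

lemma spells_delay (h0 : t 0 = 0) (hR : ∀ k, R k → t (k + 1) = t k + 1 ∧ α' k = α (t k))
    (hW : ∀ k, ¬ R k → t (k + 1) = t k ∧ α' k = none) (ht : ∀ n, ∃ k, n ≤ k ∧ t k = n ∧ R k)
    {x : ℕ → X} (h : Spells α x) : Spells α' x := by
  refine ⟨fun k a ha => ?_, fun n => ?_⟩
  · by_cases hk : R k
    · rw [lengthRead_delay h0 hR hW]
      exact h.1 _ _ ((hR k hk).2.symm.trans ha)
    · rw [(hW k hk).2] at ha
      simp at ha
  · obtain ⟨j, hj, hj'⟩ := h.2 n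
    obtain ⟨k, hk, rfl, hRk⟩ := ht j
    exact ⟨k, hj.trans hk, by rwa [(hR k hRk).2]⟩

end Delay

/-! ### The buffered automaton and its decoding -/

section Buffers

variable {A B C Q X Y : Type*}

/-- The number of symbols in the buffers. -/
def bufSize (u : List A × List A) : ℕ := u.1.length + u.2.length

/-- Appends a symbol to the second buffer if `sel` holds, and to the first buffer otherwise. -/
def bufAdd (sel : Prop) (α : Option A) (u : List A × List A) : List A × List A :=
  open Classical in
  match α with
  | none => u
  | some b => if sel then (u.1, u.2 ++ [b]) else (u.1 ++ [b], u.2)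

/-- Empties full buffers; the code word for their contents is to be written. -/
def bufSettle (m : ℕ) (K : List A × List A → List C) (q : X) (u : List A × List A) :
    X × (List A × List A) × List C :=
  if bufSize u = m then (q, ([], []), K u) else (q, u, [])

lemma bufSize_add_none (sel : Prop) (u : List A × List A) :
    bufSize (bufAdd sel none u) = bufSize u := rfl

lemma bufSize_add_some (sel : Prop) (b : A) (u : List A × List A) :
    bufSize (bufAdd sel (some b) u) = bufSize u + 1 := by
  by_cases h : sel
  · simp only [bufAdd, if_pos h, bufSize, List.length_append, List.length_singleton]
    omega
  · simp only [bufAdd, if_neg h, bufSize, List.length_append, List.length_singleton]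
    omega

lemma bufSize_add_le (sel : Prop) (α : Option A) (u : List A × List A) :
    bufSize (bufAdd sel α u) ≤ bufSize u + 1 := by
  cases α with
  | none => rw [bufSize_add_none]; omega
  | some b => rw [bufSize_add_some]

lemma prefix_bufAdd (sel : Prop) (α : Option A) (u : List A × List A) :
    u.1 <+: (bufAdd sel α u).1 ∧ u.2 <+: (bufAdd sel α u).2 := by
  cases α with
  | none => exact ⟨List.prefix_rfl, List.prefix_rfl⟩
  | some b =>
    by_cases h : sel
    · simp [bufAdd, h]
    · simp [bufAdd, h]

lemma eq_of_concat_prefix {u v : List A} {b b' : A} (h : u ++ [b] <+: v) (h' : u ++ [b'] <+: v) :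
    b = b' := by
  have h1 := (List.prefix_of_prefix_length_le h h' (by simp)).eq_of_length (by simp)
  simpa using h1

lemma eq_of_bufAdd_prefix {sel : Prop} {b b' : A} {u v : List A × List A}
    (h1 : (bufAdd sel (some b) u).1 <+: v.1) (h2 : (bufAdd sel (some b) u).2 <+: v.2)
    (h1' : (bufAdd sel (some b') u).1 <+: v.1) (h2' : (bufAdd sel (some b') u).2 <+: v.2) :
    b = b' := by
  by_cases h : sel
  · simp only [bufAdd, if_pos h] at h2 h2'
    exact eq_of_concat_prefix h2 h2'
  · simp only [bufAdd, if_neg h] at h1 h1'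
    exact eq_of_concat_prefix h1 h1'

lemma map_bufSettle (m : ℕ) (K : List A × List A → List C) (f : X → Y) (q : X)
    (u : List A × List A) :
    ((f (bufSettle m K q u).1, (bufSettle m K q u).2) : Y × _) = bufSettle m K (f q) u := by
  by_cases h : bufSize u = m
  · simp [bufSettle, h]
  · simp [bufSettle, h]

variable (s : ℕ → Q) (l : ℕ → Option A × Option B) (p : Q) (m : ℕ) (K : List A × List A → List C)

/-- The automaton that follows a run, fills the buffers with the symbols of the first tape
(depending on whether they are read at `p`) and writes the code words of their contents. -/
def bufAutomaton : ThreeAutomaton A B C (Q × (List A × List A) × List C) where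
  trans := {t | (∃ q d r, t = ((q, ([], []), d :: r), (none, none, some d), (q, ([], []), r))) ∨
    ∃ k u, bufSize u < m ∧ t = ((s k, u, []), ((l k).1, (l k).2, none),
      bufSettle m K (s (k + 1)) (bufAdd (s k = p) (l k).1 u))}
  init := {(s 0, ([], []), [])}

variable {s l p m K}

lemma bufAutomaton_write {q : Q} {u : List A × List A} {d : C} {r : List C}
    {w : Option A × Option B × Option C} {v : Q × (List A × List A) × List C}
    (h : ((q, u, d :: r), w, v) ∈ (bufAutomaton s l p m K).trans) :
    w = (none, none, some d) ∧ v = (q, ([], []), r) := by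
  rcases h with ⟨q', d', r', h⟩ | ⟨k, u', -, h⟩
  · simp only [Prod.mk.injEq, List.cons.injEq] at h
    obtain ⟨⟨rfl, rfl, rfl, rfl⟩, rfl, rfl⟩ := h
    exact ⟨rfl, rfl⟩
  · simp at h

lemma bufAutomaton_read {q : Q} {u : List A × List A}
    {w : Option A × Option B × Option C} {v : Q × (List A × List A) × List C}
    (h : ((q, u, []), w, v) ∈ (bufAutomaton s l p m K).trans) :
    bufSize u < m ∧ ∃ k, s k = q ∧ w = ((l k).1, (l k).2, none) ∧
      v = bufSettle m K (s (k + 1)) (bufAdd (q = p) (l k).1 u) := by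
  rcases h with ⟨q', d', r', h⟩ | ⟨k, u', hu, h⟩
  · simp at h
  · simp only [Prod.mk.injEq] at h
    obtain ⟨⟨rfl, rfl, -⟩, rfl, rfl⟩ := h
    exact ⟨hu, k, rfl, rfl, rfl⟩

lemma isDet₂_bufAutomaton (h : DetRun s l) : (bufAutomaton s l p m K).IsDet₂ := by
  refine ⟨⟨_, rfl⟩, ?_⟩
  rintro ⟨q, u, r⟩ w v w' v' h1 h2
  cases r with
  | cons d r =>
    obtain ⟨rfl, rfl⟩ := bufAutomaton_write h1
    obtain ⟨rfl, rfl⟩ := bufAutomaton_write h2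
    exact ⟨rfl, fun _ => ⟨rfl, rfl⟩⟩
  | nil =>
    obtain ⟨-, k, rfl, rfl, rfl⟩ := bufAutomaton_read h1
    obtain ⟨-, k', hk, rfl, rfl⟩ := bufAutomaton_read h2
    obtain ⟨h3, h4⟩ := h k k' hk.symm
    refine ⟨h3, fun h5 => ?_⟩
    have h6 : l k = l k' := h5
    rw [h6, h4 h6]
    exact ⟨rfl, rfl⟩

section Decoding

variable {S : ℕ → Q × (List A × List A) × List C} {w : ℕ → Option A × Option B × Option C}
  {z : ℕ → C}

lemma exists_suffix_eq_pending (hr : (bufAutomaton s l p m K).IsRun S w)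
    (hz : Spells (fun n => (w n).2.2) z) (r : List C) (k : ℕ) (q : Q)
    (hk : S k = (q, ([], []), r)) :
    ∃ f, suffix z (lengthRead (fun n => (w n).2.2) k) = appendSeq r f := by
  induction r generalizing k with
  | nil => exact ⟨_, rfl⟩
  | cons d r ih =>
    have h1 := hr k
    rw [hk] at h1
    obtain ⟨h2, h3⟩ := bufAutomaton_write h1
    have h4 : (fun n => (w n).2.2) k = some d := by simp [h2]
    obtain ⟨f, hf⟩ := ih (k + 1) h3
    refine ⟨f, ?_⟩
    rw [lengthRead_succ_some h4] at hf
    rw [← consSeq_suffix, hf, hz.1 k d h4]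
    rfl

/-- No symbol is written before the buffers are full, and the buffers only grow until then. So the
next output is the code word of a full pair of buffers extending the present one. The induction runs
over the distance `d` to some later step that writes. -/
lemma exists_suffix_eq_code (hr : (bufAutomaton s l p m K).IsRun S w)
    (hz : Spells (fun n => (w n).2.2) z) (d k : ℕ) (q : Q) (u : List A × List A)
    (hu : bufSize u ≤ m) (hk : S k = bufSettle m K q u) (hd : (w (k + d)).2.2.isSome) :
    ∃ v f, u.1 <+: v.1 ∧ u.2 <+: v.2 ∧ bufSize v = m ∧
      suffix z (lengthRead (fun n => (w n).2.2) k) = appendSeq (K v) f := by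
  induction d generalizing k q u with
  | zero =>
    by_cases hum : bufSize u = m
    · rw [bufSettle, if_pos hum] at hk
      obtain ⟨f, hf⟩ := exists_suffix_eq_pending hr hz _ k q hk
      exact ⟨u, f, List.prefix_rfl, List.prefix_rfl, hum, hf⟩
    · rw [bufSettle, if_neg hum] at hk
      have h1 := hr k
      rw [hk] at h1
      obtain ⟨-, j, -, h2, -⟩ := bufAutomaton_read h1
      rw [add_zero, h2] at hd
      simp at hd
  | succ d ih =>
    by_cases hum : bufSize u = m
    · rw [bufSettle, if_pos hum] at hk
      obtain ⟨f, hf⟩ := exists_suffix_eq_pending hr hz _ k q hk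
      exact ⟨u, f, List.prefix_rfl, List.prefix_rfl, hum, hf⟩
    · rw [bufSettle, if_neg hum] at hk
      have h1 := hr k
      rw [hk] at h1
      obtain ⟨hlt, j, -, h2, h3⟩ := bufAutomaton_read h1
      obtain ⟨v, f, hv1, hv2, hv3, hf⟩ := ih (k + 1) _ _ ((bufSize_add_le _ _ _).trans hlt) h3
        (by rwa [add_right_comm])
      obtain ⟨h4, h5⟩ := prefix_bufAdd (q = p) (l j).1 u
      rw [lengthRead_succ_none (by simp [h2])] at hf
      exact ⟨v, f, h4.trans hv1, h5.trans hv2, hv3, hf⟩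

/-- Two runs with the same oracle and output are compared step by step. While they agree they are in
the same state, hence read the same oracle symbol and have written the same word; the next code word
then reveals the input symbols being buffered. -/
lemma isCompressor_bufAutomaton (h : DetRun s l)
    (hK : ∀ u u' f f', bufSize u = m → bufSize u' = m →
      appendSeq (K u) f = appendSeq (K u') f' → u = u') :
    (bufAutomaton s l p m K).IsCompressor := by
  refine ⟨isDet₂_bufAutomaton h, ?_⟩
  rintro y x x' z ⟨S, w, hr, hi, hx, hy, hz⟩ ⟨S', w', hr', hi', hx', hy', hz'⟩
  have key : ∀ k, S k = S' k ∧ ∀ i < k, w i = w' i := by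
    intro k
    induction k with
    | zero =>
      refine ⟨?_, fun i hi => absurd hi (Nat.not_lt_zero i)⟩
      have h1 : S 0 = _ := hi
      have h2 : S' 0 = _ := hi'
      rw [h1, h2]
    | succ k ih =>
      obtain ⟨ihS, ihw⟩ := ih
      suffices hw : w k = w' k by
        have h1 := hr k
        have h2 := hr' k
        rw [← ihS] at h2
        refine ⟨(((isDet₂_bufAutomaton h).2 _ _ _ _ _ h1 h2).2 (by rw [hw])).2, fun i hi => ?_⟩
        rcases Nat.lt_succ_iff_lt_or_eq.1 hi with hi | rfl
        · exact ihw i hi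
        · exact hw
      have h1 := hr k
      have h2 := hr' k
      rw [← ihS] at h2
      rcases hSk : S k with ⟨q, u, r⟩
      rw [hSk] at h1 h2
      cases r with
      | cons d r => rw [(bufAutomaton_write h1).1, (bufAutomaton_write h2).1]
      | nil =>
        obtain ⟨hu, j, hj, h3, h4⟩ := bufAutomaton_read h1
        obtain ⟨-, j', hj', h3', h4'⟩ := bufAutomaton_read h2
        obtain ⟨h5, -⟩ := h j j' (hj.trans hj'.symm)
        obtain ⟨h6, h7⟩ := supp₂_eq_iff.1 h5
        have hsnd : (l j).2 = (l j').2 := by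
          cases hb : (l j).2 with
          | none => rw [hb] at h7; cases hb' : (l j').2 <;> simp_all
          | some b =>
            cases hb' : (l j').2 with
            | none => simp [hb, hb'] at h7
            | some b' =>
              have h8 := hy.1 k b (by simp [h3, hb])
              have h9 := hy'.1 k b' (by simp [h3', hb'])
              rw [lengthRead_congr (α' := fun n => (w' n).2.1) fun i hi => by rw [ihw i hi]] at h8
              rw [← h8, ← h9]
        -- The state determines which buffer receives the symbol. Both extended buffers are prefixes
        -- of buffers whose code words begin the same remaining output; by the prefix property these
        -- full buffers coincide, and so do the symbols.
        have hfst : (l j).1 = (l j').1 := by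
          cases hb : (l j).1 with
          | none => rw [hb] at h6; cases hb' : (l j').1 <;> simp_all
          | some b =>
            cases hb' : (l j').1 with
            | none => simp [hb, hb'] at h6
            | some b' =>
              rw [hb] at h4
              rw [hb'] at h4'
              have hle : ∀ b, bufSize (bufAdd (q = p) (some b) u) ≤ m :=
                fun b => (bufSize_add_le _ _ _).trans hu
              obtain ⟨n, hn, hn'⟩ := hz.2 (k + 1)
              obtain ⟨n', hn₁, hn₁'⟩ := hz'.2 (k + 1)
              obtain ⟨d, rfl⟩ := Nat.exists_eq_add_of_le hn
              obtain ⟨d', rfl⟩ := Nat.exists_eq_add_of_le hn₁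
              obtain ⟨v, f, hv1, hv2, hv3, hv4⟩ :=
                exists_suffix_eq_code hr hz d (k + 1) _ _ (hle b) h4 hn'
              obtain ⟨v', f', hv1', hv2', hv3', hv4'⟩ :=
                exists_suffix_eq_code hr' hz' d' (k + 1) _ _ (hle b') h4' hn₁'
              rw [lengthRead_succ_none (by simp [h3]),
                lengthRead_congr (α' := fun n => (w' n).2.2) fun i hi => by rw [ihw i hi]] at hv4
              rw [lengthRead_succ_none (by simp [h3'])] at hv4'
              obtain rfl := hK v v' f f' hv3 hv3' (hv4.symm.trans hv4')
              rw [eq_of_bufAdd_prefix hv1 hv2 hv1' hv2']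
        rw [h3, h3', hfst, hsnd]
  have hw : w = w' := funext fun k => (key (k + 1)).2 k (Nat.lt_succ_self k)
  subst hw
  exact hx.unique hx'

end Decoding

end Buffers

/-! ### The run of the buffered automaton and the length of its output -/

section BufferedRun

variable {A B C Q : Type*}

variable (s : ℕ → Q) (l : ℕ → Option A × Option B) (p : Q) (m : ℕ) (K : List A × List A → List C)

/-- One step of the run of the buffered compressor that follows the run `s`, `l`; the state is
represented by the number of steps of `s`, `l` made so far. -/
def bufStep (t : ℕ × (List A × List A) × List C) : ℕ × (List A × List A) × List C :=
  match t with
  | (n, u, []) => bufSettle m K (n + 1) (bufAdd (s n = p) (l n).1 u)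
  | (n, u, _ :: r) => (n, u, r)

/-- The label of a step of the buffered compressor. -/
def bufLabel (t : ℕ × (List A × List A) × List C) : Option A × Option B × Option C :=
  match t with
  | (n, _, []) => ((l n).1, (l n).2, none)
  | (_, _, d :: _) => (none, none, some d)

/-- The states of the run of the buffered compressor. -/
def bufRun (k : ℕ) : ℕ × (List A × List A) × List C :=
  (bufStep s l p m K)^[k] (0, ([], []), [])

variable {s l p m K}

lemma bufRun_succ (k : ℕ) : bufRun s l p m K (k + 1) = bufStep s l p m K (bufRun s l p m K k) :=
  Function.iterate_succ_apply' _ _ _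

lemma bufRun_invariant (hm : 0 < m) {c : ℕ} (hK : ∀ u, bufSize u = m → (K u).length ≤ c) (k : ℕ) :
    bufSize (bufRun s l p m K k).2.1 < m ∧ (bufRun s l p m K k).2.2.length ≤ c ∧
      ((bufRun s l p m K k).2.2 ≠ [] → (bufRun s l p m K k).2.1 = ([], [])) := by
  induction k with
  | zero => exact ⟨hm, Nat.zero_le _, fun h => absurd rfl h⟩
  | succ k ih =>
    rw [bufRun_succ]
    rcases hk : bufRun s l p m K k with ⟨n, u, _ | ⟨d, r⟩⟩
    · rw [hk] at ih
      have h1 : bufSize u < m := ih.1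
      have h2 := bufSize_add_le (s n = p) (l n).1 u
      simp only [bufStep, bufSettle]
      split_ifs with h
      · exact ⟨hm, hK _ h, fun _ => rfl⟩
      · exact ⟨by dsimp only; omega, Nat.zero_le _, fun h => absurd rfl h⟩
    · rw [hk] at ih
      obtain ⟨h1, h2, h3⟩ := ih
      refine ⟨h1, ?_, fun _ => h3 (by simp)⟩
      simp only [bufStep, List.length_cons] at h2 ⊢
      omega

lemma isRun_bufRun (hm : 0 < m) {c : ℕ} (hK : ∀ u, bufSize u = m → (K u).length ≤ c) :
    (bufAutomaton s l p m K).IsRun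
      (fun k => (s (bufRun s l p m K k).1, (bufRun s l p m K k).2))
      (fun k => bufLabel l (bufRun s l p m K k)) := by
  intro k
  have h1 := bufRun_invariant (s := s) (l := l) (p := p) hm hK k
  simp only [bufRun_succ]
  rcases hk : bufRun s l p m K k with ⟨n, u, _ | ⟨d, r⟩⟩
  · rw [hk] at h1
    refine Or.inr ⟨n, u, h1.1, ?_⟩
    simp only [bufStep, bufLabel, map_bufSettle]
  · rw [hk] at h1
    have h2 : u = ([], []) := h1.2.2 (by simp)
    subst h2
    exact Or.inl ⟨s n, d, r, rfl⟩

lemma bufRun_read {k : ℕ} (h : (bufRun s l p m K k).2.2 = []) :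
    (bufRun s l p m K (k + 1)).1 = (bufRun s l p m K k).1 + 1 ∧
      bufLabel l (bufRun s l p m K k)
        = ((l (bufRun s l p m K k).1).1, (l (bufRun s l p m K k).1).2, none) := by
  rw [bufRun_succ]
  rcases hk : bufRun s l p m K k with ⟨n, u, _ | ⟨d, r⟩⟩
  · simp only [bufStep, bufSettle, bufLabel, and_true]
    split_ifs <;> rfl
  · simp [hk] at h

lemma bufRun_write {k : ℕ} (h : ¬ (bufRun s l p m K k).2.2 = []) :
    (bufRun s l p m K (k + 1)).1 = (bufRun s l p m K k).1 ∧
      (bufLabel l (bufRun s l p m K k)).1 = none ∧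
      (bufLabel l (bufRun s l p m K k)).2.1 = none ∧
      (bufLabel l (bufRun s l p m K k)).2.2.isSome := by
  rw [bufRun_succ]
  rcases hk : bufRun s l p m K k with ⟨n, u, _ | ⟨d, r⟩⟩
  · simp [hk] at h
  · exact ⟨rfl, rfl, rfl, rfl⟩

lemma bufRun_flush (r : List C) (k : ℕ) (h : (bufRun s l p m K k).2.2 = r) :
    (bufRun s l p m K (k + r.length)).1 = (bufRun s l p m K k).1 ∧
      (bufRun s l p m K (k + r.length)).2.2 = [] := by
  induction r generalizing k with
  | nil => exact ⟨rfl, h⟩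
  | cons d r ih =>
    have h1 : (bufRun s l p m K (k + 1)).2.2 = r := by
      rw [bufRun_succ]
      rcases hk : bufRun s l p m K k with ⟨n, u, _ | ⟨d', r'⟩⟩
      · simp [hk] at h
      · rw [hk] at h
        exact (List.cons.inj h).2
    have h2 := ih (k + 1) h1
    rw [(bufRun_write (by simp [h])).1] at h2
    rwa [List.length_cons, add_comm r.length 1, ← add_assoc]

lemma exists_bufRun_eq (n : ℕ) :
    ∃ k, n ≤ k ∧ (bufRun s l p m K k).1 = n ∧ (bufRun s l p m K k).2.2 = [] := by
  induction n with
  | zero => exact ⟨0, le_rfl, rfl, rfl⟩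
  | succ n ih =>
    obtain ⟨k, h1, h2, h3⟩ := ih
    obtain ⟨h4, h5⟩ := bufRun_flush _ (k + 1) rfl (s := s) (l := l) (p := p) (m := m) (K := K)
    exact ⟨_, by omega, h4.trans ((bufRun_read h3).1.trans (by rw [h2])), h5⟩

/-- The contribution of a step of the original run to a sum over the second buffer. -/
def bufGain (s : ℕ → Q) (l : ℕ → Option A × Option B) (p : Q) (f : A → ℝ) (n : ℕ) : ℝ :=
  ind (s n = p) * (l n).1.elim 0 f

/-- If the cost of a code word is bounded by the cost of the encoded block, the cost of the output
is bounded by the cost of the input. -/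
lemma bufRun_cost {f : A → ℝ} {E D : ℝ}
    (hK : ∀ u, bufSize u = m → (K u).length * E ≤ m * D - (u.2.map f).sum) (k : ℕ) :
    ((lengthRead (fun k => (bufLabel l (bufRun s l p m K k)).2.2) k : ℝ)
        + (bufRun s l p m K k).2.2.length) * E
      + (bufSize (bufRun s l p m K k).2.1 * D - ((bufRun s l p m K k).2.1.2.map f).sum)
      ≤ lengthRead (fun k => (l k).1) (bufRun s l p m K k).1 * D
        - ∑ n ∈ Finset.range (bufRun s l p m K k).1, bufGain s l p f n := by
  induction k with
  | zero => simp [bufRun, bufSize, lengthRead_zero]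
  | succ k ih =>
    rcases hk : bufRun s l p m K k with ⟨n, u, _ | ⟨d, r⟩⟩
    · rw [lengthRead_succ_none (by simp [hk, bufLabel]), bufRun_succ, hk]
      rw [hk] at ih
      simp only [List.length_nil, Nat.cast_zero, add_zero] at ih
      -- Reading does not change the balance: a symbol put into a buffer costs `D` on both sides and
      -- earns `f` on both sides exactly if it is read at `p`. The bound on code words is only used
      -- when the buffers are emptied.
      have hstep : bufSize (bufAdd (s n = p) (l n).1 u) * D
            - ((bufAdd (s n = p) (l n).1 u).2.map f).sum
            - (lengthRead (fun k => (l k).1) (n + 1) * D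
              - ∑ j ∈ Finset.range (n + 1), bufGain s l p f j)
          = bufSize u * D - (u.2.map f).sum - (lengthRead (fun k => (l k).1) n * D
              - ∑ j ∈ Finset.range n, bufGain s l p f j) := by
        rw [Finset.sum_range_succ]
        cases hb : (l n).1 with
        | none =>
          rw [lengthRead_succ_none hb]
          simp [bufGain, hb, bufAdd]
        | some b =>
          rw [lengthRead_succ_some hb, bufSize_add_some]
          by_cases hp : s n = p
          · simp only [bufAdd, if_pos hp, bufGain, ind_of hp, hb, Option.elim, List.map_append,
              List.sum_append, List.map_cons, List.map_nil, List.sum_cons, List.sum_nil]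
            push_cast
            ring
          · simp only [bufAdd, if_neg hp, bufGain, ind_of_not hp]
            push_cast
            ring
      simp only [bufStep, bufSettle]
      split_ifs with h
      · have h1 := hK _ h
        rw [h] at hstep
        simp only [bufSize, List.length_nil, List.map_nil, List.sum_nil, add_zero, Nat.cast_zero]
        simp only [bufSize] at ih hstep
        nlinarith
      · simp only [List.length_nil, Nat.cast_zero, add_zero]
        linarith
    · rw [lengthRead_succ_some (a := d) (by simp [hk, bufLabel]), bufRun_succ, hk]
      rw [hk] at ih
      simp only [bufStep, List.length_cons] at ih ⊢
      push_cast at ih ⊢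
      linarith

/-- The buffered compressor writes infinitely many symbols. -/
lemma exists_bufLabel_isSome (hm : 0 < m) {c : ℕ}
    (hK : ∀ u, bufSize u = m → 0 < (K u).length ∧ (K u).length ≤ c)
    {x : ℕ → A} (hx : Spells (fun n => (l n).1) x) (N : ℕ) :
    ∃ k, N ≤ k ∧ (bufLabel l (bufRun s l p m K k)).2.2.isSome := by
  by_contra! hcon
  have hconst : ∀ k, N ≤ k → lengthRead (fun k => (bufLabel l (bufRun s l p m K k)).2.2) k
      = lengthRead (fun k => (bufLabel l (bufRun s l p m K k)).2.2) N :=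
    fun k hk => lengthRead_eq_of_none hk fun i hi _ => Option.not_isSome_iff_eq_none.1 (hcon i hi)
  obtain ⟨n, hn, hn'⟩ := ((hx.tendsto_lengthRead.eventually (eventually_gt_atTop
    (m * (lengthRead (fun k => (bufLabel l (bufRun s l p m K k)).2.2) N + 1)))).and
    (eventually_ge_atTop N)).exists
  obtain ⟨k, hk, rfl, hk'⟩ := exists_bufRun_eq (s := s) (l := l) (p := p) (m := m) (K := K) n
  -- With these costs the inequality says that the number of symbols read is at most `m` times the
  -- number of symbols written, plus the contents of the buffers.
  have h1 := bufRun_cost (s := s) (l := l) (p := p) (m := m) (K := K) (f := fun _ => 0)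
    (E := -m) (D := -1) (fun u hu => by
      have h2 : (1 : ℝ) ≤ (K u).length := by exact_mod_cast (hK u hu).1
      simp only [List.map_const', List.sum_replicate, smul_zero]
      nlinarith [(Nat.cast_nonneg m : (0 : ℝ) ≤ m)]) k
  have h2 := (bufRun_invariant (s := s) (l := l) (p := p) hm (fun u hu => (hK u hu).2) k).1
  rw [hconst k (hn'.trans hk), hk'] at h1
  simp only [bufGain, List.map_const', List.sum_replicate, smul_zero, List.length_nil,
    Nat.cast_zero, add_zero, sub_zero] at h1
  have h3 : ∀ j, (l j).1.elim (0 : ℝ) (fun _ => 0) = 0 := fun j => by cases (l j).1 <;> rfl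
  simp only [h3, mul_zero, Finset.sum_const_zero, sub_zero] at h1
  have h4 : (bufSize (bufRun s l p m K k).2.1 : ℝ) < m := by exact_mod_cast h2
  have h5 : (m : ℝ) * (lengthRead (fun k => (bufLabel l (bufRun s l p m K k)).2.2) N + 1)
      < lengthRead (fun n => (l n).1) (bufRun s l p m K k).1 := by exact_mod_cast hn
  nlinarith

end BufferedRun

/-! ### Biased symbols allow compression -/

section Compression

variable {A B : Type*} [Fintype A]

lemma finite_bufStates {C Q : Type*} [Finite C] [Finite Q] (m c : ℕ) :
    {t : Q × (List A × List A) × List C | bufSize t.2.1 < m ∧ t.2.2.length ≤ c}.Finite := by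
  have h1 := List.finite_length_le A m
  refine (Set.finite_univ.prod ((h1.prod h1).prod (List.finite_length_le C c))).subset ?_
  rintro ⟨q, ⟨o, w⟩, r⟩ ⟨h2, h3⟩
  simp only [bufSize] at h2 h3
  exact ⟨Set.mem_univ _, ⟨show o.length ≤ m by omega, show w.length ≤ m by omega⟩, h3⟩

/-- A block code yields a compressor. -/
lemma condRho_le_bufRatio {Q : Type*} [Finite Q] {s : ℕ → Q} {l : ℕ → Option A × Option B}
    {x : ℕ → A} {y : ℕ → B} (h : DetRunOn s l x y) (p : Q) {m c : ℕ}
    {K : List A × List A → List (Fin c)} (hm : 0 < m) (hc : 2 ≤ c)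
    (hK : ∀ u, bufSize u = m → 0 < (K u).length ∧ (K u).length ≤ c)
    (hK' : ∀ u u' f f', bufSize u = m → bufSize u' = m →
      appendSeq (K u) f = appendSeq (K u') f' → u = u') :
    condRho x y ≤ compressionRatio (fun k => (bufLabel l (bufRun s l p m K k)).1)
      (fun k => (bufLabel l (bufRun s l p m K k)).2.2) := by
  have : Nontrivial (Fin c) := Fin.nontrivial_iff_two_le.2 hc
  have hKc := fun u hu => (hK u hu).2
  obtain ⟨z, hz⟩ := exists_spells (exists_bufLabel_isSome (s := s) (p := p) hm hK h.fst)
  refine condRho_le_of_finite (isCompressor_bufAutomaton h.det hK')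
    (finite_bufStates (A := A) (C := Fin c) (Q := Q) m c)
    (s := fun k => (s (bufRun s l p m K k).1, (bufRun s l p m K k).2))
    (fun k => ?_) (z := z) ⟨isRun_bufRun hm hKc, rfl, ?_, ?_, hz⟩
  · obtain ⟨h1, h2, -⟩ := bufRun_invariant (s := s) (l := l) (p := p) hm hKc k
    exact ⟨h1, h2⟩
  · exact spells_delay (t := fun k => (bufRun s l p m K k).1)
      (R := fun k => (bufRun s l p m K k).2.2 = []) rfl
      (fun k hk => ⟨(bufRun_read hk).1, by rw [(bufRun_read hk).2]⟩)
      (fun k hk => ⟨(bufRun_write hk).1, (bufRun_write hk).2.1⟩) exists_bufRun_eq h.fst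
  · exact spells_delay (t := fun k => (bufRun s l p m K k).1)
      (R := fun k => (bufRun s l p m K k).2.2 = []) rfl
      (fun k hk => ⟨(bufRun_read hk).1, by rw [(bufRun_read hk).2]⟩)
      (fun k hk => ⟨(bufRun_write hk).1, (bufRun_write hk).2.2.1⟩) exists_bufRun_eq h.snd

/-- A bias of the symbols read at a state can be used for compression. -/
lemma condRho_lt_one [Nontrivial A] {Q : Type*} [Finite Q] {s : ℕ → Q}
    {l : ℕ → Option A × Option B} {x : ℕ → A} {y : ℕ → B} (h : DetRunOn s l x y) {p : Q}
    {r : A → ℝ} (hr : ∀ a, |r a| ≤ 1) (hr0 : ∑ a, r a = 0) {ε : ℝ} (hε : 0 < ε) {τ : ℝ}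
    (hτ : |τ| = ε / 4) (hτ' : |τ| ≤ 1 / 2)
    (hfreq : ∃ᶠ n : ℕ in atTop, ε ^ 2 / 4 * n < τ * ∑ k ∈ Finset.range n, bufGain s l p r k) :
    condRho x y < 1 := by
  have hlogA : 0 < Real.log (Fintype.card A) :=
    Real.log_pos (by exact_mod_cast Fintype.one_lt_card)
  obtain ⟨m, c, K, hm, hc, hK, hK'⟩ := exists_block_code hr hr0 hτ'
    (show 0 < ε ^ 2 / 32 by positivity)
  set f : A → ℝ := fun a => Real.log (1 + τ * r a) with hf
  have ht : ∀ a, |τ * r a| ≤ 1 / 2 := by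
    intro a
    rw [abs_mul]
    calc |τ| * |r a| ≤ 1 / 2 * 1 := mul_le_mul hτ' (hr a) (abs_nonneg _) (by norm_num)
      _ = 1 / 2 := by norm_num
  have hτsq : τ ^ 2 = ε ^ 2 / 16 := by rw [← sq_abs, hτ]; ring
  -- The quadratic error `2 * (τ * r a) ^ 2` of the logarithm is at most `ε ^ 2 / 8`, half of the
  -- gain `ε ^ 2 / 4` per step provided by the bias.
  have hgain : ∀ k, τ * bufGain s l p r k - ε ^ 2 / 8 ≤ bufGain s l p f k := by
    intro k
    by_cases hk : s k = p
    · simp only [bufGain, ind_of hk, one_mul]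
      cases (l k).1 with
      | none => simp only [Option.elim]; nlinarith [sq_nonneg ε]
      | some a =>
        simp only [Option.elim]
        have h1 := le_log_one_add (ht a)
        have h2 : r a ^ 2 ≤ 1 := by rw [← sq_abs]; exact pow_le_one₀ (abs_nonneg _) (hr a)
        have h3 : (τ * r a) ^ 2 ≤ ε ^ 2 / 16 := by
          rw [mul_pow, hτsq]
          nlinarith [sq_nonneg ε]
        simp only [hf]
        linarith
    · simp only [bufGain, ind_of_not hk, zero_mul, mul_zero]
      nlinarith [sq_nonneg ε]
  have hsum : ∀ n, τ * ∑ k ∈ Finset.range n, bufGain s l p r k - ε ^ 2 / 8 * n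
      ≤ ∑ k ∈ Finset.range n, bufGain s l p f k := by
    intro n
    calc τ * ∑ k ∈ Finset.range n, bufGain s l p r k - ε ^ 2 / 8 * n
        = ∑ k ∈ Finset.range n, (τ * bufGain s l p r k - ε ^ 2 / 8) := by
          rw [Finset.sum_sub_distrib, ← Finset.mul_sum]
          simp
          ring
      _ ≤ _ := Finset.sum_le_sum fun k _ => hgain k
  have hlist : ∀ w : List A, (w.map f).sum ≤ w.length := by
    intro w
    induction w with
    | nil => simp
    | cons a w ih =>
      simp only [List.map_cons, List.sum_cons, List.length_cons]
      push_cast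
      linarith [(abs_le.1 (abs_log_one_add_le (ht a))).2]
  let K₂ : List A × List A → List (Fin c) := fun u => K u.1 u.2
  refine (condRho_le_bufRatio h p (K := K₂) hm hc (fun u hu => ⟨(hK _ _ hu).1, (hK _ _ hu).2.1⟩)
    fun u u' g g' hu hu' he => Prod.ext_iff.2 (hK' _ _ _ _ g g' hu hu' he)).trans_lt ?_
  set η := ε ^ 2 / (16 * Real.log (Fintype.card A)) with hη
  have hηpos : 0 < η := by positivity
  have hlt : ENNReal.ofReal (1 - η) < 1 := by
    rw [← ENNReal.ofReal_one, ENNReal.ofReal_lt_ofReal_iff one_pos]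
    linarith
  -- The ratio is a lower limit, so a bias at infinitely many times suffices.
  refine lt_of_le_of_lt (liminf_le_of_frequently_le ?_ (by isBoundedDefault)) hlt
  rw [frequently_atTop]
  intro N
  obtain ⟨n, ⟨⟨hn1, hn2⟩, hn3⟩, hn4⟩ :=
    ((hfreq.and_eventually (eventually_ge_atTop N)).and_eventually
    (h.fst.tendsto_lengthRead.eventually (eventually_gt_atTop 0))).and_eventually
    (tendsto_natCast_atTop_atTop.eventually (eventually_ge_atTop (m / (ε ^ 2 / 32)))) |>.exists
  obtain ⟨k, hk, hkn, hk'⟩ := exists_bufRun_eq (s := s) (l := l) (p := p) (m := m) (K := K₂) n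
  refine ⟨k, hn2.trans hk, ENNReal.ofReal_le_ofReal ?_⟩
  rw [lengthRead_delay (α := fun k => (l k).1) (t := fun k => (bufRun s l p m K₂ k).1)
      (R := fun k => (bufRun s l p m K₂ k).2.2 = []) rfl
      (fun k hk => ⟨(bufRun_read hk).1, by rw [(bufRun_read hk).2]⟩)
      (fun k hk => ⟨(bufRun_write hk).1, (bufRun_write hk).2.1⟩), hkn, Fintype.card_fin]
  have h1 := bufRun_cost (s := s) (l := l) (p := p) (m := m) (K := K₂) (f := f)
    (E := Real.log c) (D := Real.log (Fintype.card A) + ε ^ 2 / 32)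
    (fun u hu => (hK _ _ hu).2.2) k
  have h2 := (bufRun_invariant (s := s) (l := l) (p := p) (K := K₂) hm
    (fun u hu => (hK _ _ hu).2.1) k).1
  rw [hk', hkn] at h1
  set R := lengthRead (fun k => (l k).1) n
  set u := (bufRun s l p m K₂ k).2.1
  set O := lengthRead (fun k => (bufLabel l (bufRun s l p m K₂ k)).2.2) k
  simp only [List.length_nil, Nat.cast_zero, add_zero] at h1
  have hR : (0 : ℝ) < R := by exact_mod_cast hn3
  have hRn : (R : ℝ) ≤ n := by exact_mod_cast lengthRead_le _ _
  have h3 : (u.2.map f).sum ≤ m := (hlist u.2).trans (by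
    have : u.2.length ≤ m := by simp only [bufSize] at h2; omega
    exact_mod_cast this)
  have h4 : 0 ≤ (bufSize u : ℝ) * (Real.log (Fintype.card A) + ε ^ 2 / 32) := by positivity
  rw [div_le_iff₀ (by positivity)] at hn4
  have h5 := hsum n
  have h6 : (R : ℝ) * (ε ^ 2 / 32) ≤ n * (ε ^ 2 / 32) := by gcongr
  -- Of the gain `ε ^ 2 / 8` per step, the overhead of the code and the symbols still in the buffers
  -- take at most `ε ^ 2 / 32` each.
  have h7 : (O : ℝ) * Real.log c ≤ R * Real.log (Fintype.card A) - ε ^ 2 / 16 * n := by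
    linarith
  have h8 : ε ^ 2 / 16 * R ≤ ε ^ 2 / 16 * n := by gcongr
  rw [div_mul_div_comm, div_le_iff₀ (by positivity)]
  have h9 : (1 - η) * (R * Real.log (Fintype.card A))
      = R * Real.log (Fintype.card A) - ε ^ 2 / 16 * R := by
    rw [hη]
    field_simp
  linarith

/-- If the deviation of `a` is not o(n), it exceeds `ε * n` infinitely often in one of the two
directions; the sign of `τ` is chosen accordingly, so that the code favours or disfavours `a` at
this state. -/
theorem halfUniform_of_one_le_condRho [Nontrivial A] [Fintype B] {x : ℕ → A} {y : ℕ → B}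
    (h : 1 ≤ condRho x y) : HalfUniform x y := by
  intro N s l hrun hsingle k₀ a hk₀
  have hA : (0 : ℝ) < Fintype.card A := by exact_mod_cast Fintype.card_pos
  have hA1 : 1 / (Fintype.card A : ℝ) ≤ 1 := by
    rw [div_le_one hA]
    exact_mod_cast Fintype.card_pos
  let r : A → ℝ := fun b => ind (a = b) - 1 / (Fintype.card A : ℝ)
  have hr : ∀ b, |r b| ≤ 1 := fun b => abs_ind_sub_le (by positivity) hA1
  have hr0 : ∑ b, r b = 0 := by
    simp only [r, Finset.sum_sub_distrib, sum_ind_eq, Finset.sum_const, Finset.card_univ,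
      nsmul_eq_mul]
    field_simp
    ring
  have hdev : ∀ n, dev s l (s k₀) (some a, none) n
      = ∑ k ∈ Finset.range n, bufGain s l (s k₀) r k := by
    intro n
    refine Finset.sum_congr rfl fun k _ => ?_
    by_cases hk : s k = s k₀
    · have h1 := (supp₂_eq_iff.1 (hrun.det k k₀ hk).1).1
      have h2 : (l k).1.isSome := by rw [h1]; exact hk₀
      have h3 := hsingle k
      rcases hl : l k with ⟨_ | b, _ | b'⟩
      · simp [hl] at h2
      · simp [hl] at h2
      · simp only [bufGain, hl, Option.elim, r, weight_some_none]
        rw [ind_congr (show ((some b, none) : Option A × Option B) = (some a, none) ↔ a = b by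
          simp [eq_comm])]
      · simp [Single, hl] at h3
    · simp only [bufGain, ind_of_not hk, zero_mul]
  by_contra hcon
  rw [isLittleO_iff] at hcon
  push Not at hcon
  obtain ⟨ε, hε, hfreq⟩ := hcon
  have hbound : ∀ n, |dev s l (s k₀) (some a, none) n| ≤ n := by
    intro n
    rw [hdev]
    refine (Finset.abs_sum_le_sum_abs _ _).trans ?_
    have : ∀ k ∈ Finset.range n, |bufGain s l (s k₀) r k| ≤ 1 := by
      intro k _
      rw [bufGain, abs_mul, abs_of_nonneg (ind_nonneg _)]
      refine mul_le_one₀ (ind_le_one _) (abs_nonneg _) ?_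
      cases (l k).1 with
      | none => simp
      | some b => exact hr b
    simpa using Finset.sum_le_sum this
  -- The deviation never exceeds `n`; this ensures that `|τ| = ε / 4` is at most `1 / 2`.
  have hε1 : ε < 1 := by
    obtain ⟨n, hn⟩ := hfreq.exists
    rw [Real.norm_of_nonneg (Nat.cast_nonneg n), Real.norm_eq_abs] at hn
    have h1 := hn.trans_le (hbound n)
    by_contra! hle
    nlinarith [(Nat.cast_nonneg n : (0 : ℝ) ≤ n)]
  have hfreq' : (∃ᶠ n : ℕ in atTop, ε * n < dev s l (s k₀) (some a, none) n) ∨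
      ∃ᶠ n : ℕ in atTop, ε * n < -dev s l (s k₀) (some a, none) n := by
    rw [← frequently_or_distrib]
    refine hfreq.mono fun n hn => ?_
    rw [Real.norm_of_nonneg (Nat.cast_nonneg n), Real.norm_eq_abs] at hn
    exact lt_abs.1 hn
  refine absurd h (not_le.2 ?_)
  rcases hfreq' with hf | hf
  · refine condRho_lt_one hrun (p := s k₀) hr hr0 hε (τ := ε / 4) (abs_of_pos (by positivity))
      (by rw [abs_of_pos (by positivity)]; linarith) (hf.mono fun n hn => ?_)
    rw [← hdev]
    nlinarith
  · refine condRho_lt_one hrun (p := s k₀) hr hr0 hε (τ := -(ε / 4))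
      (by rw [abs_neg, abs_of_pos (by positivity)])
      (by rw [abs_neg, abs_of_pos (by positivity)]; linarith) (hf.mono fun n hn => ?_)
    rw [← hdev]
    nlinarith

end Compression

/-! ### The equivalences -/

section Characterization

variable {A B : Type*} [Fintype A] [Fintype B] {x : ℕ → A} {y : ℕ → B}

theorem stateFrequencies_of_halfUniform (hx : HalfUniform x y) (hy : HalfUniform y x) :
    StateFrequencies x y :=
  stateFrequencies_of_uniform (uniform_of_halfUniform hx hy)

variable [Nontrivial A] [Nontrivial B]

/-- Normal words have ratio 1, so independence forces both conditional ratios to be 1, and no bias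
can be exploited in either direction. -/
theorem stateFrequencies_of_independent (hx : IsNormal x) (hy : IsNormal y)
    (h : Independent x y) : StateFrequencies x y :=
  stateFrequencies_of_halfUniform
    (halfUniform_of_one_le_condRho (h.1.trans (rho_eq_one hx)).ge)
    (halfUniform_of_one_le_condRho (h.2.1.trans (rho_eq_one hy)).ge)

theorem tfae_independent (hx : IsNormal x) (hy : IsNormal y) :
    [Independent x y, StateFrequencies x y, SelectionsNormal x y ∧ SelectionsNormal y x].TFAE := by
  tfae_have 1 → 2 := stateFrequencies_of_independent hx hy
  tfae_have 2 → 1 := fun h => independent_of_runsErgodic (runsErgodic_of_stateFrequencies h)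
  tfae_have 2 → 3 := fun h =>
    have he := runsErgodic_of_stateFrequencies h
    ⟨selectionsNormal_of_runsErgodic he, selectionsNormal_of_runsErgodic he.swap⟩
  tfae_have 3 → 2 := fun h => stateFrequencies_of_halfUniform
    (halfUniform_of_selectionsNormal h.1) (halfUniform_of_selectionsNormal h.2)
  tfae_finish

end Characterization

end FSI

end

theorem theorem1 {A : Type*} [Fintype A] [Nontrivial A] (x : ℕ → A) (hx : FSI.IsNormal x) :
    (∀ {B : Type*} [Fintype B] [Nontrivial B] (y : ℕ → B), FSI.IsNormal y →
      [FSI.Independent x y,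
        FSI.StateFrequencies x y,
        FSI.SelectionsNormal x y ∧ FSI.SelectionsNormal y x].TFAE) ∧
    (∀ y : ℕ → A, FSI.IsNormal y →
      [FSI.Independent x y,
        FSI.StateFrequencies x y,
        FSI.SelectionsNormal x y ∧ FSI.SelectionsNormal y x,
        FSI.ShufflesNormal x y].TFAE) := by
  refine ⟨fun y hy => FSI.tfae_independent hx hy, fun y hy => ?_⟩
  have h := FSI.tfae_independent hx hy
  tfae_have 1 ↔ 2 := h.out 0 1
  tfae_have 2 ↔ 3 := h.out 1 2
  tfae_have 2 → 4 := fun h =>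
    FSI.shufflesNormal_of_runsErgodic (FSI.runsErgodic_of_stateFrequencies h)
  tfae_have 4 → 2 := fun h => FSI.stateFrequencies_of_halfUniform
    (FSI.halfUniform_of_shufflesNormal h).1 (FSI.halfUniform_of_shufflesNormal h).2
  tfae_finish
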